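/- Let $T>0$ and let $\Omega\subset\mathbb R^3$ and $\mathcal S_0$, $\overline{\mathcal S_0}\subset\Omega$, be bounded domains of class $C^{2+\kappa}$, $\kappa>0$. Let $u\in C([0,T];\mathcal D(\overline\Omega))$, where $\mathcal D(\overline\Omega)$ is the space of restrictions to $\overline\Omega$ of smooth compactly supported vector fields on $\mathbb R^3$ with the topology of uniform convergence of all derivatives, and let $\rho\in L^2(0,T;H^2(\Omega))\cap C([0,T];H^1(\Omega))$ with $\rho(t)\ge 0$ a.e. in $\Omega$ for every $t\in[0,T]$ and $\int_{\mathcal S_0}\rho(0)>0$; $\rho$ is extended by zero outside $\Omega$. For a function $\chi$ on $[0,T]\times\mathbb R^3$ put, at each time $t$, $$m=\int_{\mathbb R^3}\rho\chi\,dx,\qquad h=\frac1m\int_{\mathbb R^3}\rho\chi\,x\,dx,\qquad J=\int_{\mathbb R^3}\rho\chi\big[|x-h|^2\mathbb I-(x-h)\otimes(x-h)\big]dx,$$ $$P_\chi u(t,x)=\frac1m\int_\Omega\rho\chi u\,dy+\Big(J^{-1}\int_\Omega\rho\chi\,((y-h)\times u)\,dy\Big)\times(x-h),\qquad x\in\mathbb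 R^3 .$$ For $0<\tau\le T$, a body motion on $[0,\tau)$ is a family of isometries $\eta_t$ of $\mathbb R^3$, $t\in[0,\tau)$, with $\eta_0=\mathrm{id}$, with $m(t)=\int_{\eta_t(\mathcal S_0)\cap\Omega}\rho(t)>0$, and with $\partial_t\eta_t(y)=P_\chi u(t,\eta_t(y))$ for all $y\in\mathbb R^3$, where $\chi(t)=\mathbb 1_{\eta_t(\mathcal S_0)}$. We say that the mass persists up to time $T$ if for every $\tau\in(0,T]$ and every body motion on $[0,\tau)$ one has $\inf_{[0,\tau)}m>0$ (so that $P_\chi u$ does not cease to be defined because the body has left $\Omega$). The mass always persists up to some time $\tau\in(0,T]$. If it persists up to time $T$, then the following holds. 1. There is a unique weak solution $\chi_{\mathcal S}\in L^\infty((0,T)\times\mathbb R^3)\cap C([0,T];L^p(\mathbb R^3))$ for all $1\le p<\infty$ of $$\partial_t\chi_{\mathcal S}+\operatorname{div}(\chi_{\mathcal S}\,P_{\mathcal S}u)=0\ \text{ in }(0,T)\times\mathbb R^3,\qquad \chi_{\mathcal S}|_{t=0}=\mathbb 1_{\mathcal S_0},$$ where $P_{\mathcal S}u=P_{\chi_{\mathcal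 S}}u$; along it $m(t)>0$ and $J(t)$ is invertible for all $t\in[0,T]$. Moreover $\chi_{\mathcal S}(t,x)=\mathbb 1_{\mathcal S(t)}(x)$ for all $t\in[0,T]$ and $x\in\mathbb R^3$, with $\mathcal S(t)=\eta_{t,0}(\mathcal S_0)$, where $(\eta_{t,s})_{t,s\in[0,T]}$ is the unique family with $\partial_t\eta_{t,s}(y)=P_{\mathcal S}u(t,\eta_{t,s}(y))$ and $\eta_{s,s}(y)=y$ for all $y\in\mathbb R^3$; each $\eta_{t,s}$ is an isometry, and $(t,s)\mapsto\eta_{t,s}$ belongs to $C^1([0,T]^2;C^\infty_{loc}(\mathbb R^3))$. 2. If $\rho_0\mathbb 1_{\mathcal S_0}\in L^\infty(\mathbb R^3)$, then, with the field $P_{\mathcal S}u$ of part 1, there is a unique weak solution $r\in L^\infty((0,T)\times\mathbb R^3)\cap C([0,T];L^p(\mathbb R^3))$ for all $1\le p<\infty$ (the transported solid density, denoted $\rho\chi_{\mathcal S}$) of $$\partial_t r+\operatorname{div}(r\,P_{\mathcal S}u)=0\ \text{ in }(0,T)\times\mathbb R^3,\qquad r|_{t=0}=\rho_0\mathbb 1_{\mathcal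 S_0}.$$ -/

import Mathlib

open Set Filter Topology MeasureTheory
open scoped ENNReal NNReal ContDiff

noncomputable section

namespace RigidTransport

/-- Three-dimensional Euclidean space. -/
abbrev E3 : Type := EuclideanSpace ℝ (Fin 3)

/-! ### Domains -/

/-- A bounded domain (open, connected, nonempty) of class `C^{2+κ}` for some `0 < κ ≤ 1`: near each
boundary point it is the sublevel set `{g < 0}` of a `C^{2+κ}` function with nonzero differential. -/
structure IsRegularDomain (D : Set E3) : Prop where
  isOpen : IsOpen D
  isConnected : IsConnected D
  isBounded : Bornology.IsBounded D
  boundary : ∃ κ : ℝ≥0, 0 < κ ∧ κ ≤ 1 ∧ ∀ x ∈ frontier D,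
    ∃ (U : Set E3) (g : E3 → ℝ), IsOpen U ∧ x ∈ U ∧ ContDiffOn ℝ 2 g U ∧
      (∃ C : ℝ≥0, HolderOnWith C κ (iteratedFDeriv ℝ 2 g) U) ∧
      fderiv ℝ g x ≠ 0 ∧ D ∩ U = {y ∈ U | g y < 0}

/-! ### Function spaces for the data -/

/-- `f'` is the weak (distributional) derivative of `f` in the open set `Ω`. -/
def HasWeakFDerivOn {F : Type*} [NormedAddCommGroup F] [NormedSpace ℝ F]
    (Ω : Set E3) (f : E3 → F) (f' : E3 → E3 →L[ℝ] F) : Prop :=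
  ∀ φ : E3 → ℝ, ContDiff ℝ ∞ φ → HasCompactSupport φ → tsupport φ ⊆ Ω → ∀ v : E3,
    ∫ x in Ω, (fderiv ℝ φ x v) • f x = - ∫ x in Ω, φ x • f' x v

/-- `L^2(Ω; F)`. -/
abbrev L2 (Ω : Set E3) (F : Type*) [NormedAddCommGroup F] : Type _ :=
  Lp F 2 ((volume : Measure E3).restrict Ω)

/-- `ρ ∈ C([0,T]; H¹(Ω))`. -/
def IsContinuousH1 (T : ℝ) (Ω : Set E3) (ρ : ℝ → L2 Ω ℝ) : Prop :=
  ∃ Dρ : ℝ → L2 Ω (E3 →L[ℝ] ℝ),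
    (∀ t ∈ Icc 0 T, HasWeakFDerivOn Ω (ρ t) (Dρ t)) ∧
    ContinuousOn ρ (Icc 0 T) ∧ ContinuousOn Dρ (Icc 0 T)

/-- `ρ ∈ L²(0,T; H²(Ω))` (Bochner). -/
def IsSquareIntegrableH2 (T : ℝ) (Ω : Set E3) (ρ : ℝ → L2 Ω ℝ) : Prop :=
  ∃ (Dρ : ℝ → L2 Ω (E3 →L[ℝ] ℝ)) (D2ρ : ℝ → L2 Ω (E3 →L[ℝ] E3 →L[ℝ] ℝ)),
    (∀ᵐ t ∂(volume.restrict (Ioo 0 T)),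
      HasWeakFDerivOn Ω (ρ t) (Dρ t) ∧ HasWeakFDerivOn Ω (Dρ t) (D2ρ t)) ∧
    MemLp ρ 2 (volume.restrict (Ioo 0 T)) ∧ MemLp Dρ 2 (volume.restrict (Ioo 0 T)) ∧
    MemLp D2ρ 2 (volume.restrict (Ioo 0 T))

/-- `u ∈ C([0,T]; 𝓓(Ω̄))`: each `u(t)` is on `Ω̄` the restriction of a smooth compactly supported
field on `ℝ³`, and all space derivatives depend continuously on `t`, uniformly in `Ω`. -/
def IsContinuousSmooth (T : ℝ) (Ω : Set E3) (u : ℝ → E3 → E3) : Prop :=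
  (∀ t ∈ Icc 0 T, ∃ U : E3 → E3, ContDiff ℝ ∞ U ∧ HasCompactSupport U ∧
    EqOn (u t) U (closure Ω)) ∧
  ∀ k : ℕ, ∀ t ∈ Icc 0 T,
    TendstoUniformlyOn (fun s x => iteratedFDeriv ℝ k (u s) x)
      (iteratedFDeriv ℝ k (u t)) (𝓝[Icc 0 T] t) Ω

/-! ### The projection onto rigid fields -/

/-- The cross product on `ℝ³`. -/
def cross (a b : E3) : E3 := WithLp.toLp 2 (crossProduct (WithLp.ofLp a) (WithLp.ofLp b))

/-- Mass of the density `w` on `Ω` (a density on `Ω` is extended by zero to `ℝ³`). -/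
def mass (Ω : Set E3) (w : E3 → ℝ) : ℝ := ∫ x in Ω, w x

/-- Centre of mass. -/
def center (Ω : Set E3) (w : E3 → ℝ) : E3 := (mass Ω w)⁻¹ • ∫ x in Ω, w x • x

/-- Inertia matrix `∫ w (|x-h|² I - (x-h) ⊗ (x-h))`. -/
def inertia (Ω : Set E3) (w : E3 → ℝ) : Matrix (Fin 3) (Fin 3) ℝ := fun i j =>
  ∫ x in Ω, w x * (‖x - center Ω w‖ ^ 2 * (1 : Matrix (Fin 3) (Fin 3) ℝ) i j
    - (x - center Ω w) i * (x - center Ω w) j)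

/-- Angular momentum `∫ w (x-h) × v`. -/
def angularMomentum (Ω : Set E3) (w : E3 → ℝ) (v : E3 → E3) : E3 :=
  ∫ x in Ω, w x • cross (x - center Ω w) (v x)

/-- Angular velocity `J⁻¹ ∫ w (x-h) × v`. -/
def angularVelocity (Ω : Set E3) (w : E3 → ℝ) (v : E3 → E3) : E3 :=
  WithLp.toLp 2 ((inertia Ω w)⁻¹.mulVec (WithLp.ofLp (angularMomentum Ω w v)))

/-- The projection of `v` onto rigid fields, with respect to the weight `w` on `Ω`. -/
def rigidProj (Ω : Set E3) (w : E3 → ℝ) (v : E3 → E3) (x : E3) : E3 :=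
  (mass Ω w)⁻¹ • (∫ y in Ω, w y • v y) + cross (angularVelocity Ω w v) (x - center Ω w)

/-- The solid density `ρ χ` at time `t`. -/
def solidDensity {Ω : Set E3} (ρ : ℝ → L2 Ω ℝ) (χ : ℝ → E3 → ℝ) (t : ℝ) (x : E3) : ℝ :=
  ρ t x * χ t x

/-- The field `P_S u (t, x)` determined by the density `ρ` and the function `χ`. -/
def solidVelocity {Ω : Set E3} (ρ : ℝ → L2 Ω ℝ) (χ : ℝ → E3 → ℝ) (u : ℝ → E3 → E3)
    (t : ℝ) (x : E3) : E3 :=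
  rigidProj Ω (solidDensity ρ χ t) (u t) x

/-! ### Transport equations -/

/-- `f ∈ L^∞((0,T) × ℝ³) ∩ C([0,T]; L^p(ℝ³))` for all `1 ≤ p < ∞`. -/
structure InSolutionClass (T : ℝ) (f : ℝ → E3 → ℝ) : Prop where
  bounded : MemLp (fun z : ℝ × E3 => f z.1 z.2) ⊤ (volume.restrict (Ioo 0 T ×ˢ univ))
  memLp : ∀ p : ℝ≥0∞, 1 ≤ p → p ≠ ⊤ → ∀ t ∈ Icc 0 T, MemLp (f t) p volume
  continuous : ∀ p : ℝ≥0∞, 1 ≤ p → p ≠ ⊤ → ∀ t ∈ Icc 0 T,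
    Tendsto (fun s => eLpNorm (f s - f t) p volume) (𝓝[Icc 0 T] t) (𝓝 0)

/-- `f` is a weak solution, in the above class, of
`∂_t f + div (f v) = 0` in `(0,T) × ℝ³`, `f|_{t=0} = f₀`.
Here `fderiv ℝ φ z (1, v)` is `∂_t φ + v · ∇φ`. -/
structure IsTransportSolution (T : ℝ) (v : ℝ → E3 → E3) (f₀ : E3 → ℝ) (f : ℝ → E3 → ℝ) :
    Prop where
  inClass : InSolutionClass T f
  equation : ∀ φ : ℝ × E3 → ℝ, ContDiff ℝ ∞ φ → HasCompactSupport φ →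
    tsupport φ ⊆ Ioo 0 T ×ˢ univ →
    ∫ z in Ioo 0 T ×ˢ univ, f z.1 z.2 * fderiv ℝ φ z (1, v z.1 z.2) = 0
  initial : f 0 =ᵐ[volume] f₀

/-- The characteristic function of `S`. -/
def charFn (S : Set E3) : E3 → ℝ := S.indicator (fun _ => 1)

/-! ### Propagators -/

/-- `f ∈ C([0,T]²; C^∞_loc(ℝ³))`. -/
def IsContinuousSmoothLoc (T : ℝ) (f : ℝ × ℝ → E3 → E3) : Prop :=
  (∀ q ∈ Icc 0 T ×ˢ Icc 0 T, ContDiff ℝ ∞ (f q)) ∧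
  ∀ k : ℕ, ∀ K : Set E3, IsCompact K → ∀ q ∈ Icc 0 T ×ˢ Icc 0 T,
    TendstoUniformlyOn (fun q' x => iteratedFDeriv ℝ k (f q') x)
      (iteratedFDeriv ℝ k (f q)) (𝓝[Icc 0 T ×ˢ Icc 0 T] q) K

/-- `f ∈ C¹([0,T]²; C^∞_loc(ℝ³))`: `f` is differentiable with respect to every seminorm
`sup_K |D^k ·|`, and its two partial derivatives are continuous into `C^∞_loc(ℝ³)`. -/
def IsC1SmoothLoc (T : ℝ) (f : ℝ × ℝ → E3 → E3) : Prop :=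
  IsContinuousSmoothLoc T f ∧
  ∃ A B : ℝ × ℝ → E3 → E3, IsContinuousSmoothLoc T A ∧ IsContinuousSmoothLoc T B ∧
    ∀ k : ℕ, ∀ K : Set E3, IsCompact K → ∀ q ∈ Icc 0 T ×ˢ Icc 0 T, ∀ ε > 0,
      ∀ᶠ q' in 𝓝[Icc 0 T ×ˢ Icc 0 T] q, ∀ x ∈ K,
        ‖iteratedFDeriv ℝ k
          (fun y => f q' y - f q y - (q'.1 - q.1) • A q y - (q'.2 - q.2) • B q y) x‖
          ≤ ε * ‖q' - q‖

/-- `η t s y` is the position at time `t` of the point moved by the field `v` that is at `y` at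
time `s`, for `s, t ∈ [0,T]`. -/
def IsPropagator (T : ℝ) (v : ℝ → E3 → E3) (η : ℝ → ℝ → E3 → E3) : Prop :=
  ∀ s ∈ Icc 0 T, ∀ y : E3, η s s y = y ∧
    ∀ t ∈ Icc 0 T, HasDerivWithinAt (fun τ => η τ s y) (v t (η t s y)) (Icc 0 T) t

/-! ### Persistence of the mass

The density `ρ` is given on `Ω` only, so a body that leaves `Ω` loses its mass
`m(t) = ∫_{S(t) ∩ Ω} ρ(t)`, and `P_S u`, which contains `1/m` and `J⁻¹`, ceases to be defined. -/

/-- The mass in `Ω`, at time `t`, of the body that occupies `η t (S₀)`. -/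
def bodyMass {Ω : Set E3} (ρ : ℝ → L2 Ω ℝ) (S₀ : Set E3) (η : ℝ → E3 → E3) (t : ℝ) : ℝ :=
  mass Ω (solidDensity ρ (fun τ => charFn (η τ '' S₀)) t)

/-- On `[0,τ)` the isometries `η t` move the body `S(t) = η t (S₀)` by its own field `P_S u`,
and the mass of the body in `Ω` is positive. -/
structure IsBodyMotion {Ω : Set E3} (S₀ : Set E3) (u : ℝ → E3 → E3) (ρ : ℝ → L2 Ω ℝ)
    (τ : ℝ) (η : ℝ → E3 → E3) : Prop where
  isometry : ∀ t ∈ Ico 0 τ, Isometry (η t)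
  start : ∀ y, η 0 y = y
  mass_pos : ∀ t ∈ Ico 0 τ, 0 < bodyMass ρ S₀ η t
  velocity : ∀ t ∈ Ico 0 τ, ∀ y : E3, HasDerivWithinAt (fun s => η s y)
    (solidVelocity ρ (fun s => charFn (η s '' S₀)) u t (η t y)) (Ico 0 τ) t

/-- Up to time `T` a moving body cannot lose its mass: its mass stays away from zero along every
motion on `[0,τ)`, `τ ≤ T`. -/
def MassPersists {Ω : Set E3} (S₀ : Set E3) (u : ℝ → E3 → E3) (ρ : ℝ → L2 Ω ℝ) (T : ℝ) : Prop :=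
  ∀ τ ∈ Ioc 0 T, ∀ η : ℝ → E3 → E3, IsBodyMotion S₀ u ρ τ η →
    ∃ c > 0, ∀ t ∈ Ico 0 τ, c ≤ bodyMass ρ S₀ η t

end RigidTransport

end

open RigidTransport

/-! The unknown is finite-dimensional. A body moved by rigid fields is described by a configuration
`X = (A, b)`, the affine map `y ↦ A y + b`, and `P_S u` at time `t` has the form `x ↦ a + ω × x`,
where `a` and `ω` are determined by finitely many moments of `ρ χ`: mass, first moment, inertia
about the origin, momentum, angular momentum (`rigidProj_eq_moments`). They are C¹ functions of the
moments as long as the mass and the determinant of the inertia matrix do not vanish, and for a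
nonnegative density positive mass already makes the inertia matrix positive definite
(`det_inertia_pos`). The nonlocal transport problem thus becomes an ordinary differential equation
`X' = bodyField(t, X)`.

The analytic core is that the moments are Lipschitz in `X`, although `ρ` is merely H¹ in `Ω` and the
body may cross the boundary of `Ω`. The moments are written as `∫_{S₀} (1_Ω f)(X y) dy` with `f` the
moment density; this makes sense for every invertible `X` near a rigid one, so the equation can be
solved in a vector space. The extension by zero of a W^{1,1} function on a regular domain has
bounded variation: inside `Ω` one integrates the weak derivative along segments, and the layer of
width `δ` at the boundary carries at most `c δ ‖f‖_{W^{1,1}}`, by translation along a transversal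
direction. This gives `exists_bodyMoments_sub_le`, and Picard–Lindelöf applies.

The solutions stay rigid because `x ↦ ω × x` is skew. A body of positive mass meets the bounded set
`Ω`, so rigid configurations with mass at least `c > 0` form a compact set, and a solution can cease
to exist only if its mass tends to zero. `MassPersists` excludes this, hence
`exists_isBodySolution`; on a short interval it holds by continuity and uniqueness.

For a known rigid field with continuous coefficients the linear transport equation is solved by `f₀
∘ X(t)⁻¹`. Conversely, if `f` is any weak solution, then `∫ f(t) Φ ∘ X(t)⁻¹` has zero time
derivative for every test function `Φ`, so `f(t) ∘ X(t)` is constant (`comp_flow_ae_eq`).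

Uniqueness of `χ` joins the two parts. The moments of an arbitrary solution are continuous in time,
since it is continuous in L². At a time where the solution agrees with the moving body they are
nondegenerate, hence they remain so for a while; its field is then rigid with continuous
coefficients, it is carried along a rigid motion, and that motion solves the same differential
equation as the body. So agreement propagates to the right (`exists_ae_eq_charFn_right`), and it is
closed in time. The propagator is `X(t) ∘ X(s)⁻¹`; as it is affine, its regularity is that of its
two coefficients. -/

noncomputable section

namespace RigidTransport

/-! ### Ordinary differential equations with a locally Lipschitz right-hand side -/

section ODE

variable {E : Type*} [NormedAddCommGroup E] [NormedSpace ℝ E]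

/-- Near `(t₀, X₀)` the time-dependent field `G` is bounded, continuous in time and uniformly
Lipschitz in space, for times in `[0,T]`. -/
def IsLipschitzNear (T : ℝ) (G : ℝ → E → E) (t₀ : ℝ) (X₀ : E) : Prop :=
  ∃ ε > 0, ∃ r > 0, ∃ K L : ℝ≥0,
    (∀ t ∈ Icc 0 T ∩ Metric.closedBall t₀ ε,
      LipschitzOnWith K (G t) (Metric.closedBall X₀ r) ∧
      ∀ X ∈ Metric.closedBall X₀ r, ‖G t X‖ ≤ L) ∧
    ∀ X ∈ Metric.closedBall X₀ r,
      ContinuousOn (fun t => G t X) (Icc 0 T ∩ Metric.closedBall t₀ ε)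

/-- `X` solves `X' = G(t, X)` on `[a,b]`. -/
def IsSolutionOn (G : ℝ → E → E) (a b : ℝ) (X : ℝ → E) : Prop :=
  ∀ t ∈ Icc a b, HasDerivWithinAt X (G t (X t)) (Icc a b) t

lemma IsSolutionOn.mono {G : ℝ → E → E} {a b a' b' : ℝ} {X : ℝ → E} (h : IsSolutionOn G a b X)
    (ha : a ≤ a') (hb : b' ≤ b) : IsSolutionOn G a' b' X := fun t ht =>
  (h t (Icc_subset_Icc ha hb ht)).mono (Icc_subset_Icc ha hb)

lemma IsSolutionOn.continuousOn {G : ℝ → E → E} {a b : ℝ} {X : ℝ → E}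
    (h : IsSolutionOn G a b X) : ContinuousOn X (Icc a b) :=
  fun t ht => (h t ht).continuousWithinAt

lemma hasDerivWithinAt_Ici_of_Icc {f : ℝ → E} {f' : E} {a b t : ℝ}
    (h : HasDerivWithinAt f f' (Icc a b) t) (ht : t ∈ Ico a b) :
    HasDerivWithinAt f f' (Ici t) t := by
  refine h.mono_of_mem_nhdsWithin ?_
  exact mem_of_superset (Icc_mem_nhdsGE ht.2) (Icc_subset_Icc_left ht.1)

/-- Picard–Lindelöf to the right of `t₀`. Only right neighbourhoods are needed, since all
continuation arguments advance in time. -/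
lemma exists_isSolutionOn [CompleteSpace E] {T : ℝ} {G : ℝ → E → E} {t₀ : ℝ} {X₀ : E}
    (ht₀ : t₀ ∈ Ico 0 T) (hG : IsLipschitzNear T G t₀ X₀) :
    ∃ δ > 0, t₀ + δ ≤ T ∧ ∃ X : ℝ → E, X t₀ = X₀ ∧ IsSolutionOn G t₀ (t₀ + δ) X := by
  obtain ⟨ε, hε, r, hr, K, L, h1, h2⟩ := hG
  -- The step keeps the times within `ε` of `t₀` and below `T`, and a curve of speed at most `L`
  -- within distance `r`; `L + 1` avoids division by zero.
  set δ := min (min ε (T - t₀)) (r / (L + 1)) with hδ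
  have hLpos : (0 : ℝ) < L + 1 := by positivity
  have hδpos : 0 < δ := lt_min (lt_min hε (by linarith [ht₀.2])) (by positivity)
  have hδε : δ ≤ ε := (min_le_left _ _).trans (min_le_left _ _)
  have hδT : δ ≤ T - t₀ := (min_le_left _ _).trans (min_le_right _ _)
  have hδr : δ ≤ r / (L + 1) := min_le_right _ _
  have hsub : Icc t₀ (t₀ + δ) ⊆ Icc 0 T ∩ Metric.closedBall t₀ ε := by
    intro t ht
    refine ⟨⟨ht₀.1.trans ht.1, by linarith [ht.2]⟩, ?_⟩
    rw [Metric.mem_closedBall, Real.dist_eq, abs_le]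
    constructor <;> linarith [ht.1, ht.2]
  lift r to ℝ≥0 using hr.le
  have hPL : IsPicardLindelof G (tmin := t₀) (tmax := t₀ + δ) ⟨t₀, by simp [hδpos.le]⟩ X₀ r 0 L K :=
    { lipschitzOnWith := fun t ht => (h1 t (hsub ht)).1
      continuousOn := fun x hx => (h2 x hx).mono hsub
      norm_le := fun t ht x hx => (h1 t (hsub ht)).2 x hx
      mul_max_le := by
        simp only [add_sub_cancel_left, sub_self, NNReal.coe_zero, sub_zero]
        rw [max_eq_left hδpos.le]
        calc (L : ℝ) * δ ≤ (L + 1) * (r / (L + 1)) := by gcongr; linarith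
          _ = r := by field_simp }
  obtain ⟨X, hX, hX'⟩ := hPL.exists_eq_forall_mem_Icc_hasDerivWithinAt₀
  exact ⟨δ, hδpos, by linarith, X, hX, hX'⟩

/-- Continuous induction on the closed set of agreement: at a common point both curves enter the
ball where the field is Lipschitz, and Grönwall applies there. The Lipschitz condition is needed
along one of the two solutions only. -/
lemma IsSolutionOn.eqOn {T : ℝ} {G : ℝ → E → E} {a b : ℝ} (ha : 0 ≤ a) (hb : b ≤ T)
    {X Y : ℝ → E} (hX : IsSolutionOn G a b X) (hY : IsSolutionOn G a b Y) (h0 : X a = Y a)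
    (hG : ∀ t ∈ Ico a b, IsLipschitzNear T G t (X t)) : EqOn X Y (Icc a b) := by
  rcases lt_or_ge b a with hab | hab
  · simp [Icc_eq_empty (not_le.2 hab)]
  have hXc := hX.continuousOn
  have hYc := hY.continuousOn
  have hclosed : IsClosed ({t | X t = Y t} ∩ Icc a b) := by
    have h : {t | X t = Y t} ∩ Icc a b = {t ∈ Icc a b | X t = Y t} := by
      ext t; simp [and_comm]
    rw [h]
    exact isClosed_Icc.isClosed_eq hXc hYc
  refine hclosed.Icc_subset_of_forall_exists_gt h0 ?_
  rintro t ⟨hXY, ht⟩ y hy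
  obtain ⟨ε, hε, r, hr, K, L, h1, h2⟩ := hG t ht
  have htI : t ∈ Icc a b := Ico_subset_Icc_self ht
  have near : ∀ Z : ℝ → E, ContinuousOn Z (Icc a b) → Z t = X t →
      ∀ᶠ s in 𝓝[Icc a b] t, Z s ∈ Metric.closedBall (X t) r := fun Z hZ hZt => by
    have := hZ t htI
    rw [ContinuousWithinAt, hZt] at this
    exact this.eventually (Metric.closedBall_mem_nhds _ hr)
  have hev := ((near X hXc rfl).and (near Y hYc hXY.symm)).and
    (mem_nhdsWithin_of_mem_nhds (Metric.closedBall_mem_nhds t hε))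
  have hev' : ∀ᶠ s in 𝓝[≥] t, ((X s ∈ Metric.closedBall (X t) r ∧
      Y s ∈ Metric.closedBall (X t) r) ∧ s ∈ Metric.closedBall t ε) := by
    have hle : 𝓝[≥] t ≤ 𝓝[Icc a b] t := by
      rw [← nhdsWithin_Icc_eq_nhdsGE ht.2]
      exact nhdsWithin_mono _ (Icc_subset_Icc_left ht.1)
    exact hle hev
  obtain ⟨c, hc, hcs⟩ := (mem_nhdsGE_iff_exists_Icc_subset).1 hev'
  set d := min (min c y) b
  have htd : t < d := lt_min (lt_min hc hy) ht.2
  have hdb : d ≤ b := min_le_right _ _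
  have hdc : d ≤ c := (min_le_left _ _).trans (min_le_left _ _)
  have hdy : d ≤ y := (min_le_left _ _).trans (min_le_right _ _)
  have hsub : Icc t d ⊆ Icc a b := Icc_subset_Icc ht.1 hdb
  have hX' := hX.mono ht.1 hdb
  have hY' := hY.mono ht.1 hdb
  have hEq : EqOn X Y (Icc t d) := by
    refine ODE_solution_unique_of_mem_Icc_right (v := G) (K := K)
      (s := fun _ => Metric.closedBall (X t) r) ?_ hX'.continuousOn ?_ ?_ hY'.continuousOn ?_ ?_ hXY
    · intro s hs
      refine (h1 s ⟨⟨?_, ?_⟩, (hcs ⟨hs.1, hs.2.le.trans hdc⟩).2⟩).1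
      · exact ha.trans (ht.1.trans hs.1)
      · exact hs.2.le.trans (hdb.trans hb)
    · exact fun s hs => hasDerivWithinAt_Ici_of_Icc (hX' s (Ico_subset_Icc_self hs)) hs
    · exact fun s hs => (hcs ⟨hs.1, hs.2.le.trans hdc⟩).1.1
    · exact fun s hs => hasDerivWithinAt_Ici_of_Icc (hY' s (Ico_subset_Icc_self hs)) hs
    · exact fun s hs => (hcs ⟨hs.1, hs.2.le.trans hdc⟩).1.2
  exact ⟨d, hEq ⟨htd.le, le_rfl⟩, htd, hdy⟩

/-- Concatenation of two solutions. -/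
lemma IsSolutionOn.concat {G : ℝ → E → E} {a b c : ℝ} (hab : a ≤ b) (hbc : b ≤ c) {X Y : ℝ → E}
    (hX : IsSolutionOn G a b X) (hY : IsSolutionOn G b c Y) (h : X b = Y b) :
    IsSolutionOn G a c (fun t => if t ≤ b then X t else Y t) := by
  intro t ht
  set Z : ℝ → E := fun t => if t ≤ b then X t else Y t with hZ
  have hZX : EqOn Z X (Icc a b) := fun s hs => by simp [hZ, hs.2]
  have hZY : EqOn Z Y (Icc b c) := fun s hs => by
    rcases hs.1.eq_or_lt with rfl | h'
    · simp [hZ, h]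
    · simp [hZ, not_le.2 h']
  rw [← Icc_union_Icc_eq_Icc hab hbc]
  rcases lt_trichotomy t b with htb | rfl | htb
  · have h1 : HasDerivWithinAt Z (G t (Z t)) (Icc a b) t := by
      rw [hZX ⟨ht.1, htb.le⟩]
      exact (hX t ⟨ht.1, htb.le⟩).congr hZX (hZX ⟨ht.1, htb.le⟩)
    refine h1.mono_of_mem_nhdsWithin ?_
    rw [mem_nhdsWithin_iff_exists_mem_nhds_inter]
    refine ⟨Iio b, Iio_mem_nhds htb, ?_⟩
    rintro s ⟨hs, h' | h'⟩
    · exact h'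
    · exact absurd h'.1 (not_le.2 hs)
  · have ht1 : t ∈ Icc a t := ⟨hab, le_rfl⟩
    have ht2 : t ∈ Icc t c := ⟨le_rfl, hbc⟩
    refine HasDerivWithinAt.union ?_ ?_
    · rw [hZX ht1]
      exact (hX t ht1).congr hZX (hZX ht1)
    · rw [hZY ht2]
      exact (hY t ht2).congr hZY (hZY ht2)
  · have ht2 : t ∈ Icc b c := ⟨htb.le, ht.2⟩
    have h1 : HasDerivWithinAt Z (G t (Z t)) (Icc b c) t := by
      rw [hZY ht2]
      exact (hY t ht2).congr hZY (hZY ht2)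
    refine h1.mono_of_mem_nhdsWithin ?_
    rw [mem_nhdsWithin_iff_exists_mem_nhds_inter]
    refine ⟨Ioi b, Ioi_mem_nhds htb, ?_⟩
    rintro s ⟨hs, h' | h'⟩
    · exact absurd h'.2 (not_le.2 hs)
    · exact h'

end ODE

/-! ### Mollification of weakly differentiable functions -/

section Mollify

open ContinuousLinearMap
open scoped Convolution

variable {F : Type*} [NormedAddCommGroup F] [NormedSpace ℝ F]

lemma integrable_indicator_of_integrableOn {H : Type*} [NormedAddCommGroup H] {Ω : Set E3}
    (hΩ : MeasurableSet Ω) {f : E3 → H} (hf : IntegrableOn f Ω) : Integrable (Ω.indicator f) :=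
  (integrable_indicator_iff hΩ).2 hf

lemma lintegral_enorm_indicator {H : Type*} [NormedAddCommGroup H] {Ω : Set E3}
    (hΩ : MeasurableSet Ω) (f : E3 → H) :
    ∫⁻ x, ‖Ω.indicator f x‖ₑ = ∫⁻ x in Ω, ‖f x‖ₑ := by
  simp_rw [enorm_indicator_eq_indicator_enorm]
  rw [lintegral_indicator hΩ]

/-- Young's inequality for a kernel of mass one, by Tonelli and translation invariance. -/
lemma lintegral_enorm_convolution_bump_le {F : Type*} [NormedAddCommGroup F] [NormedSpace ℝ F]
    (φ : ContDiffBump (0 : E3)) {h : E3 → F}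
    (hh : AEStronglyMeasurable h volume) :
    ∫⁻ x, ‖(φ.normed volume ⋆[lsmul ℝ ℝ, volume] h) x‖ₑ ≤ ∫⁻ x, ‖h x‖ₑ := by
  have hmeas : AEStronglyMeasurable (fun p : E3 × E3 => φ.normed volume p.2 • h (p.1 - p.2))
      (volume.prod volume) :=
    (AEStronglyMeasurable.convolution_integrand (lsmul ℝ ℝ)
      φ.continuous_normed.aestronglyMeasurable hh)
  calc ∫⁻ x, ‖(φ.normed volume ⋆[lsmul ℝ ℝ, volume] h) x‖ₑ
      ≤ ∫⁻ x, ∫⁻ t, ‖φ.normed volume t • h (x - t)‖ₑ :=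
        lintegral_mono fun x => enorm_integral_le_lintegral_enorm _
    _ = ∫⁻ t, ∫⁻ x, ‖φ.normed volume t • h (x - t)‖ₑ :=
        lintegral_lintegral_swap hmeas.enorm
    _ = ∫⁻ t, ‖φ.normed volume t‖ₑ * ∫⁻ x, ‖h x‖ₑ := by
        congr 1; ext t
        simp_rw [enorm_smul]
        rw [lintegral_const_mul' _ _ enorm_ne_top, lintegral_sub_right_eq_self (fun x => ‖h x‖ₑ)]
    _ = (∫⁻ t, ‖φ.normed volume t‖ₑ) * ∫⁻ x, ‖h x‖ₑ := by
        rw [lintegral_mul_const]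
        exact φ.continuous_normed.measurable.enorm
    _ = ∫⁻ x, ‖h x‖ₑ := by
        have : ∫⁻ t, ‖φ.normed volume t‖ₑ = 1 := by
          have h1 : ∀ t, ‖φ.normed volume t‖ₑ = ENNReal.ofReal (φ.normed volume t) := fun t =>
            Real.enorm_of_nonneg (φ.nonneg_normed t)
          simp_rw [h1]
          rw [← ofReal_integral_eq_lintegral_ofReal φ.integrable_normed
            (Eventually.of_forall φ.nonneg_normed), φ.integral_normed, ENNReal.ofReal_one]
        rw [this, one_mul]

/-- Testing the weak derivative with `y ↦ φ (x - y)`, which is supported in a ball inside `Ω`; the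
sign produced by the inner derivative cancels the one in the definition. The extension by zero is
not weakly differentiable across the boundary, but the ball around `x` does not see this. -/
lemma fderiv_convolution_bump_eq {Ω : Set E3} (hΩ : IsOpen Ω) {f : E3 → F} {f' : E3 → E3 →L[ℝ] F}
    (hf : IntegrableOn f Ω) (hf' : IntegrableOn f' Ω) (hw : HasWeakFDerivOn Ω f f')
    (φ : ContDiffBump (0 : E3)) {x : E3} (hx : Metric.closedBall x φ.rOut ⊆ Ω) :
    fderiv ℝ (φ.normed volume ⋆[lsmul ℝ ℝ, volume] Ω.indicator f) x =
      (φ.normed volume ⋆[lsmul ℝ ℝ, volume] Ω.indicator f') x := by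
  have hfi : Integrable (Ω.indicator f) := (integrable_indicator_iff hΩ.measurableSet).2 hf
  have hfi' : Integrable (Ω.indicator f') := by
    exact integrable_indicator_of_integrableOn hΩ.measurableSet hf'
  have hder := φ.hasCompactSupport_normed (μ := volume) |>.hasFDerivAt_convolution_left
    (lsmul ℝ ℝ) (φ.contDiff_normed (n := 1)) hfi.locallyIntegrable x
  rw [hder.fderiv]
  ext v
  set ψ : E3 → ℝ := fun y => φ.normed volume (x - y) with hψ
  have hψs : ContDiff ℝ ∞ ψ := φ.contDiff_normed.comp (contDiff_const.sub contDiff_id)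
  have hψsupp : tsupport ψ ⊆ Metric.closedBall x φ.rOut := by
    refine closure_minimal ?_ Metric.isClosed_closedBall
    intro y hy
    have : x - y ∈ Function.support (φ.normed volume) := hy
    rw [φ.support_normed_eq] at this
    rw [Metric.mem_closedBall, dist_comm, dist_eq_norm]
    simpa using (Metric.mem_ball.1 this).le
  have hψc : HasCompactSupport ψ :=
    HasCompactSupport.intro' (isCompact_closedBall x φ.rOut) Metric.isClosed_closedBall
      fun y hy => image_eq_zero_of_notMem_tsupport fun h => hy (hψsupp h)
  have hψd : ∀ y, fderiv ℝ ψ y v = - fderiv ℝ (φ.normed volume) (x - y) v := by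
    intro y
    have h1 : HasFDerivAt ψ ((fderiv ℝ (φ.normed volume) (x - y)).comp
        (-ContinuousLinearMap.id ℝ E3)) y := by
      have h2 := ((φ.contDiff_normed (n := 1) (μ := volume)).differentiable one_ne_zero
        (x - y)).hasFDerivAt
      exact h2.comp y ((hasFDerivAt_id y).const_sub x)
    rw [h1.fderiv]; simp
  have key := hw ψ hψs hψc (hψsupp.trans hx) v
  have hcd : Continuous (fderiv ℝ (φ.normed volume)) :=
    (φ.contDiff_normed (n := 1) (μ := volume)).continuous_fderiv one_ne_zero
  have hcs : HasCompactSupport (fderiv ℝ (φ.normed volume)) :=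
    (φ.hasCompactSupport_normed (μ := volume)).fderiv ℝ
  have hex1 : ConvolutionExistsAt (fderiv ℝ (φ.normed volume)) (Ω.indicator f) x
      ((lsmul ℝ ℝ : ℝ →L[ℝ] F →L[ℝ] F).precompL E3) volume :=
    hcs.convolutionExists_left _ hcd hfi.locallyIntegrable x
  have hex2 : ConvolutionExistsAt (φ.normed volume) (Ω.indicator f') x
      (lsmul ℝ ℝ : ℝ →L[ℝ] (E3 →L[ℝ] F) →L[ℝ] (E3 →L[ℝ] F)) volume :=
    (φ.hasCompactSupport_normed (μ := volume)).convolutionExists_left _ φ.continuous_normed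
      hfi'.locallyIntegrable x
  rw [convolution_def, convolution_def, ContinuousLinearMap.integral_apply hex1.integrable,
    ContinuousLinearMap.integral_apply hex2.integrable]
  have e1 : ∫ t, (((lsmul ℝ ℝ : ℝ →L[ℝ] F →L[ℝ] F).precompL E3)
      (fderiv ℝ (φ.normed volume) t)) (Ω.indicator f (x - t)) v
      = ∫ y in Ω, fderiv ℝ (φ.normed volume) (x - y) v • f y := by
    rw [← integral_sub_left_eq_self _ volume x, ← integral_indicator hΩ.measurableSet]
    congr 1; ext y
    by_cases hy : y ∈ Ω <;> simp [hy, precompL_apply]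
  have e2 : ∫ t, ((lsmul ℝ ℝ : ℝ →L[ℝ] (E3 →L[ℝ] F) →L[ℝ] (E3 →L[ℝ] F))
      (φ.normed volume t) (Ω.indicator f' (x - t))) v = ∫ y in Ω, ψ y • f' y v := by
    rw [← integral_sub_left_eq_self _ volume x, ← integral_indicator hΩ.measurableSet]
    congr 1; ext y
    by_cases hy : y ∈ Ω <;> simp [hy, hψ]
  rw [e1, e2]
  simp_rw [hψd, neg_smul] at key
  rw [integral_neg, neg_inj] at key
  exact key

variable [CompleteSpace F]

/-- If the segments `[p y, q y]`, `y ∈ E`, lie in `Ω` and do not concentrate, then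
`∫_E |f ∘ q - f ∘ p|` is controlled by the weak derivative of `f`. -/
lemma lintegral_enorm_sub_le_of_segment {Ω : Set E3} (hΩ : IsOpen Ω) {f : E3 → F}
    {f' : E3 → E3 →L[ℝ] F} (hf : IntegrableOn f Ω) (hf' : IntegrableOn f' Ω)
    (hw : HasWeakFDerivOn Ω f f') {E : Set E3} (hE : MeasurableSet E) {p q : E3 → E3}
    (hp : Continuous p) (hq : Continuous q)
    (hp' : Measure.QuasiMeasurePreserving p) (hq' : Measure.QuasiMeasurePreserving q)
    (hseg : ∀ y ∈ E, ∀ s ∈ Icc (0 : ℝ) 1, p y + s • (q y - p y) ∈ Ω) {K : ℝ≥0∞}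
    (hK : ∀ G : E3 → ℝ≥0∞, Measurable G →
      ∫⁻ y in E, ∫⁻ s in Icc (0 : ℝ) 1, G (p y + s • (q y - p y)) * ‖q y - p y‖ₑ ≤ K * ∫⁻ x, G x) :
    ∫⁻ y in E, ‖f (q y) - f (p y)‖ₑ ≤ K * ∫⁻ x in Ω, ‖f' x‖ₑ := by
  have hfi : Integrable (Ω.indicator f) := (integrable_indicator_iff hΩ.measurableSet).2 hf
  have hfi' : Integrable (Ω.indicator f') := by
    exact integrable_indicator_of_integrableOn hΩ.measurableSet hf'
  let φ : ℕ → ContDiffBump (0 : E3) := fun n =>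
    ⟨1 / ((n : ℝ) + 1), 2 / ((n : ℝ) + 1), by positivity, by gcongr; norm_num⟩
  have hφ : Tendsto (fun n => (φ n).rOut) atTop (𝓝 0) := by
    have := (tendsto_one_div_add_atTop_nhds_zero_nat (𝕜 := ℝ)).const_mul 2
    simp only [mul_one_div, mul_zero] at this
    exact this
  have hφ' : ∀ᶠ n in atTop, (φ n).rOut ≤ 2 * (φ n).rIn :=
    Eventually.of_forall fun n => by simp [φ, div_eq_mul_inv]
  set g : ℕ → E3 → F := fun n => (φ n).normed volume ⋆[lsmul ℝ ℝ, volume] Ω.indicator f with hg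
  have hgs : ∀ n, ContDiff ℝ 1 (g n) := fun n =>
    ((φ n).hasCompactSupport_normed (μ := volume)).contDiff_convolution_left _
      (φ n).contDiff_normed hfi.locallyIntegrable
  have hlim := ContDiffBump.ae_convolution_tendsto_right_of_locallyIntegrable hφ hφ'
    hfi.locallyIntegrable
  -- The points of `E` whose whole segment keeps distance at least `1/(k+1)` from the complement of
  -- `Ω`. Mollifiers of smaller radius are harmless there, and by compactness of the segments these
  -- sets exhaust `E`.
  set Ek : ℕ → Set E3 := fun k => E ∩ ⋂ s ∈ Icc (0 : ℝ) 1,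
    (fun y => p y + s • (q y - p y)) ⁻¹' (Metric.thickening (1 / ((k : ℝ) + 1)) Ωᶜ)ᶜ with hEk
  have hEkm : ∀ k, MeasurableSet (Ek k) := by
    intro k
    refine hE.inter (IsClosed.measurableSet ?_)
    refine isClosed_biInter fun s _ => ?_
    exact Metric.isOpen_thickening.isClosed_compl.preimage (by fun_prop)
  have hEkmono : Monotone Ek := by
    intro k l hkl
    refine inter_subset_inter_right _ (iInter₂_mono fun s _ => preimage_mono ?_)
    refine compl_subset_compl.2 (Metric.thickening_mono ?_ _)
    gcongr
  have hEunion : E = ⋃ k, Ek k := by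
    ext y
    refine ⟨fun hy => ?_, fun hy => ?_⟩
    · have hcomp : IsCompact ((fun s : ℝ => p y + s • (q y - p y)) '' Icc 0 1) :=
        isCompact_Icc.image (by fun_prop)
      obtain ⟨δ, hδ, hsub⟩ := hcomp.exists_thickening_subset_open hΩ
        (by rintro _ ⟨s, hs, rfl⟩; exact hseg y hy s hs)
      obtain ⟨k, hk⟩ := exists_nat_one_div_lt hδ
      refine mem_iUnion.2 ⟨k, hy, mem_iInter₂.2 fun s hs hmem => ?_⟩
      obtain ⟨z, hz, hdz⟩ := Metric.mem_thickening_iff.1 hmem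
      refine hz (hsub (Metric.mem_thickening_iff.2 ⟨_, ⟨s, hs, rfl⟩, ?_⟩))
      rw [dist_comm]
      exact hdz.trans hk
    · obtain ⟨k, hk⟩ := mem_iUnion.1 hy
      exact hk.1
  have hbound : ∀ k, ∀ᶠ n in atTop, ∫⁻ y in Ek k, ‖g n (q y) - g n (p y)‖ₑ ≤
      K * ∫⁻ x in Ω, ‖f' x‖ₑ := by
    intro k
    have hk : (0 : ℝ) < 1 / ((k : ℝ) + 1) := by positivity
    filter_upwards [hφ.eventually (gt_mem_nhds hk)] with n hn
    set D : E3 → E3 →L[ℝ] F := (φ n).normed volume ⋆[lsmul ℝ ℝ, volume] Ω.indicator f' with hD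
    have hDc : Continuous D :=
      (φ n).hasCompactSupport_normed.continuous_convolution_left _ (φ n).continuous_normed
        hfi'.locallyIntegrable
    have hpt : ∀ y ∈ Ek k, ‖g n (q y) - g n (p y)‖ₑ ≤
        ∫⁻ s in Icc (0 : ℝ) 1, ‖D (p y + s • (q y - p y))‖ₑ * ‖q y - p y‖ₑ := by
      intro y hy
      have hd : ∀ s ∈ uIcc (0 : ℝ) 1, HasDerivAt (fun s : ℝ => g n (p y + s • (q y - p y)))
          (D (p y + s • (q y - p y)) (q y - p y)) s := by
        intro s hs
        rw [uIcc_of_le zero_le_one] at hs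
        have hball : Metric.closedBall (p y + s • (q y - p y)) (φ n).rOut ⊆ Ω := by
          intro z hz
          by_contra hzΩ
          refine (mem_iInter₂.1 hy.2 s hs) (Metric.mem_thickening_iff.2 ⟨z, hzΩ, ?_⟩)
          rw [dist_comm]
          exact (Metric.mem_closedBall.1 hz).trans_lt hn
        have h1 := ((hgs n).differentiable one_ne_zero (p y + s • (q y - p y))).hasFDerivAt
        rw [hg, fderiv_convolution_bump_eq hΩ hf hf' hw (φ n) hball] at h1
        have h2 : HasDerivAt (fun s : ℝ => p y + s • (q y - p y)) (q y - p y) s := by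
          simpa using ((hasDerivAt_id s).smul_const (q y - p y)).const_add (p y)
        exact h1.comp_hasDerivAt s h2
      have hci : Continuous fun s : ℝ => D (p y + s • (q y - p y)) (q y - p y) :=
        (hDc.comp (by fun_prop)).clm_apply continuous_const
      have hftc := intervalIntegral.integral_eq_sub_of_hasDerivAt hd (hci.intervalIntegrable 0 1)
      simp only [one_smul, zero_smul, add_zero, add_sub_cancel] at hftc
      rw [← hftc, intervalIntegral.integral_of_le zero_le_one, ← integral_Icc_eq_integral_Ioc]
      refine (enorm_integral_le_lintegral_enorm _).trans (lintegral_mono fun s => ?_)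
      exact ContinuousLinearMap.le_opENorm _ _
    calc ∫⁻ y in Ek k, ‖g n (q y) - g n (p y)‖ₑ
        ≤ ∫⁻ y in Ek k, ∫⁻ s in Icc (0 : ℝ) 1, ‖D (p y + s • (q y - p y))‖ₑ * ‖q y - p y‖ₑ :=
          setLIntegral_mono' (hEkm k) hpt
      _ ≤ ∫⁻ y in E, ∫⁻ s in Icc (0 : ℝ) 1, ‖D (p y + s • (q y - p y))‖ₑ * ‖q y - p y‖ₑ :=
          lintegral_mono_set inter_subset_left
      _ ≤ K * ∫⁻ x, ‖D x‖ₑ := hK _ hDc.enorm.measurable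
      _ ≤ K * ∫⁻ x, ‖Ω.indicator f' x‖ₑ := by
          refine mul_le_mul_right ?_ _
          exact lintegral_enorm_convolution_bump_le (φ n) hfi'.aestronglyMeasurable
      _ = K * ∫⁻ x in Ω, ‖f' x‖ₑ := by
          congr 1
          exact lintegral_enorm_indicator hΩ.measurableSet f'
  -- Passage to the limit by Fatou. The mollifications converge almost everywhere, and this survives
  -- composition with `p` and `q` because preimages of null sets are null.
  have hkbound : ∀ k, ∫⁻ y in Ek k, ‖f (q y) - f (p y)‖ₑ ≤ K * ∫⁻ x in Ω, ‖f' x‖ₑ := by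
    intro k
    have hae : ∀ᵐ y ∂(volume.restrict (Ek k)),
        ‖f (q y) - f (p y)‖ₑ = liminf (fun n => ‖g n (q y) - g n (p y)‖ₑ) atTop := by
      filter_upwards [ae_restrict_of_ae (hp'.ae hlim), ae_restrict_of_ae (hq'.ae hlim),
        ae_restrict_mem (hEkm k)] with y h1 h2 hy
      have hpΩ : p y ∈ Ω := by simpa using hseg y hy.1 0 (by simp)
      have hqΩ : q y ∈ Ω := by simpa using hseg y hy.1 1 (by simp)
      rw [indicator_of_mem hpΩ] at h1
      rw [indicator_of_mem hqΩ] at h2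
      exact ((h2.sub h1).enorm.liminf_eq).symm
    rw [lintegral_congr_ae hae]
    refine (lintegral_liminf_le' fun n => ?_).trans ?_
    · exact (((hgs n).continuous.comp hq).sub
        ((hgs n).continuous.comp hp)).enorm.measurable.aemeasurable
    · exact liminf_le_of_frequently_le' (hbound k).frequently
  rw [hEunion, setLIntegral_iUnion_of_directed _ hEkmono.directed_le]
  exact iSup_le hkbound

end Mollify

/-! ### Boundary layers and affine changes of variables -/

section Layer

variable {F : Type*} [NormedAddCommGroup F] [NormedSpace ℝ F] [CompleteSpace F]

/-- The points of `Ω` at distance at most `δ` from the complement of `Ω`. -/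
def layer (Ω : Set E3) (δ : ℝ) : Set E3 := {x ∈ Ω | Metric.infDist x Ωᶜ ≤ δ}

lemma measurableSet_layer {Ω : Set E3} (hΩ : IsOpen Ω) (δ : ℝ) : MeasurableSet (layer Ω δ) :=
  hΩ.measurableSet.inter
    (isClosed_le (Metric.continuous_infDist_pt _) continuous_const).measurableSet

/-- If `E` meets every line of direction `v` in a set of diameter at most `D` (in the parameter),
then averages over translations of `E` along `v` do not concentrate. -/
lemma lintegral_translate_le {E : Set E3} (hE : MeasurableSet E) {v : E3} {D s₀ : ℝ} (hs₀ : 0 < s₀)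
    (hD : ∀ x ∈ E, ∀ s : ℝ, x + s • v ∈ E → |s| ≤ D) {G : E3 → ℝ≥0∞} (hG : Measurable G) :
    ∫⁻ y in E, ∫⁻ s in Icc (0 : ℝ) 1, G (y + s • s₀ • v) ≤ ENNReal.ofReal (D / s₀) * ∫⁻ x, G x := by
  have hmeas : Measurable (fun z : E3 × ℝ => E.indicator 1 z.1 * G (z.1 + z.2 • s₀ • v)) := by
    refine Measurable.mul ((measurable_const.indicator hE).comp measurable_fst) ?_
    exact hG.comp (by fun_prop)
  have hmeas' : Measurable (fun z : E3 × ℝ => E.indicator (1 : E3 → ℝ≥0∞) (z.1 - z.2 • s₀ • v)) :=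
    (measurable_const.indicator hE).comp (by fun_prop)
  calc ∫⁻ y in E, ∫⁻ s in Icc (0 : ℝ) 1, G (y + s • s₀ • v)
      = ∫⁻ y, ∫⁻ s in Icc (0 : ℝ) 1, E.indicator 1 y * G (y + s • s₀ • v) := by
        rw [← lintegral_indicator hE]
        congr 1; ext y
        by_cases hy : y ∈ E <;> simp [hy]
    _ = ∫⁻ s in Icc (0 : ℝ) 1, ∫⁻ y, E.indicator 1 y * G (y + s • s₀ • v) :=
        lintegral_lintegral_swap hmeas.aemeasurable
    _ = ∫⁻ s in Icc (0 : ℝ) 1, ∫⁻ z, E.indicator 1 (z - s • s₀ • v) * G z := by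
        congr 1; ext s
        rw [← lintegral_add_right_eq_self (μ := volume)
          (fun z => E.indicator 1 (z - s • s₀ • v) * G z) (s • s₀ • v)]
        simp
    _ = ∫⁻ z, ∫⁻ s in Icc (0 : ℝ) 1, E.indicator 1 (z - s • s₀ • v) * G z := by
        refine (lintegral_lintegral_swap ?_).symm
        exact (hmeas'.mul (hG.comp measurable_fst)).aemeasurable
    _ = ∫⁻ z, (∫⁻ s in Icc (0 : ℝ) 1, E.indicator 1 (z - s • s₀ • v)) * G z := by
        congr 1; ext z
        rw [lintegral_mul_const]
        exact hmeas'.comp measurable_prodMk_left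
    _ ≤ ∫⁻ z, ENNReal.ofReal (D / s₀) * G z := by
        refine lintegral_mono fun z => mul_le_mul_left ?_ _
        -- After exchanging the integrals, `G z` is weighted by the length of the set of parameters
        -- that bring `z` back into `E`; two such parameters differ by at most `D / s₀`.
        set W : Set ℝ := {s | z - s • s₀ • v ∈ E}
        have hW : MeasurableSet W :=
          hE.preimage (by fun_prop : Measurable fun s : ℝ => z - s • s₀ • v)
        have h1 : ∀ s : ℝ, E.indicator (1 : E3 → ℝ≥0∞) (z - s • s₀ • v) = W.indicator 1 s :=
          fun s => by by_cases h : z - s • s₀ • v ∈ E <;> simp [W, h]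
        simp_rw [h1]
        rw [lintegral_indicator_one hW]
        refine (Measure.restrict_apply_le _ _).trans ((Real.volume_le_diam _).trans ?_)
        refine Metric.ediam_le fun s hs t ht => ?_
        rw [edist_dist]
        refine ENNReal.ofReal_le_ofReal ?_
        rw [Real.dist_eq, le_div_iff₀ hs₀]
        have h2 := hD _ hs ((s - t) * s₀) (by
          have : z - s • s₀ • v + ((s - t) * s₀) • v = z - t • s₀ • v := by
            simp only [sub_mul, sub_smul, mul_smul]; abel
          rw [this]; exact ht)
        rwa [abs_mul, abs_of_pos hs₀] at h2
    _ = _ := lintegral_const_mul _ hG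

lemma quasiMeasurePreserving_add_const (v : E3) :
    Measure.QuasiMeasurePreserving (fun y : E3 => y + v) :=
  (measurePreserving_add_right volume v).quasiMeasurePreserving

/-- Trace-type inequality: if `E ⊆ Ω` can be translated along `v` inside `Ω` up to time `a` and is
thin in the direction `v`, then `∫_E |f|` is small. -/
lemma lintegral_enorm_le_of_translate {Ω : Set E3} (hΩ : IsOpen Ω) {E : Set E3}
    (hE : MeasurableSet E) {v : E3} {D a : ℝ} (ha : 0 < a)
    (hD : ∀ x ∈ E, ∀ s : ℝ, x + s • v ∈ E → |s| ≤ D)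
    (hEΩ : ∀ x ∈ E, ∀ s ∈ Icc 0 a, x + s • v ∈ Ω)
    {f : E3 → F} {f' : E3 → E3 →L[ℝ] F} (hf : IntegrableOn f Ω) (hf' : IntegrableOn f' Ω)
    (hw : HasWeakFDerivOn Ω f f') :
    ∫⁻ x in E, ‖f x‖ₑ ≤ ENNReal.ofReal (D / a) * (∫⁻ x in Ω, ‖f x‖ₑ) +
      ENNReal.ofReal (D * ‖v‖) * ∫⁻ x in Ω, ‖f' x‖ₑ := by
  have hfi : Integrable (Ω.indicator f) := integrable_indicator_of_integrableOn hΩ.measurableSet hf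
  -- A measurable representative of the extension by zero, needed for Tonelli in the point and the
  -- translation parameter.
  obtain ⟨f₀, hf₀, hff₀⟩ := hfi.aestronglyMeasurable
  -- The value at `x` is compared with the value at `x + s a v`. Averaging the estimate over `s` in
  -- `(0,1]` then spreads the translated value over `Ω` at the price of the factor `D / a`.
  have hstep : ∀ s ∈ Ioc (0 : ℝ) 1, ∫⁻ x in E, ‖f x‖ₑ ≤
      (∫⁻ x in E, ‖f₀ (x + s • a • v)‖ₑ) + ENNReal.ofReal (D * ‖v‖) * ∫⁻ x in Ω, ‖f' x‖ₑ := by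
    intro s hs
    have hsa : 0 < s * a := mul_pos hs.1 ha
    have hseg : ∀ y ∈ E, ∀ t ∈ Icc (0 : ℝ) 1, y + t • (y + s • a • v - y) ∈ Ω := by
      intro y hy t ht
      rw [add_sub_cancel_left, ← mul_smul, ← mul_smul]
      refine hEΩ y hy _ ⟨?_, ?_⟩
      · have := ht.1; have := hs.1; positivity
      · have : t * s ≤ 1 := mul_le_one₀ ht.2 hs.1.le hs.2
        nlinarith
    have h1 := lintegral_enorm_sub_le_of_segment hΩ hf hf' hw hE (p := fun y => y)
      (q := fun y => y + s • a • v) continuous_id (by fun_prop)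
      (Measure.QuasiMeasurePreserving.id _) (quasiMeasurePreserving_add_const _) hseg
      (K := ENNReal.ofReal (D * ‖v‖)) (by
        intro G hG
        have h2 := lintegral_translate_le hE hsa hD hG
        simp only [add_sub_cancel_left]
        have hm : Measurable fun y : E3 => ∫⁻ t in Icc (0 : ℝ) 1, G (y + t • s • a • v) := by
          refine Measurable.lintegral_prod_right' (f := fun z : E3 × ℝ => G (z.1 + z.2 • s • a • v)) ?_
          exact hG.comp (by fun_prop)
        calc ∫⁻ y in E, ∫⁻ t in Icc (0 : ℝ) 1, G (y + t • s • a • v) * ‖s • a • v‖ₑ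
            = (∫⁻ y in E, ∫⁻ t in Icc (0 : ℝ) 1, G (y + t • s • a • v)) * ‖s • a • v‖ₑ := by
              rw [← lintegral_mul_const _ hm]
              congr 1; ext y
              rw [lintegral_mul_const]
              exact hG.comp (by fun_prop)
          _ ≤ (ENNReal.ofReal (D / (s * a)) * ∫⁻ x, G x) * ‖s • a • v‖ₑ := by
              gcongr
              simpa only [mul_smul] using h2
          -- The length of the segment cancels the factor `1 / (s a)`, so the bound is uniform in
          -- `s`.
          _ = ENNReal.ofReal (D * ‖v‖) * ∫⁻ x, G x := by
              rw [mul_right_comm, ← ofReal_norm, norm_smul, norm_smul,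
                ← ENNReal.ofReal_mul' (by positivity)]
              congr 2
              rw [Real.norm_of_nonneg hs.1.le, Real.norm_of_nonneg ha.le]
              have := hs.1.ne'
              field_simp)
    have hae : ∀ᵐ x ∂(volume.restrict E), ‖f (x + s • a • v)‖ₑ = ‖f₀ (x + s • a • v)‖ₑ := by
      filter_upwards [ae_restrict_of_ae ((quasiMeasurePreserving_add_const (s • a • v)).ae hff₀),
        ae_restrict_mem hE] with x hx hxE
      rw [← hx, indicator_of_mem]
      rw [← mul_smul]
      exact hEΩ x hxE _ ⟨hsa.le, by nlinarith [hs.2]⟩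
    calc ∫⁻ x in E, ‖f x‖ₑ
        ≤ ∫⁻ x in E, (‖f (x + s • a • v)‖ₑ + ‖f (x + s • a • v) - f x‖ₑ) := by
          refine lintegral_mono fun x => ?_
          calc ‖f x‖ₑ = ‖f (x + s • a • v) - (f (x + s • a • v) - f x)‖ₑ := by rw [sub_sub_cancel]
            _ ≤ _ := enorm_sub_le
      _ = ∫⁻ x in E, (‖f₀ (x + s • a • v)‖ₑ + ‖f (x + s • a • v) - f x‖ₑ) := by
          refine lintegral_congr_ae ?_
          filter_upwards [hae] with x hx
          rw [hx]
      _ = (∫⁻ x in E, ‖f₀ (x + s • a • v)‖ₑ) + ∫⁻ x in E, ‖f (x + s • a • v) - f x‖ₑ := by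
          refine lintegral_add_left ?_ _
          exact hf₀.enorm.comp (by fun_prop)
      _ ≤ _ := by gcongr
  have hm : Measurable fun z : E3 × ℝ => ‖f₀ (z.1 + z.2 • a • v)‖ₑ := hf₀.enorm.comp (by fun_prop)
  calc ∫⁻ x in E, ‖f x‖ₑ = ∫⁻ _ in Ioc (0 : ℝ) 1, ∫⁻ x in E, ‖f x‖ₑ := by simp
    _ ≤ ∫⁻ s in Ioc (0 : ℝ) 1, ((∫⁻ x in E, ‖f₀ (x + s • a • v)‖ₑ) +
          ENNReal.ofReal (D * ‖v‖) * ∫⁻ x in Ω, ‖f' x‖ₑ) :=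
        setLIntegral_mono' measurableSet_Ioc hstep
    _ = (∫⁻ s in Ioc (0 : ℝ) 1, ∫⁻ x in E, ‖f₀ (x + s • a • v)‖ₑ) +
          ENNReal.ofReal (D * ‖v‖) * ∫⁻ x in Ω, ‖f' x‖ₑ := by
        rw [lintegral_add_right _ measurable_const]
        simp
    _ = (∫⁻ x in E, ∫⁻ s in Ioc (0 : ℝ) 1, ‖f₀ (x + s • a • v)‖ₑ) +
          ENNReal.ofReal (D * ‖v‖) * ∫⁻ x in Ω, ‖f' x‖ₑ := by
        rw [lintegral_lintegral_swap]
        exact (hm.comp measurable_swap).aemeasurable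
    _ ≤ (∫⁻ x in E, ∫⁻ s in Icc (0 : ℝ) 1, ‖f₀ (x + s • a • v)‖ₑ) +
          ENNReal.ofReal (D * ‖v‖) * ∫⁻ x in Ω, ‖f' x‖ₑ := by
        gcongr with x
        exact Ioc_subset_Icc_self
    _ ≤ ENNReal.ofReal (D / a) * (∫⁻ x, ‖f₀ x‖ₑ) +
          ENNReal.ofReal (D * ‖v‖) * ∫⁻ x in Ω, ‖f' x‖ₑ := by
        exact add_le_add (lintegral_translate_le hE ha hD hf₀.enorm) le_rfl
    _ = _ := by
        have h : ∫⁻ x, ‖f₀ x‖ₑ = ∫⁻ x in Ω, ‖f x‖ₑ := by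
          refine Eq.trans (lintegral_congr_ae ?_) (lintegral_enorm_indicator hΩ.measurableSet f)
          filter_upwards [hff₀] with x hx
          rw [hx]
        rw [h]

/-- Near a boundary point a regular domain has thin layers. -/
lemma IsRegularDomain.exists_thin_layer {Ω : Set E3} (hΩ : IsRegularDomain Ω) {x₀ : E3}
    (hx₀ : x₀ ∈ frontier Ω) : ∃ r > 0, ∃ a > (0 : ℝ), ∃ v : E3, ∃ M ≥ 0, ∀ δ ∈ Ioo 0 r,
      (∀ x ∈ Metric.ball x₀ r ∩ layer Ω δ, ∀ s : ℝ,
        x + s • v ∈ Metric.ball x₀ r ∩ layer Ω δ → |s| ≤ M * δ) ∧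
      ∀ x ∈ Metric.ball x₀ r ∩ layer Ω δ, ∀ s ∈ Icc 0 a, x + s • v ∈ Ω := by
  obtain ⟨κ, -, -, hb⟩ := hΩ.boundary
  obtain ⟨U, g, hU, hxU, hg, -, hg0, hgU⟩ := hb x₀ hx₀
  -- A direction transversal to the boundary and pointing into `Ω`: the defining function decreases
  -- along it.
  obtain ⟨v, hv⟩ : ∃ v, fderiv ℝ g x₀ v < 0 := by
    obtain ⟨w, hw⟩ : ∃ w, fderiv ℝ g x₀ w ≠ 0 := by
      by_contra! h
      exact hg0 (by ext w; simpa using h w)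
    rcases lt_or_gt_of_ne hw with h | h
    · exact ⟨w, h⟩
    · exact ⟨-w, by simpa using h⟩
  set c := - fderiv ℝ g x₀ v / 2 with hc
  have hcpos : 0 < c := by linarith
  set L := ‖fderiv ℝ g x₀‖ + 1 with hL
  have hLpos : 0 < L := by positivity
  have hcont : ContinuousAt (fderiv ℝ g) x₀ :=
    (hg.continuousOn_fderiv_of_isOpen hU one_le_two).continuousAt (hU.mem_nhds hxU)
  have hev1 : ∀ᶠ x in 𝓝 x₀, fderiv ℝ g x v < -c := by
    have h1 : ContinuousAt (fun x => fderiv ℝ g x v) x₀ := hcont.clm_apply continuousAt_const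
    exact h1.eventually (gt_mem_nhds (by linarith))
  have hev2 : ∀ᶠ x in 𝓝 x₀, ‖fderiv ℝ g x‖ < L :=
    hcont.norm.eventually (gt_mem_nhds (by linarith))
  obtain ⟨R, hR, hball⟩ := Metric.eventually_nhds_iff_ball.1
    ((hev1.and hev2).and (hU.eventually_mem hxU))
  have hdiff : ∀ x ∈ Metric.ball x₀ R, DifferentiableAt ℝ g x := fun x hx =>
    (hg.differentiableOn two_ne_zero).differentiableAt (hU.mem_nhds (hball x hx).2)
  have hmono : ∀ x : E3, ∀ s : ℝ, 0 ≤ s → x ∈ Metric.ball x₀ R → x + s • v ∈ Metric.ball x₀ R →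
      g (x + s • v) ≤ g x - c * s := by
    intro x s hs hx hxs
    have hmem : ∀ t ∈ Icc 0 s, x + t • v ∈ Metric.ball x₀ R := by
      intro t ht
      rcases hs.eq_or_lt with rfl | hs'
      · have : t = 0 := le_antisymm ht.2 ht.1
        simpa [this] using hx
      · have := (convex_ball x₀ R).add_smul_mem hx hxs (t := t / s)
          ⟨div_nonneg ht.1 hs, (div_le_one hs').2 ht.2⟩
        rwa [← mul_smul, div_mul_cancel₀ _ hs'.ne'] at this
    have hd : ∀ t ∈ Icc 0 s, HasDerivAt (fun t : ℝ => g (x + t • v)) (fderiv ℝ g (x + t • v) v) t := by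
      intro t ht
      have h2 : HasDerivAt (fun t : ℝ => x + t • v) v t := by
        simpa using ((hasDerivAt_id t).smul_const v).const_add x
      exact (hdiff _ (hmem t ht)).hasFDerivAt.comp_hasDerivAt t h2
    have := (convex_Icc 0 s).image_sub_le_mul_sub_of_deriv_le
      (f := fun t : ℝ => g (x + t • v)) (C := -c) (fun t ht => (hd t ht).continuousAt.continuousWithinAt)
      (fun t ht => (hd t (interior_subset ht)).differentiableAt.differentiableWithinAt)
      (fun t ht => by
        rw [(hd t (interior_subset ht)).deriv]
        exact (hball _ (hmem t (interior_subset ht))).1.1.le)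
      0 ⟨le_rfl, hs⟩ s ⟨hs, le_rfl⟩ hs
    simp only [zero_smul, add_zero, sub_zero] at this
    linarith
  have hneg : ∀ x ∈ Metric.ball x₀ R, (x ∈ Ω ↔ g x < 0) := by
    intro x hx
    have hxU := (hball x hx).2
    have : x ∈ Ω ∩ U ↔ x ∈ {y ∈ U | g y < 0} := by rw [hgU]
    simpa [hxU] using this
  -- A nearest point of the complement lies within `2R/3` of `x₀`, where `g ≥ 0` characterises the
  -- complement; since `g` is `L`-Lipschitz, it is at least `-L δ` on the layer.
  have hlay : ∀ δ ∈ Ioo 0 (R / 3), ∀ x ∈ Metric.ball x₀ (R / 3) ∩ layer Ω δ, -(L * δ) ≤ g x := by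
    rintro δ ⟨hδ, hδR⟩ x ⟨hx, hxΩ, hxd⟩
    have hne : Ωᶜ.Nonempty := ⟨x₀, fun h => by
      have := hΩ.isOpen.frontier_eq ▸ hx₀
      exact this.2 h⟩
    obtain ⟨z, hz, hzd⟩ := hΩ.isOpen.isClosed_compl.exists_infDist_eq_dist hne x
    rw [hzd] at hxd
    rw [Metric.mem_ball] at hx
    have hxR : x ∈ Metric.ball x₀ R := Metric.mem_ball.2 (by linarith)
    have hzR : z ∈ Metric.ball x₀ R := Metric.mem_ball.2 (by
      have := dist_triangle z x x₀
      rw [dist_comm z x] at this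
      linarith)
    have hgz : 0 ≤ g z := not_lt.1 fun h => hz ((hneg z hzR).2 h)
    have hlip := (convex_ball x₀ R).norm_image_sub_le_of_norm_fderiv_le (𝕜 := ℝ)
      hdiff (fun y hy => (hball y hy).1.2.le) hxR hzR
    rw [← dist_eq_norm z x, dist_comm z x, Real.norm_eq_abs] at hlip
    have : L * dist x z ≤ L * δ := by gcongr
    linarith [le_abs_self (g z - g x)]
  -- On the layer `g` takes values in `[-L δ, 0)`, and it falls at rate at least `c` along `v`: this
  -- gives the thickness `(L / c) δ`. The time `a` is such that points of the ball of radius `R/3`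
  -- move by at most `R/3`.
  refine ⟨R / 3, by positivity, R / 3 / (‖v‖ + 1), by positivity, v, L / c, by positivity,
    fun δ hδ => ⟨?_, ?_⟩⟩
  · have key : ∀ x ∈ Metric.ball x₀ (R / 3) ∩ layer Ω δ, ∀ s : ℝ, 0 ≤ s →
        x + s • v ∈ Metric.ball x₀ (R / 3) ∩ layer Ω δ → s ≤ L / c * δ := by
      intro x hx s hs hxs
      have hsub : Metric.ball x₀ (R / 3) ⊆ Metric.ball x₀ R :=
        Metric.ball_subset_ball (by linarith)
      have h1 := hmono x s hs (hsub hx.1) (hsub hxs.1)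
      have h2 := hlay δ hδ _ hxs
      have h3 := (hneg x (hsub hx.1)).1 hx.2.1
      rw [div_mul_eq_mul_div, le_div_iff₀ hcpos]
      linarith
    intro x hx s hxs
    rcases le_total 0 s with hs | hs
    · rw [abs_of_nonneg hs]; exact key x hx s hs hxs
    · rw [abs_of_nonpos hs]
      refine key _ hxs (-s) (by linarith) ?_
      simpa using hx
  · intro x hx s hs
    have hx1 := Metric.mem_ball.1 hx.1
    have hxR : x ∈ Metric.ball x₀ R := Metric.mem_ball.2 (by linarith)
    have hsv : ‖s • v‖ ≤ R / 3 := by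
      rw [norm_smul, Real.norm_of_nonneg hs.1]
      calc s * ‖v‖ ≤ R / 3 / (‖v‖ + 1) * (‖v‖ + 1) := by
            gcongr
            · exact hs.2
            · linarith
        _ = R / 3 := by field_simp
    have hxsR : x + s • v ∈ Metric.ball x₀ R := by
      rw [Metric.mem_ball]
      calc dist (x + s • v) x₀ ≤ dist (x + s • v) x + dist x x₀ := dist_triangle _ _ _
        _ < R := by rw [dist_eq_norm, add_sub_cancel_left]; linarith
    refine (hneg _ hxsR).2 ?_
    have h1 := hmono x s hs.1 hxR hxsR
    have h3 := (hneg x hxR).1 hx.2.1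
    nlinarith [hs.1]

end Layer

/-! ### Estimate of boundary layers and bounded variation of extensions by zero -/

section BV

variable {F : Type*} [NormedAddCommGroup F] [NormedSpace ℝ F] [CompleteSpace F]

lemma lintegral_biUnion_finset_le {ι α : Type*} [MeasurableSpace α] {μ : Measure α} (t : Finset ι)
    (s : ι → Set α) (f : α → ℝ≥0∞) :
    ∫⁻ x in ⋃ i ∈ t, s i, f x ∂μ ≤ ∑ i ∈ t, ∫⁻ x in s i, f x ∂μ := by
  classical
  induction t using Finset.induction_on with
  | empty => simp
  | insert i t hi ih =>
    rw [Finset.set_biUnion_insert, Finset.sum_insert hi]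
    exact (lintegral_union_le _ _ _).trans (by gcongr)

/-- Boundary layers of a regular domain: `∫_{layer δ} |f| ≤ c δ ‖f‖_{W^{1,1}}`. -/
lemma IsRegularDomain.exists_lintegral_layer_le {Ω : Set E3} (hΩ : IsRegularDomain Ω) :
    ∃ c ≥ (0 : ℝ), ∀ (f : E3 → F) (f' : E3 → E3 →L[ℝ] F), IntegrableOn f Ω → IntegrableOn f' Ω →
      HasWeakFDerivOn Ω f f' → ∀ δ > 0, ∫⁻ x in layer Ω δ, ‖f x‖ₑ ≤
        ENNReal.ofReal (c * δ) * ((∫⁻ x in Ω, ‖f x‖ₑ) + ∫⁻ x in Ω, ‖f' x‖ₑ) := by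
  have hcomp : IsCompact (frontier Ω) := by
    refine Metric.isCompact_of_isClosed_isBounded isClosed_frontier ?_
    exact hΩ.isBounded.closure.subset frontier_subset_closure
  have hthin := fun x (hx : x ∈ frontier Ω) => hΩ.exists_thin_layer hx
  choose! r hr a ha v M hM hlay using hthin
  obtain ⟨t, ht, hcover⟩ := hcomp.elim_nhds_subcover (fun x => Metric.ball x (r x))
    (fun x hx => Metric.ball_mem_nhds x (hr x hx))
  have hVopen : IsOpen (⋃ x ∈ t, Metric.ball x (r x)) :=
    isOpen_biUnion fun _ _ => Metric.isOpen_ball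
  obtain ⟨δ₀, hδ₀, hthick⟩ := hcomp.exists_thickening_subset_open hVopen hcover
  -- Below `δ₁` the layer lies in the union of the finitely many balls, and the local estimates hold
  -- in all of them.
  obtain ⟨δ₁, hδ₁, hδ₁'⟩ : ∃ δ₁ > 0, δ₁ ≤ δ₀ ∧ ∀ x ∈ t, δ₁ ≤ r x := by
    have h1 : ∀ᶠ δ in 𝓝[>] (0 : ℝ), δ ≤ δ₀ ∧ ∀ x ∈ t, δ ≤ r x := by
      refine Filter.Eventually.and ?_ ((Finset.eventually_all t).2 fun x hx => ?_)
      · exact eventually_nhdsWithin_of_eventually_nhds (eventually_le_nhds hδ₀)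
      · exact eventually_nhdsWithin_of_eventually_nhds (eventually_le_nhds (hr x (ht x hx)))
    obtain ⟨δ, h2, h3⟩ := (h1.and self_mem_nhdsWithin).exists
    exact ⟨δ, h3, h2⟩
  have hci : ∀ x ∈ t, 0 ≤ M x / a x + M x * ‖v x‖ := fun x hx => by
    have := ha x (ht x hx); have := hM x (ht x hx); positivity
  have hcs : 0 ≤ ∑ x ∈ t, (M x / a x + M x * ‖v x‖) := Finset.sum_nonneg hci
  -- The summand `1 / δ₁` takes care of thick layers, `δ ≥ δ₁`, for which the integral over all of
  -- `Ω` is a sufficient bound.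
  refine ⟨∑ x ∈ t, (M x / a x + M x * ‖v x‖) + 1 / δ₁, by positivity, ?_⟩
  intro f f' hf hf' hw δ hδ
  set I := ∫⁻ x in Ω, ‖f x‖ₑ with hI
  set I' := ∫⁻ x in Ω, ‖f' x‖ₑ with hI'
  rcases lt_or_ge δ δ₁ with hδδ | hδδ
  · have hsub : layer Ω δ ⊆ ⋃ x ∈ t, (Metric.ball x (r x) ∩ layer Ω δ) := by
      intro y hy
      have hne : Ω ≠ univ := by
        intro h
        have := hΩ.isBounded
        rw [h] at this
        exact NormedSpace.unbounded_univ ℝ E3 this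
      obtain ⟨z, hz, hzd⟩ := exists_mem_frontier_infDist_compl_eq_dist hy.1 hne
      have hyV := hthick (Metric.mem_thickening_iff.2 ⟨z, hz, by
        rw [← hzd]; exact hy.2.trans_lt (hδδ.trans_le hδ₁'.1)⟩)
      obtain ⟨x, hx, hyx⟩ := mem_iUnion₂.1 hyV
      exact mem_iUnion₂.2 ⟨x, hx, hyx, hy⟩
    have hloc : ∀ x ∈ t, ∫⁻ y in Metric.ball x (r x) ∩ layer Ω δ, ‖f y‖ₑ ≤
        ENNReal.ofReal ((M x / a x + M x * ‖v x‖) * δ) * (I + I') := by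
      intro x hx
      have hxf := ht x hx
      have h1 := hlay x hxf δ ⟨hδ, hδδ.trans_le (hδ₁'.2 x hx)⟩
      refine (lintegral_enorm_le_of_translate hΩ.isOpen
        (Metric.isOpen_ball.measurableSet.inter (measurableSet_layer hΩ.isOpen δ))
        (ha x hxf) h1.1 h1.2 hf hf' hw).trans ?_
      rw [mul_add]
      have := ha x hxf
      have := hM x hxf
      refine add_le_add (mul_le_mul_left (ENNReal.ofReal_le_ofReal ?_) _)
        (mul_le_mul_left (ENNReal.ofReal_le_ofReal ?_) _)
      · have : 0 ≤ M x * ‖v x‖ * δ := by positivity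
        rw [add_mul, mul_div_right_comm]; linarith
      · have : 0 ≤ M x / a x * δ := by positivity
        rw [add_mul, mul_right_comm]; linarith
    calc ∫⁻ x in layer Ω δ, ‖f x‖ₑ
        ≤ ∫⁻ x in ⋃ x ∈ t, (Metric.ball x (r x) ∩ layer Ω δ), ‖f x‖ₑ := lintegral_mono_set hsub
      _ ≤ ∑ x ∈ t, ∫⁻ y in Metric.ball x (r x) ∩ layer Ω δ, ‖f y‖ₑ :=
          lintegral_biUnion_finset_le t _ _
      _ ≤ ∑ x ∈ t, ENNReal.ofReal ((M x / a x + M x * ‖v x‖) * δ) * (I + I') :=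
          Finset.sum_le_sum hloc
      _ = ENNReal.ofReal ((∑ x ∈ t, (M x / a x + M x * ‖v x‖)) * δ) * (I + I') := by
          rw [← Finset.sum_mul, ← ENNReal.ofReal_sum_of_nonneg, Finset.sum_mul]
          exact fun x hx => mul_nonneg (hci x hx) hδ.le
      _ ≤ _ := by
          gcongr
          have : 0 < 1 / δ₁ := by positivity
          linarith
  · calc ∫⁻ x in layer Ω δ, ‖f x‖ₑ ≤ I := lintegral_mono_set fun x hx => hx.1
      _ ≤ 1 * (I + I') := by rw [one_mul]; exact le_self_add
      _ ≤ _ := by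
          gcongr
          rw [ENNReal.one_le_ofReal, add_mul]
          have h1 : 1 ≤ 1 / δ₁ * δ := by
            rw [one_div, inv_mul_eq_div, one_le_div hδ₁]; exact hδδ
          have h2 : 0 ≤ (∑ x ∈ t, (M x / a x + M x * ‖v x‖)) * δ := by positivity
          linarith

/-- The affine map `y ↦ A y + b` given by the pair `(A, b)`. -/
def affineMap (X : (E3 →L[ℝ] E3) × E3) (y : E3) : E3 := X.1 y + X.2

@[fun_prop]
lemma continuous_affineMap (X : (E3 →L[ℝ] E3) × E3) : Continuous (affineMap X) := by
  unfold affineMap; fun_prop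

lemma map_affineMap_volume (X : (E3 →L[ℝ] E3) × E3) (hX : X.1.det ≠ 0) :
    (volume : Measure E3).map (affineMap X) = ENNReal.ofReal |X.1.det⁻¹| • volume := by
  have h1 : affineMap X = (fun x => x + X.2) ∘ X.1 := rfl
  rw [h1, ← Measure.map_map (by fun_prop) (by fun_prop)]
  have h2 := Measure.map_linearMap_addHaar_eq_smul_addHaar (volume : Measure E3)
    (f := (X.1 : E3 →ₗ[ℝ] E3)) hX
  have h3 : (volume : Measure E3).map X.1 = ENNReal.ofReal |X.1.det⁻¹| • volume := h2
  rw [h3, Measure.map_smul, map_add_right_eq_self]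

lemma quasiMeasurePreserving_affineMap (X : (E3 →L[ℝ] E3) × E3) (hX : X.1.det ≠ 0) :
    Measure.QuasiMeasurePreserving (affineMap X) := by
  refine ⟨(continuous_affineMap X).measurable, ?_⟩
  rw [map_affineMap_volume X hX]
  exact Measure.smul_absolutelyContinuous

lemma lintegral_comp_affineMap_le (X : (E3 →L[ℝ] E3) × E3) (hX : 1 / 2 ≤ |X.1.det|)
    {G : E3 → ℝ≥0∞} (hG : AEMeasurable G) : ∫⁻ y, G (affineMap X y) ≤ 2 * ∫⁻ x, G x := by
  have hX0 : X.1.det ≠ 0 := fun h => by rw [h] at hX; norm_num at hX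
  have hac : AEMeasurable G ((volume : Measure E3).map (affineMap X)) :=
    hG.mono_ac (quasiMeasurePreserving_affineMap X hX0).absolutelyContinuous
  rw [← lintegral_map' hac (continuous_affineMap X).aemeasurable, map_affineMap_volume X hX0,
    lintegral_smul_measure, smul_eq_mul]
  refine mul_le_mul_left ?_ _
  have h2 : (2 : ℝ≥0∞) = ENNReal.ofReal 2 := by simp
  refine le_of_le_of_eq (ENNReal.ofReal_le_ofReal ?_) h2.symm
  rw [abs_inv]
  exact (inv_anti₀ (by norm_num) hX).trans (by norm_num)

lemma affineMap_add_smul_sub (X Y : (E3 →L[ℝ] E3) × E3) (y : E3) (s : ℝ) :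
    affineMap X y + s • (affineMap Y y - affineMap X y) = affineMap (X + s • (Y - X)) y := by
  simp [affineMap, smul_sub, smul_add]; abel

lemma det_ne_zero_of_half_le {A : E3 →L[ℝ] E3} (h : 1 / 2 ≤ |A.det|) : A.det ≠ 0 := fun h' => by
  rw [h'] at h; norm_num at h

/-- Tonelli: for each fixed `s` the map `y ↦ Γ (y, s)` is a change of variables with Jacobian
bounded below, so no mass concentrates along the paths. -/
lemma lintegral_path_le {Γ : E3 × ℝ → E3} (hΓ : Measurable Γ)
    (hchange : ∀ s ∈ Icc (0 : ℝ) 1, ∀ G : E3 → ℝ≥0∞, Measurable G →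
      ∫⁻ y, G (Γ (y, s)) ≤ 2 * ∫⁻ x, G x)
    {E : Set E3} (hE : MeasurableSet E) {w : E3 → ℝ≥0∞} {D : ℝ≥0∞} (hw : ∀ y ∈ E, w y ≤ D)
    {G : E3 → ℝ≥0∞} (hG : Measurable G) :
    ∫⁻ y in E, ∫⁻ s in Icc (0 : ℝ) 1, G (Γ (y, s)) * w y ≤ 2 * D * ∫⁻ x, G x := by
  have hm : Measurable (fun z : E3 × ℝ => G (Γ z)) := hG.comp hΓ
  calc ∫⁻ y in E, ∫⁻ s in Icc (0 : ℝ) 1, G (Γ (y, s)) * w y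
      ≤ ∫⁻ y in E, ∫⁻ s in Icc (0 : ℝ) 1, G (Γ (y, s)) * D :=
        setLIntegral_mono' hE fun y hy => lintegral_mono fun s => mul_le_mul_right (hw y hy) _
    _ ≤ ∫⁻ y, ∫⁻ s in Icc (0 : ℝ) 1, G (Γ (y, s)) * D := setLIntegral_le_lintegral _ _
    _ = ∫⁻ s in Icc (0 : ℝ) 1, ∫⁻ y, G (Γ (y, s)) * D :=
        lintegral_lintegral_swap (hm.mul_const _).aemeasurable
    _ ≤ ∫⁻ s in Icc (0 : ℝ) 1, (2 * ∫⁻ x, G x) * D := by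
        refine setLIntegral_mono' measurableSet_Icc fun s hs => ?_
        have hms : Measurable fun y => G (Γ (y, s)) := hm.comp measurable_prodMk_right
        rw [lintegral_mul_const _ hms]
        exact mul_le_mul_left (hchange s hs G hG) _
    _ = 2 * D * ∫⁻ x, G x := by
        rw [setLIntegral_const, Real.volume_Icc]
        simp
        ring

/-- The point at parameter `s` of the segment from `X y` to `Y y` is the image of `y` under an
affine map between `X` and `Y`, whose determinant is bounded below. -/
lemma lintegral_segment_affineMap_le {X Y : (E3 →L[ℝ] E3) × E3}
    (hdet : ∀ s ∈ Icc (0 : ℝ) 1, 1 / 2 ≤ |(X + s • (Y - X)).1.det|)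
    {E : Set E3} (hE : MeasurableSet E) {d : ℝ}
    (hdist : ∀ y ∈ E, ‖affineMap Y y - affineMap X y‖ ≤ d) {G : E3 → ℝ≥0∞} (hG : Measurable G) :
    ∫⁻ y in E, ∫⁻ s in Icc (0 : ℝ) 1,
      G (affineMap X y + s • (affineMap Y y - affineMap X y)) * ‖affineMap Y y - affineMap X y‖ₑ ≤
      ENNReal.ofReal (2 * d) * ∫⁻ x, G x := by
  have hX := (continuous_affineMap X).comp (continuous_fst (X := E3) (Y := ℝ))
  have hY := (continuous_affineMap Y).comp (continuous_fst (X := E3) (Y := ℝ))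
  have hc : Continuous (fun z : E3 × ℝ =>
      affineMap X z.1 + z.2 • (affineMap Y z.1 - affineMap X z.1)) :=
    hX.add (continuous_snd.smul (hY.sub hX))
  have h := lintegral_path_le hc.measurable (fun s hs G hG => by
    simp only [affineMap_add_smul_sub]
    exact lintegral_comp_affineMap_le _ (hdet s hs) hG.aemeasurable) hE
    (w := fun y => ‖affineMap Y y - affineMap X y‖ₑ) (D := ENNReal.ofReal d) (fun y hy => by
      rw [← ofReal_norm]; exact ENNReal.ofReal_le_ofReal (hdist y hy)) hG
  refine h.trans_eq ?_
  rw [ENNReal.ofReal_mul zero_le_two]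
  simp

lemma lintegral_affineMap_sub_le_of_segment {Ω : Set E3} (hΩ : IsOpen Ω) {f : E3 → F}
    {f' : E3 → E3 →L[ℝ] F} (hf : IntegrableOn f Ω) (hf' : IntegrableOn f' Ω)
    (hw : HasWeakFDerivOn Ω f f') {X Y : (E3 →L[ℝ] E3) × E3}
    (hdet : ∀ s ∈ Icc (0 : ℝ) 1, 1 / 2 ≤ |(X + s • (Y - X)).1.det|)
    {E : Set E3} (hE : MeasurableSet E) {d : ℝ}
    (hdist : ∀ y ∈ E, ‖affineMap Y y - affineMap X y‖ ≤ d)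
    (hEΩ : ∀ y ∈ E, ∀ s ∈ Icc (0 : ℝ) 1,
      affineMap X y + s • (affineMap Y y - affineMap X y) ∈ Ω) :
    ∫⁻ y in E, ‖Ω.indicator f (affineMap Y y) - Ω.indicator f (affineMap X y)‖ₑ ≤
      ENNReal.ofReal (2 * d) * ∫⁻ x in Ω, ‖f' x‖ₑ := by
  have hX := hdet 0 (by simp)
  have hY := hdet 1 (by simp)
  rw [zero_smul ℝ (Y - X), add_zero] at hX
  rw [one_smul ℝ (Y - X), add_sub_cancel] at hY
  have h1 := lintegral_enorm_sub_le_of_segment hΩ hf hf' hw hE (continuous_affineMap X)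
    (continuous_affineMap Y)
    (quasiMeasurePreserving_affineMap X (det_ne_zero_of_half_le hX))
    (quasiMeasurePreserving_affineMap Y (det_ne_zero_of_half_le hY)) hEΩ
    (fun G hG => lintegral_segment_affineMap_le hdet hE hdist hG)
  refine le_trans (le_of_eq ?_) h1
  refine setLIntegral_congr_fun hE fun y hy => ?_
  have hp : affineMap X y ∈ Ω := by simpa using hEΩ y hy 0 (by simp)
  have hq : affineMap Y y ∈ Ω := by simpa using hEΩ y hy 1 (by simp)
  simp only [indicator_of_mem hp, indicator_of_mem hq]

/-- The extension by zero of a function in `W^{1,1}(Ω)` is of bounded variation; in terms of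
affine changes of variables. -/
lemma IsRegularDomain.exists_lintegral_affineMap_sub_le {Ω S : Set E3} (hΩ : IsRegularDomain Ω)
    (hS : MeasurableSet S) (hSb : Bornology.IsBounded S) :
    ∃ C ≥ (0 : ℝ), ∀ (f : E3 → F) (f' : E3 → E3 →L[ℝ] F), IntegrableOn f Ω → IntegrableOn f' Ω →
      HasWeakFDerivOn Ω f f' → ∀ X Y : (E3 →L[ℝ] E3) × E3,
      (∀ s ∈ Icc (0 : ℝ) 1, 1 / 2 ≤ |(X + s • (Y - X)).1.det|) →
      ∫⁻ y in S, ‖Ω.indicator f (affineMap Y y) - Ω.indicator f (affineMap X y)‖ₑ ≤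
        ENNReal.ofReal (C * ‖Y - X‖) * ((∫⁻ x in Ω, ‖f x‖ₑ) + ∫⁻ x in Ω, ‖f' x‖ₑ) := by
  obtain ⟨c, hc, hlayer⟩ := hΩ.exists_lintegral_layer_le (F := F)
  obtain ⟨R, hR, hSR⟩ := hSb.exists_pos_norm_le
  -- With `d = (R + 1) ‖Y - X‖`, which bounds the displacement on `S`, the two interior parts
  -- contribute `2 d` each, and the layer of width `d` contributes `2 c d` for each of the two maps.
  refine ⟨(4 + 4 * c) * (R + 1), by positivity, ?_⟩
  intro f f' hf hf' hw X Y hdet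
  set d := (R + 1) * ‖Y - X‖ with hd
  set I := ∫⁻ x in Ω, ‖f x‖ₑ with hI
  set I' := ∫⁻ x in Ω, ‖f' x‖ₑ with hI'
  have hdist : ∀ y ∈ S, ‖affineMap Y y - affineMap X y‖ ≤ d := by
    intro y hy
    have h1 : affineMap Y y - affineMap X y = (Y - X).1 y + (Y - X).2 := by
      simp [affineMap]; abel
    rw [h1]
    calc ‖(Y - X).1 y + (Y - X).2‖ ≤ ‖(Y - X).1‖ * ‖y‖ + ‖(Y - X).2‖ :=
          (norm_add_le _ _).trans (add_le_add (ContinuousLinearMap.le_opNorm _ _) le_rfl)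
      _ ≤ ‖Y - X‖ * R + ‖Y - X‖ := by
          gcongr
          · exact norm_fst_le _
          · exact hSR y hy
          · exact norm_snd_le _
      _ = d := by rw [hd]; ring
  rcases (norm_nonneg (Y - X)).eq_or_lt with h0 | hpos
  · have hXY : Y = X := by rw [← sub_eq_zero]; exact norm_eq_zero.1 h0.symm
    simp [hXY]
  have hdpos : 0 < d := by positivity
  have hdetX : 1 / 2 ≤ |X.1.det| := by
    have h := hdet 0 (by simp)
    rwa [zero_smul ℝ (Y - X), add_zero] at h
  have hdetY : 1 / 2 ≤ |Y.1.det| := by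
    have h := hdet 1 (by simp)
    rwa [one_smul ℝ (Y - X), add_sub_cancel] at h
  have hqX := quasiMeasurePreserving_affineMap X (det_ne_zero_of_half_le hdetX)
  have hqY := quasiMeasurePreserving_affineMap Y (det_ne_zero_of_half_le hdetY)
  -- If one endpoint of the segment is deeper than `d` inside `Ω`, the segment has length at most
  -- `d` and stays in `Ω`. `E₁` and `E₂` are the points for which this holds at the `X` end and at
  -- the `Y` end.
  set E₁ : Set E3 := S ∩ {y | d < Metric.infDist (affineMap X y) Ωᶜ} with hE₁
  set E₂ : Set E3 := S ∩ {y | d < Metric.infDist (affineMap Y y) Ωᶜ} with hE₂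
  have hopen : ∀ X : (E3 →L[ℝ] E3) × E3, MeasurableSet {y | d < Metric.infDist (affineMap X y) Ωᶜ} :=
    fun X => (isOpen_lt continuous_const
      ((Metric.continuous_infDist_pt _).comp (continuous_affineMap X))).measurableSet
  have hseg : ∀ E ⊆ S, MeasurableSet E →
      (∀ y ∈ E, ∀ s ∈ Icc (0 : ℝ) 1, affineMap X y + s • (affineMap Y y - affineMap X y) ∈ Ω) →
      ∫⁻ y in E, ‖Ω.indicator f (affineMap Y y) - Ω.indicator f (affineMap X y)‖ₑ ≤
        ENNReal.ofReal (2 * d) * I' := fun E hES hE hEΩ =>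
    lintegral_affineMap_sub_le_of_segment hΩ.isOpen hf hf' hw hdet hE
      (fun y hy => hdist y (hES hy)) hEΩ
  have hin : ∀ x z : E3, d < Metric.infDist x Ωᶜ → dist x z ≤ d → z ∈ Ω := by
    intro x z hx hz
    by_contra h
    exact absurd (hx.trans_le ((Metric.infDist_le_dist_of_mem h).trans hz)) (lt_irrefl _)
  have hb₁ := hseg E₁ inter_subset_left (hS.inter (hopen X)) (by
    rintro y ⟨hyS, hy⟩ s hs
    refine hin _ _ hy ?_
    rw [dist_self_add_right, norm_smul, Real.norm_of_nonneg hs.1]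
    calc s * _ ≤ 1 * d := mul_le_mul hs.2 (hdist y hyS) (norm_nonneg _) zero_le_one
      _ = d := one_mul d)
  have hb₂ := hseg E₂ inter_subset_left (hS.inter (hopen Y)) (by
    rintro y ⟨hyS, hy⟩ s hs
    refine hin _ _ hy ?_
    have : affineMap X y + s • (affineMap Y y - affineMap X y) =
        affineMap Y y + (s - 1) • (affineMap Y y - affineMap X y) := by
      rw [sub_smul, one_smul]; abel
    rw [this, dist_self_add_right, norm_smul, Real.norm_eq_abs, abs_sub_comm,
      abs_of_nonneg (by linarith [hs.2])]
    calc (1 - s) * _ ≤ 1 * d :=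
          mul_le_mul (by linarith [hs.1]) (hdist y hyS) (norm_nonneg _) zero_le_one
      _ = d := one_mul d)
  set g : E3 → F := (layer Ω d).indicator f with hg
  have hlm := measurableSet_layer hΩ.isOpen d
  have hgm : AEMeasurable (fun x => ‖g x‖ₑ) := by
    have h1 : IntegrableOn f (layer Ω d) := hf.mono_set fun x hx => hx.1
    exact (integrable_indicator_of_integrableOn hlm h1).aestronglyMeasurable.enorm
  have hglay : ∫⁻ x, ‖g x‖ₑ ≤ ENNReal.ofReal (c * d) * (I + I') := by
    rw [hg, lintegral_enorm_indicator hlm]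
    exact hlayer f f' hf hf' hw d hdpos
  -- For the remaining points each endpoint is outside `Ω` or in the layer of width `d`, so the
  -- extension by zero may be replaced by the part of `f` on the layer.
  have hrest : ∀ y ∈ S \ (E₁ ∪ E₂),
      ‖Ω.indicator f (affineMap Y y) - Ω.indicator f (affineMap X y)‖ₑ ≤
        ‖g (affineMap Y y)‖ₑ + ‖g (affineMap X y)‖ₑ := by
    rintro y ⟨hyS, hy⟩
    have hZ : ∀ x, ¬ d < Metric.infDist x Ωᶜ → Ω.indicator f x = g x := by
      intro x hx
      by_cases hxΩ : x ∈ Ω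
      · rw [indicator_of_mem hxΩ, hg, indicator_of_mem]
        exact ⟨hxΩ, not_lt.1 hx⟩
      · rw [indicator_of_notMem hxΩ, hg, indicator_of_notMem]
        exact fun h => hxΩ h.1
    rw [hZ (affineMap X y) fun h => hy (Or.inl ⟨hyS, h⟩),
      hZ (affineMap Y y) fun h => hy (Or.inr ⟨hyS, h⟩)]
    exact enorm_sub_le
  have hsplit : S ⊆ (E₁ ∪ E₂) ∪ (S \ (E₁ ∪ E₂)) := fun y hy => by
    by_cases h : y ∈ E₁ ∪ E₂
    · exact Or.inl h
    · exact Or.inr ⟨hy, h⟩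
  have hmE : MeasurableSet (S \ (E₁ ∪ E₂)) :=
    hS.diff ((hS.inter (hopen X)).union (hS.inter (hopen Y)))
  calc ∫⁻ y in S, ‖Ω.indicator f (affineMap Y y) - Ω.indicator f (affineMap X y)‖ₑ
      ≤ ((∫⁻ y in E₁, ‖Ω.indicator f (affineMap Y y) - Ω.indicator f (affineMap X y)‖ₑ) +
        ∫⁻ y in E₂, ‖Ω.indicator f (affineMap Y y) - Ω.indicator f (affineMap X y)‖ₑ) +
        ∫⁻ y in S \ (E₁ ∪ E₂), ‖Ω.indicator f (affineMap Y y) - Ω.indicator f (affineMap X y)‖ₑ :=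
        (lintegral_mono_set hsplit).trans ((lintegral_union_le _ _ _).trans
          (add_le_add (lintegral_union_le _ _ _) le_rfl))
    _ ≤ (ENNReal.ofReal (2 * d) * I' + ENNReal.ofReal (2 * d) * I') +
        ∫⁻ y, (‖g (affineMap Y y)‖ₑ + ‖g (affineMap X y)‖ₑ) := by
        refine add_le_add (add_le_add hb₁ hb₂) ?_
        exact (setLIntegral_mono' hmE hrest).trans (setLIntegral_le_lintegral _ _)
    _ = (ENNReal.ofReal (2 * d) * I' + ENNReal.ofReal (2 * d) * I') +
        ((∫⁻ y, ‖g (affineMap Y y)‖ₑ) + ∫⁻ y, ‖g (affineMap X y)‖ₑ) := by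
        have hgY : AEMeasurable fun y => ‖g (affineMap Y y)‖ₑ := hgm.comp_quasiMeasurePreserving hqY
        rw [lintegral_add_left' hgY]
    _ ≤ (ENNReal.ofReal (2 * d) * (I + I') + ENNReal.ofReal (2 * d) * (I + I')) +
        (2 * (ENNReal.ofReal (c * d) * (I + I')) + 2 * (ENNReal.ofReal (c * d) * (I + I'))) := by
        have hII : I' ≤ I + I' := le_add_self
        refine add_le_add (by gcongr) (add_le_add ?_ ?_)
        · exact (lintegral_comp_affineMap_le Y hdetY hgm).trans (by gcongr)
        · exact (lintegral_comp_affineMap_le X hdetX hgm).trans (by gcongr)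
    _ = ENNReal.ofReal ((4 + 4 * c) * (R + 1) * ‖Y - X‖) * (I + I') := by
        have : (4 + 4 * c) * (R + 1) * ‖Y - X‖ = (2 * d + 2 * d) + 2 * (c * d + c * d) := by
          rw [hd]; ring
        have hcd : 0 ≤ c * d := by positivity
        rw [this, ENNReal.ofReal_add (by positivity) (by positivity),
          ENNReal.ofReal_add (by positivity) (by positivity), ENNReal.ofReal_mul zero_le_two (q := c * d + c * d),
          ENNReal.ofReal_add hcd hcd, ENNReal.ofReal_ofNat]
        ring

/-- Leibniz rule for weak derivatives. -/
lemma HasWeakFDerivOn.smul_contDiff {Ω : Set E3} {f : E3 → ℝ} {f' : E3 → E3 →L[ℝ] ℝ}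
    (hf : IntegrableOn f Ω) (hf' : IntegrableOn f' Ω) (hw : HasWeakFDerivOn Ω f f')
    {Φ : E3 → F} (hΦ : ContDiff ℝ ∞ Φ) :
    HasWeakFDerivOn Ω (fun x => f x • Φ x)
      (fun x => (f' x).smulRight (Φ x) + f x • fderiv ℝ Φ x) := by
  intro φ hφ hφc hφΩ v
  have hΦc : Continuous Φ := hΦ.continuous
  have hΦd : Continuous (fun x => fderiv ℝ Φ x v) :=
    (hΦ.continuous_fderiv (by simp)).clm_apply continuous_const
  have hφd : Continuous (fun x => fderiv ℝ φ x v) :=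
    (hφ.continuous_fderiv (by simp)).clm_apply continuous_const
  have hφdc : HasCompactSupport (fun x => fderiv ℝ φ x v) :=
    (hφc.fderiv ℝ).comp_left (g := fun L : E3 →L[ℝ] ℝ => L v) (by simp)
  have hint : ∀ (g : E3 → ℝ) (G : E3 → F), IntegrableOn g Ω → Continuous G → HasCompactSupport G →
      Integrable (fun x => g x • G x) (volume.restrict Ω) := by
    intro g G hg hG hGc
    obtain ⟨C, hC⟩ := hGc.exists_bound_of_continuous hG
    exact hg.smul_bdd C hG.aestronglyMeasurable (Eventually.of_forall hC)
  have hf'v : IntegrableOn (fun x => f' x v) Ω :=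
    ((ContinuousLinearMap.apply ℝ ℝ v).integrable_comp hf')
  have i1 : Integrable (fun x => f x • (fderiv ℝ φ x v • Φ x)) (volume.restrict Ω) :=
    hint f _ hf (hφd.smul hΦc) (hφdc.smul_right)
  have i2 : Integrable (fun x => f' x v • (φ x • Φ x)) (volume.restrict Ω) :=
    hint _ _ hf'v (hφ.continuous.smul hΦc) (hφc.smul_right)
  have i3 : Integrable (fun x => f x • (φ x • fderiv ℝ Φ x v)) (volume.restrict Ω) :=
    hint _ _ hf (hφ.continuous.smul hΦd) (hφc.smul_right)
  have e1 : ∀ x, fderiv ℝ φ x v • f x • Φ x = f x • (fderiv ℝ φ x v • Φ x) := fun x =>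
    smul_comm _ _ _
  have e2 : ∀ x, φ x • ((f' x).smulRight (Φ x) + f x • fderiv ℝ Φ x) v =
      f' x v • (φ x • Φ x) + f x • (φ x • fderiv ℝ Φ x v) := fun x => by
    simp only [add_apply, ContinuousLinearMap.smulRight_apply,
      smul_apply, smul_add]
    rw [smul_comm (φ x) (f' x v), smul_comm (φ x) (f x)]
  simp_rw [e1, e2]
  rw [integral_add i2 i3]
  -- Functionals reduce the vector-valued identity to a scalar one, which is the weak derivative of
  -- `f` tested with `φ · ℓ(Φ)`.
  refine (SeparatingDual.eq_iff_forall_dual_eq (R := ℝ)).2 fun ℓ => ?_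
  rw [map_neg, map_add, ← ℓ.integral_comp_comm i1, ← ℓ.integral_comp_comm i2,
    ← ℓ.integral_comp_comm i3, ← integral_add (ℓ.integrable_comp i2) (ℓ.integrable_comp i3)]
  have hψ := hw (fun x => φ x * ℓ (Φ x)) (hφ.mul (ℓ.contDiff.comp hΦ)) hφc.mul_right
    ((tsupport_mul_subset_left).trans hφΩ) v
  have hd : ∀ x, fderiv ℝ (fun x => φ x * ℓ (Φ x)) x v =
      fderiv ℝ φ x v * ℓ (Φ x) + φ x * ℓ (fderiv ℝ Φ x v) := by
    intro x
    have h1 := (hφ.differentiable (by simp) x).hasFDerivAt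
    have h2 := ℓ.hasFDerivAt.comp x (hΦ.differentiable (by simp) x).hasFDerivAt
    have h3 : HasFDerivAt (fun x => φ x * ℓ (Φ x)) _ x := h1.mul h2
    rw [h3.fderiv]
    simp
    ring
  simp_rw [hd] at hψ
  have e3 : ∀ x, (fderiv ℝ φ x v * ℓ (Φ x) + φ x * ℓ (fderiv ℝ Φ x v)) • f x =
      ℓ (f x • (fderiv ℝ φ x v • Φ x)) + ℓ (f x • (φ x • fderiv ℝ Φ x v)) := fun x => by
    simp; ring
  have e4 : ∀ x, (φ x * ℓ (Φ x)) • f' x v = ℓ (f' x v • (φ x • Φ x)) := fun x => by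
    simp; ring
  simp_rw [e3, e4] at hψ
  rw [integral_add (ℓ.integrable_comp i1) (ℓ.integrable_comp i3)] at hψ
  rw [integral_add (ℓ.integrable_comp i2) (ℓ.integrable_comp i3)]
  linarith

end BV

/-! ### The cross product -/

section Cross

lemma cross_apply_zero (a b : E3) : cross a b 0 = a 1 * b 2 - a 2 * b 1 := by
  simp [cross, cross_apply]
lemma cross_apply_one (a b : E3) : cross a b 1 = a 2 * b 0 - a 0 * b 2 := by
  simp [cross, cross_apply]
lemma cross_apply_two (a b : E3) : cross a b 2 = a 0 * b 1 - a 1 * b 0 := by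
  simp [cross, cross_apply]

lemma E3_ext {a b : E3} (h0 : a 0 = b 0) (h1 : a 1 = b 1) (h2 : a 2 = b 2) : a = b := by
  ext i; fin_cases i
  exacts [h0, h1, h2]

lemma cross_add_left (a b c : E3) : cross (a + b) c = cross a c + cross b c := by
  apply E3_ext <;> simp [cross_apply_zero, cross_apply_one, cross_apply_two] <;> ring

lemma cross_add_right (a b c : E3) : cross a (b + c) = cross a b + cross a c := by
  apply E3_ext <;> simp [cross_apply_zero, cross_apply_one, cross_apply_two] <;> ring

lemma cross_smul_left (r : ℝ) (a b : E3) : cross (r • a) b = r • cross a b := by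
  apply E3_ext <;> simp [cross_apply_zero, cross_apply_one, cross_apply_two] <;> ring

lemma cross_smul_right (r : ℝ) (a b : E3) : cross a (r • b) = r • cross a b := by
  apply E3_ext <;> simp [cross_apply_zero, cross_apply_one, cross_apply_two] <;> ring

lemma cross_sub_right (a b c : E3) : cross a (b - c) = cross a b - cross a c := by
  apply E3_ext <;> simp [cross_apply_zero, cross_apply_one, cross_apply_two] <;> ring

lemma cross_sub_left (a b c : E3) : cross (a - b) c = cross a c - cross b c := by
  apply E3_ext <;> simp [cross_apply_zero, cross_apply_one, cross_apply_two] <;> ring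

lemma inner_eq_sum (a b : E3) : inner ℝ a b = a 0 * b 0 + a 1 * b 1 + a 2 * b 2 := by
  simp [PiLp.inner_apply, Fin.sum_univ_three]; ring

lemma norm_sq_eq_sum (a : E3) : ‖a‖ ^ 2 = a 0 ^ 2 + a 1 ^ 2 + a 2 ^ 2 := by
  rw [← real_inner_self_eq_norm_sq, inner_eq_sum]; ring

/-- Skew-symmetry of `a × ·`: the reason why rigid fields preserve norms and why adjoints invert
their flows. -/
lemma inner_cross_add_inner_cross (a x y : E3) :
    inner ℝ (cross a x) y + inner ℝ x (cross a y) = 0 := by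
  simp only [inner_eq_sum, cross_apply_zero, cross_apply_one, cross_apply_two]; ring

/-- The cross product as a continuous bilinear map. -/
def crossL : E3 →L[ℝ] E3 →L[ℝ] E3 :=
  LinearMap.toContinuousLinearMap
    ((LinearMap.toContinuousLinearMap : (E3 →ₗ[ℝ] E3) ≃ₗ[ℝ] (E3 →L[ℝ] E3)).toLinearMap ∘ₗ
      LinearMap.mk₂ ℝ cross cross_add_left cross_smul_left cross_add_right cross_smul_right)

@[simp] lemma crossL_apply (a b : E3) : crossL a b = cross a b := rfl

end Cross

/-! ### Moments of a density -/

section Moments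

/-- Mass, first moment, second moment (inertia about the origin), momentum and angular momentum
about the origin. -/
abbrev Moments : Type := ℝ × E3 × (Fin 3 → Fin 3 → ℝ) × E3 × E3

/-- The contribution of a unit point mass at `z.1` with velocity `z.2` to the moments. -/
def momentKernel (z : E3 × E3) : Moments :=
  (1, z.1, fun i j => ‖z.1‖ ^ 2 * (1 : Matrix (Fin 3) (Fin 3) ℝ) i j - z.1 i * z.1 j, z.2,
    cross z.1 z.2)

lemma contDiff_momentKernel : ContDiff ℝ ∞ momentKernel := by
  have hc : ∀ i : Fin 3, ContDiff ℝ ∞ fun z : E3 × E3 => z.1 i := fun i =>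
    (EuclideanSpace.proj (𝕜 := ℝ) i).contDiff.comp contDiff_fst
  refine contDiff_const.prodMk (contDiff_fst.prodMk (ContDiff.prodMk ?_ (contDiff_snd.prodMk ?_)))
  · refine contDiff_pi.2 fun i => contDiff_pi.2 fun j => ?_
    exact ((contDiff_fst.norm_sq ℝ).mul contDiff_const).sub ((hc i).mul (hc j))
  · exact (crossL.contDiff.comp contDiff_fst).clm_apply contDiff_snd

/-- The moments of the density `w` moving with velocity `v`. -/
def moments (Ω : Set E3) (w : E3 → ℝ) (v : E3 → E3) : Moments :=
  ∫ x in Ω, w x • momentKernel (x, v x)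

/-- Centre of mass in terms of the moments. -/
def momCenter (M : Moments) : E3 := M.1⁻¹ • M.2.1

/-- Inertia matrix about `h` in terms of the moments. -/
def momInertiaAt (h : E3) (M : Moments) : Matrix (Fin 3) (Fin 3) ℝ := fun i j =>
  M.2.2.1 i j - 2 * (h 0 * M.2.1 0 + h 1 * M.2.1 1 + h 2 * M.2.1 2) *
    (1 : Matrix (Fin 3) (Fin 3) ℝ) i j + (h i * M.2.1 j + M.2.1 i * h j) +
    M.1 * ((h 0 ^ 2 + h 1 ^ 2 + h 2 ^ 2) * (1 : Matrix (Fin 3) (Fin 3) ℝ) i j - h i * h j)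

/-- Inertia matrix about the centre of mass. -/
def momInertia (M : Moments) : Matrix (Fin 3) (Fin 3) ℝ := momInertiaAt (momCenter M) M

/-- Angular velocity in terms of the moments. -/
def momAngular (M : Moments) : E3 :=
  WithLp.toLp 2 ((momInertia M)⁻¹.mulVec
    (WithLp.ofLp (M.2.2.2.2 - cross (momCenter M) M.2.2.2.1)))

/-- Velocity at the origin of the rigid field, in terms of the moments. -/
def momLinear (M : Moments) : E3 := M.1⁻¹ • M.2.2.2.1 - cross (momAngular M) (momCenter M)

lemma integral_linearMap_comp {G : Type*} [NormedAddCommGroup G] [NormedSpace ℝ G] [CompleteSpace G]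
    {Ω : Set E3} {k : E3 → Moments} (hk : IntegrableOn k Ω) (ℓ : Moments →ₗ[ℝ] G) :
    ∫ x in Ω, ℓ (k x) = ℓ (∫ x in Ω, k x) :=
  (LinearMap.toContinuousLinearMap ℓ).integral_comp_comm hk

variable {Ω : Set E3} {w : E3 → ℝ} {v : E3 → E3}

lemma mass_eq_moments (hk : IntegrableOn (fun x => w x • momentKernel (x, v x)) Ω) :
    mass Ω w = (moments Ω w v).1 := by
  have := integral_linearMap_comp hk (LinearMap.fst ℝ ℝ _)
  simpa [momentKernel, mass, moments] using this

lemma center_eq_moments (hk : IntegrableOn (fun x => w x • momentKernel (x, v x)) Ω) :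
    center Ω w = momCenter (moments Ω w v) := by
  have h := integral_linearMap_comp hk (LinearMap.fst ℝ E3 _ ∘ₗ LinearMap.snd ℝ ℝ _)
  rw [center, mass_eq_moments hk, momCenter]
  congr 1

/-- With the point `h` held fixed, the inertia about `h` is linear in the moments (expansion of the
square, as for parallel axes), so it commutes with the integral; only then is `h` taken to be the
centre of mass. The angular momentum is treated in the same way. -/
lemma inertia_eq_moments (hk : IntegrableOn (fun x => w x • momentKernel (x, v x)) Ω) :
    inertia Ω w = momInertia (moments Ω w v) := by
  ext i j
  set h := momCenter (moments Ω w v) with hh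
  have h1 := integral_linearMap_comp hk (IsLinearMap.mk' (fun M => momInertiaAt h M i j)
    ⟨fun M N => by simp [momInertiaAt]; ring, fun c M => by simp [momInertiaAt]; ring⟩)
  simp only [IsLinearMap.mk'_apply] at h1
  refine Eq.trans ?_ h1
  unfold inertia
  rw [center_eq_moments hk, ← hh]
  congr 1; ext x
  simp only [momInertiaAt, momentKernel, norm_sq_eq_sum, Prod.smul_mk, smul_eq_mul, PiLp.sub_apply,
    PiLp.smul_apply, Pi.smul_apply]
  ring

lemma angularMomentum_eq_moments (hk : IntegrableOn (fun x => w x • momentKernel (x, v x)) Ω) :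
    angularMomentum Ω w v = (moments Ω w v).2.2.2.2 -
      cross (momCenter (moments Ω w v)) (moments Ω w v).2.2.2.1 := by
  set h := momCenter (moments Ω w v) with hh
  have h1 := integral_linearMap_comp hk
    (IsLinearMap.mk' (fun M : Moments => M.2.2.2.2 - cross h M.2.2.2.1)
    ⟨fun M N => by simp [cross_add_right]; abel, fun c M => by simp [cross_smul_right, smul_sub]⟩)
  simp only [IsLinearMap.mk'_apply] at h1
  rw [angularMomentum, moments]
  refine Eq.trans ?_ h1
  rw [center_eq_moments hk, ← hh]
  congr 1; ext x : 1
  simp only [momentKernel, Prod.smul_mk, cross_sub_left, cross_smul_right, smul_sub]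

lemma momentum_eq_moments (hk : IntegrableOn (fun x => w x • momentKernel (x, v x)) Ω) :
    ∫ y in Ω, w y • v y = (moments Ω w v).2.2.2.1 :=
  integral_linearMap_comp hk
    (LinearMap.fst ℝ E3 E3 ∘ₗ LinearMap.snd ℝ (Fin 3 → Fin 3 → ℝ) _ ∘ₗ
      LinearMap.snd ℝ E3 _ ∘ₗ LinearMap.snd ℝ ℝ _)

/-- The term `-ω × h` is absorbed into the constant, which leaves a field `a + ω × x` whose two
coefficients are functions of the moments alone. -/
lemma rigidProj_eq_moments (hk : IntegrableOn (fun x => w x • momentKernel (x, v x)) Ω) (x : E3) :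
    rigidProj Ω w v x = momLinear (moments Ω w v) + cross (momAngular (moments Ω w v)) x := by
  have hω : angularVelocity Ω w v = momAngular (moments Ω w v) := by
    rw [angularVelocity, inertia_eq_moments hk, angularMomentum_eq_moments hk, momAngular]
  rw [rigidProj, hω, momLinear, mass_eq_moments hk, momentum_eq_moments hk, center_eq_moments hk,
    cross_sub_right]
  abel

/-! Regularity of the rigid velocity as a function of the moments. -/

lemma contDiffAt_apply {n : WithTop ℕ∞} {V : Type*} [NormedAddCommGroup V] [NormedSpace ℝ V]
    {f : V → E3} {x : V} (hf : ContDiffAt ℝ n f x) (i : Fin 3) : ContDiffAt ℝ n (fun y => f y i) x :=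
  (EuclideanSpace.proj (𝕜 := ℝ) i).contDiff.contDiffAt.comp x hf

lemma contDiffAt_momCenter {M : Moments} (hM : M.1 ≠ 0) : ContDiffAt ℝ 1 momCenter M :=
  (contDiffAt_fst.inv hM).smul (contDiffAt_fst.comp M contDiffAt_snd)

lemma contDiffAt_cross {V : Type*} [NormedAddCommGroup V] [NormedSpace ℝ V]
    {f g : V → E3} {x : V} (hf : ContDiffAt ℝ 1 f x) (hg : ContDiffAt ℝ 1 g x) :
    ContDiffAt ℝ 1 (fun y => cross (f y) (g y)) x :=
  (crossL.contDiff.contDiffAt.comp x hf).clm_apply hg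

lemma contDiffAt_momInertia {M : Moments} (hM : M.1 ≠ 0) (i j : Fin 3) :
    ContDiffAt ℝ 1 (fun M => momInertia M i j) M := by
  have hc := fun k => contDiffAt_apply (contDiffAt_momCenter hM) k
  have hp : ∀ k, ContDiffAt ℝ 1 (fun M : Moments => M.2.1 k) M := fun k =>
    contDiffAt_apply (contDiffAt_fst.comp M contDiffAt_snd) k
  have hQ : ContDiffAt ℝ 1 (fun M : Moments => M.2.2.1 i j) M := by
    have h : ContDiff ℝ 1 (fun M : Moments => M.2.2.1) :=
      contDiff_fst.comp (contDiff_snd.comp contDiff_snd)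
    exact (contDiff_pi.1 (contDiff_pi.1 h i) j).contDiffAt
  have hm : ContDiffAt ℝ 1 (fun M : Moments => M.1) M := contDiffAt_fst
  unfold momInertia momInertiaAt
  refine ((hQ.sub ((contDiffAt_const.mul ((((hc 0).mul (hp 0)).add ((hc 1).mul (hp 1))).add
    ((hc 2).mul (hp 2)))).mul contDiffAt_const)).add (((hc i).mul (hp j)).add
    ((hp i).mul (hc j)))).add (hm.mul ?_)
  exact (((((hc 0).pow 2).add ((hc 1).pow 2)).add ((hc 2).pow 2)).mul contDiffAt_const).sub
    ((hc i).mul (hc j))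

lemma contDiffAt_det {V : Type*} [NormedAddCommGroup V] [NormedSpace ℝ V]
    {A : V → Matrix (Fin 3) (Fin 3) ℝ} {x : V} (hA : ∀ i j, ContDiffAt ℝ 1 (fun y => A y i j) x) :
    ContDiffAt ℝ 1 (fun y => (A y).det) x := by
  simp only [Matrix.det_apply']
  refine ContDiffAt.sum fun σ _ => contDiffAt_const.mul ?_
  exact contDiffAt_prod fun i _ => hA _ _

/-- Cramer's rule: the entries of the inverse are determinants divided by a nonzero determinant. -/
lemma contDiffAt_inv_apply {V : Type*} [NormedAddCommGroup V] [NormedSpace ℝ V]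
    {A : V → Matrix (Fin 3) (Fin 3) ℝ} {x : V} (hA : ∀ i j, ContDiffAt ℝ 1 (fun y => A y i j) x)
    (hdet : (A x).det ≠ 0) (i j : Fin 3) : ContDiffAt ℝ 1 (fun y => (A y)⁻¹ i j) x := by
  simp only [Matrix.inv_def, Matrix.smul_apply, Ring.inverse_eq_inv', smul_eq_mul,
    Matrix.adjugate_apply]
  refine ((contDiffAt_det hA).inv hdet).mul (contDiffAt_det fun k l => ?_)
  simp only [Matrix.updateRow_apply]
  split_ifs
  · exact contDiffAt_const
  · exact hA k l

lemma contDiffAt_momAngular {M : Moments} (hM : M.1 ≠ 0) (hJ : (momInertia M).det ≠ 0) :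
    ContDiffAt ℝ 1 momAngular M := by
  have hV : ContDiffAt ℝ 1 (fun M : Moments => M.2.2.2.1) M :=
    (contDiff_fst.comp (contDiff_snd.comp (contDiff_snd.comp contDiff_snd))).contDiffAt
  have hL : ContDiffAt ℝ 1 (fun M : Moments => M.2.2.2.2) M :=
    (contDiff_snd.comp (contDiff_snd.comp (contDiff_snd.comp contDiff_snd))).contDiffAt
  have hd := hL.sub (contDiffAt_cross (contDiffAt_momCenter hM) hV)
  rw [contDiffAt_euclidean]
  intro i
  simp only [momAngular, Matrix.mulVec, dotProduct]
  exact ContDiffAt.sum fun j _ =>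
    (contDiffAt_inv_apply (contDiffAt_momInertia hM) hJ i j).mul (contDiffAt_apply hd j)

lemma contDiffAt_momLinear {M : Moments} (hM : M.1 ≠ 0) (hJ : (momInertia M).det ≠ 0) :
    ContDiffAt ℝ 1 momLinear M := by
  have hV : ContDiffAt ℝ 1 (fun M : Moments => M.2.2.2.1) M :=
    (contDiff_fst.comp (contDiff_snd.comp (contDiff_snd.comp contDiff_snd))).contDiffAt
  exact ((contDiffAt_fst.inv hM).smul hV).sub
    (contDiffAt_cross (contDiffAt_momAngular hM hJ) (contDiffAt_momCenter hM))

/-- The inertia matrix of a nonnegative nonzero density is positive definite. -/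
lemma det_inertia_pos {Ω : Set E3} (hΩ : MeasurableSet Ω) (hb : Bornology.IsBounded Ω) {w : E3 → ℝ}
    (hw : IntegrableOn w Ω) (hw0 : ∀ᵐ x ∂(volume.restrict Ω), 0 ≤ w x) (hm : 0 < mass Ω w) :
    0 < (inertia Ω w).det := by
  set h := center Ω w with hh
  obtain ⟨R, hR⟩ := hb.exists_norm_le
  have hint : ∀ g : E3 → ℝ, Continuous g → IntegrableOn (fun x => w x * g x) Ω := by
    intro g hg
    obtain ⟨C, hC⟩ := (isCompact_closedBall (0 : E3) R).exists_bound_of_continuousOn hg.continuousOn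
    refine Integrable.mul_bdd (c := C) hw hg.aestronglyMeasurable ?_
    filter_upwards [ae_restrict_mem hΩ] with x hx
    exact hC x (mem_closedBall_zero_iff.2 (hR x hx))
  have hcoord : ∀ i : Fin 3, Continuous fun x : E3 => (x - h) i := fun i =>
    (EuclideanSpace.proj (𝕜 := ℝ) i).continuous.comp (continuous_id.sub continuous_const)
  -- The quadratic form of the inertia matrix is `e ↦ ∫ w |e × (x - h)|²`.
  have hquad : ∀ e : Fin 3 → ℝ, e ⬝ᵥ (inertia Ω w).mulVec e =
      ∫ x in Ω, w x * ‖cross (WithLp.toLp 2 e) (x - h)‖ ^ 2 := by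
    intro e
    have hentry : ∀ i j, IntegrableOn (fun x => w x * (‖x - h‖ ^ 2 *
        (1 : Matrix (Fin 3) (Fin 3) ℝ) i j - (x - h) i * (x - h) j)) Ω := fun i j =>
      hint _ ((((continuous_id.sub continuous_const).norm.pow 2).mul continuous_const).sub
        ((hcoord i).mul (hcoord j)))
    have h1 : e ⬝ᵥ (inertia Ω w).mulVec e = ∑ i, ∑ j, ∫ x in Ω, (e i * e j) *
        (w x * (‖x - h‖ ^ 2 * (1 : Matrix (Fin 3) (Fin 3) ℝ) i j - (x - h) i * (x - h) j)) := by
      simp only [dotProduct, Matrix.mulVec, Finset.mul_sum]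
      refine Finset.sum_congr rfl fun i _ => Finset.sum_congr rfl fun j _ => ?_
      rw [integral_const_mul, inertia]; ring
    rw [h1]
    simp_rw [← integral_finsetSum _ fun j _ => (hentry _ j).const_mul _]
    rw [← integral_finsetSum _ fun i _ => integrable_finsetSum _ fun j _ => (hentry i j).const_mul _]
    congr 1; ext x
    simp only [norm_sq_eq_sum, Fin.sum_univ_three, cross_apply_zero, cross_apply_one,
      cross_apply_two]
    simp
    ring
  have hsymm : (inertia Ω w).IsHermitian := by
    ext i j
    simp only [Matrix.conjTranspose_apply, star_trivial, inertia]
    congr 1; ext x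
    rw [← Matrix.transpose_apply (1 : Matrix (Fin 3) (Fin 3) ℝ) i j, Matrix.transpose_one]
    ring
  refine Matrix.PosDef.det_pos (Matrix.PosDef.of_dotProduct_mulVec_pos hsymm fun e he => ?_)
  rw [star_trivial, hquad e]
  have hcont : Continuous fun x : E3 => ‖cross (WithLp.toLp 2 e) (x - h)‖ ^ 2 :=
    (((crossL (WithLp.toLp 2 e)).continuous.comp (continuous_id.sub continuous_const)).norm.pow 2)
  have hnn : 0 ≤ᵐ[volume.restrict Ω] fun x => w x * ‖cross (WithLp.toLp 2 e) (x - h)‖ ^ 2 := by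
    filter_upwards [hw0] with x hx
    exact mul_nonneg hx (sq_nonneg _)
  refine lt_of_le_of_ne (integral_nonneg_of_ae hnn) fun h0 => ?_
  have hz := (integral_eq_zero_iff_of_nonneg_ae hnn (hint _ hcont)).1 h0.symm
  -- For `e ≠ 0` the product `e × (x - h)` vanishes only in a proper affine subspace, which is a
  -- null set. So a vanishing quadratic form forces `w = 0` almost everywhere, against the positive
  -- mass.
  have hker : ∀ᵐ x ∂(volume : Measure E3), cross (WithLp.toLp 2 e) (x - h) ≠ 0 := by
    have hne : LinearMap.ker ((crossL (WithLp.toLp 2 e)) : E3 →ₗ[ℝ] E3) ≠ ⊤ := by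
      intro htop
      apply he
      have hz : ∀ x : E3, cross (WithLp.toLp 2 e) x = 0 := fun x => by
        have : x ∈ LinearMap.ker ((crossL (WithLp.toLp 2 e)) : E3 →ₗ[ℝ] E3) := by
          rw [htop]; trivial
        simpa using this
      have h1 := hz (WithLp.toLp 2 ![1, 0, 0])
      have h2 := hz (WithLp.toLp 2 ![0, 1, 0])
      have a1 := congrArg (fun z : E3 => z 1) h1
      have a2 := congrArg (fun z : E3 => z 2) h1
      have b0 := congrArg (fun z : E3 => z 0) h2
      simp [cross_apply_zero, cross_apply_one, cross_apply_two] at a1 a2 b0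
      ext i
      fin_cases i
      · have b2 := congrArg (fun z : E3 => z 2) h2
        simpa [cross_apply_two] using b2
      · simpa using a2
      · simpa using a1
    have hnull := Measure.addHaar_submodule (volume : Measure E3) _ hne
    have hae : ∀ᵐ x ∂(volume : Measure E3), cross (WithLp.toLp 2 e) x ≠ 0 := by
      refine measure_mono_null (fun x hx => ?_) hnull
      simpa using hx
    exact (measurePreserving_sub_right volume h).quasiMeasurePreserving.ae hae
  have hw00 : w =ᵐ[volume.restrict Ω] 0 := by
    filter_upwards [hz, ae_restrict_of_ae hker] with x h1 h2
    have : ‖cross (WithLp.toLp 2 e) (x - h)‖ ^ 2 ≠ 0 := by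
      simpa using h2
    simpa [this] using h1
  rw [mass, integral_congr_ae hw00] at hm
  simp at hm

end Moments

/-! ### The moment density -/

section Density

variable {T : ℝ} {Ω : Set E3} {u : ℝ → E3 → E3} {ρ : ℝ → L2 Ω ℝ}

/-- The density of the moments of the fluid of density `ρ` and velocity `u`. -/
def momentDensity (ρ : ℝ → L2 Ω ℝ) (u : ℝ → E3 → E3) (t : ℝ) (x : E3) : Moments :=
  ρ t x • momentKernel (x, u t x)

/-- At `t₀` the derivatives agree on the open set `Ω` with those of a compactly supported smooth
field, hence are bounded; uniform convergence costs at most one more. -/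
lemma IsContinuousSmooth.eventually_bound (hu : IsContinuousSmooth T Ω u) (hΩ : IsOpen Ω) (k : ℕ)
    {t₀ : ℝ} (ht₀ : t₀ ∈ Icc 0 T) :
    ∃ B ≥ 0, ∀ᶠ t in 𝓝[Icc 0 T] t₀, ∀ x ∈ Ω, ‖iteratedFDeriv ℝ k (u t) x‖ ≤ B := by
  obtain ⟨U, hU, hUc, hUe⟩ := hu.1 t₀ ht₀
  obtain ⟨C, hC⟩ := (hUc.iteratedFDeriv (𝕜 := ℝ) k).exists_bound_of_continuous
    (hU.continuous_iteratedFDeriv (m := k) (by exact_mod_cast le_top))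
  have heq : ∀ x ∈ Ω, iteratedFDeriv ℝ k (u t₀) x = iteratedFDeriv ℝ k U x := by
    intro x hx
    refine Filter.EventuallyEq.eq_of_nhds (Filter.EventuallyEq.iteratedFDeriv ℝ ?_ k)
    filter_upwards [hΩ.mem_nhds hx] with y hy
    exact hUe (subset_closure hy)
  have h0 : 0 ≤ C := (norm_nonneg _).trans (hC 0)
  refine ⟨C + 1, by linarith, ?_⟩
  have := (Metric.tendstoUniformlyOn_iff.1 (hu.2 k t₀ ht₀)) 1 one_pos
  filter_upwards [this] with t ht x hx
  have h1 := ht x hx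
  rw [dist_comm, dist_eq_norm] at h1
  have h2 := hC x
  rw [← heq x hx] at h2
  calc ‖iteratedFDeriv ℝ k (u t) x‖
      = ‖iteratedFDeriv ℝ k (u t₀) x + (iteratedFDeriv ℝ k (u t) x - iteratedFDeriv ℝ k (u t₀) x)‖ := by
        rw [add_sub_cancel]
    _ ≤ _ := (norm_add_le _ _).trans (by linarith)

lemma IsContinuousSmooth.tendsto_sub (hu : IsContinuousSmooth T Ω u)
    {t₀ : ℝ} (ht₀ : t₀ ∈ Icc 0 T) {δ : ℝ} (hδ : 0 < δ) :
    ∀ᶠ t in 𝓝[Icc 0 T] t₀, ∀ x ∈ Ω, ‖u t x - u t₀ x‖ < δ := by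
  have := (Metric.tendstoUniformlyOn_iff.1 (hu.2 0 t₀ ht₀)) δ hδ
  filter_upwards [this] with t ht x hx
  have h1 := ht x hx
  rw [dist_comm, dist_eq_norm, iteratedFDeriv_zero_eq_comp, iteratedFDeriv_zero_eq_comp] at h1
  simp only [Function.comp_apply] at h1
  rwa [← map_sub, LinearIsometryEquiv.norm_map] at h1

lemma exists_momentKernel_bound (R : ℝ) : ∃ C ≥ 0, ∀ z : E3 × E3, ‖z‖ ≤ R →
    ‖momentKernel z‖ ≤ C ∧ ‖fderiv ℝ momentKernel z‖ ≤ C := by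
  have hc := isCompact_closedBall (0 : E3 × E3) R
  obtain ⟨C₁, h₁⟩ := hc.exists_bound_of_continuousOn contDiff_momentKernel.continuous.continuousOn
  obtain ⟨C₂, h₂⟩ := hc.exists_bound_of_continuousOn
    (contDiff_momentKernel.continuous_fderiv (by simp)).continuousOn
  refine ⟨max 0 (max C₁ C₂), le_max_left _ _, fun z hz => ?_⟩
  have hz' := mem_closedBall_zero_iff.2 hz
  exact ⟨(h₁ z hz').trans ((le_max_left _ _).trans (le_max_right _ _)),
    (h₂ z hz').trans ((le_max_right _ _).trans (le_max_right _ _))⟩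

lemma momentKernel_sub_le {R C : ℝ} (hC : ∀ z : E3 × E3, ‖z‖ ≤ R →
    ‖momentKernel z‖ ≤ C ∧ ‖fderiv ℝ momentKernel z‖ ≤ C) {x a b : E3}
    (hx : ‖x‖ ≤ R) (ha : ‖a‖ ≤ R) (hb : ‖b‖ ≤ R) :
    ‖momentKernel (x, a) - momentKernel (x, b)‖ ≤ C * ‖a - b‖ := by
  have := (convex_closedBall (0 : E3 × E3) R).norm_image_sub_le_of_norm_fderiv_le (𝕜 := ℝ)
    (f := momentKernel) (C := C)
    (fun z _ => contDiff_momentKernel.differentiable (by simp) z)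
    (fun z hz => (hC z (mem_closedBall_zero_iff.1 hz)).2)
    (x := (x, b)) (y := (x, a))
    (mem_closedBall_zero_iff.2 (by rw [Prod.norm_def]; exact max_le hx hb))
    (mem_closedBall_zero_iff.2 (by rw [Prod.norm_def]; exact max_le hx ha))
  have hn : ‖((x, a) : E3 × E3) - (x, b)‖ = ‖a - b‖ := by
    rw [Prod.mk_sub_mk, sub_self, Prod.norm_mk, norm_zero, max_eq_right (norm_nonneg _)]
  rwa [hn] at this

/-- Uniform bounds near a time: positions in `Ω` and velocities stay in a ball on which the moment
kernel and its derivative are bounded. -/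
lemma exists_local_bounds (hu : IsContinuousSmooth T Ω u) (hΩ : IsOpen Ω)
    (hb : Bornology.IsBounded Ω) {t₀ : ℝ} (ht₀ : t₀ ∈ Icc 0 T) :
    ∃ R ≥ 0, ∃ C ≥ 0, (∀ z : E3 × E3, ‖z‖ ≤ R →
        ‖momentKernel z‖ ≤ C ∧ ‖fderiv ℝ momentKernel z‖ ≤ C) ∧ (∀ x ∈ Ω, ‖x‖ ≤ R) ∧
      ∀ᶠ t in 𝓝[Icc 0 T] t₀, ∀ x ∈ Ω, ‖u t x‖ ≤ R ∧ ‖fderiv ℝ (u t) x‖ ≤ R := by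
  obtain ⟨R₀, hR₀⟩ := hb.exists_norm_le
  obtain ⟨B₀, hB₀, h0⟩ := hu.eventually_bound hΩ 0 ht₀
  obtain ⟨B₁, hB₁, h1⟩ := hu.eventually_bound hΩ 1 ht₀
  set R := max R₀ (max B₀ B₁)
  obtain ⟨C, hC0, hC⟩ := exists_momentKernel_bound R
  refine ⟨R, hB₀.trans ((le_max_left _ _).trans (le_max_right _ _)), C, hC0, hC,
    fun x hx => (hR₀ x hx).trans (le_max_left _ _), ?_⟩
  filter_upwards [h0, h1] with t h0 h1 x hx
  have h2 := h0 x hx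
  have h3 := h1 x hx
  rw [norm_iteratedFDeriv_zero] at h2
  rw [norm_iteratedFDeriv_one] at h3
  exact ⟨h2.trans ((le_max_left _ _).trans (le_max_right _ _)),
    h3.trans ((le_max_right _ _).trans (le_max_right _ _))⟩

lemma aestronglyMeasurable_momentKernel (hu : IsContinuousSmooth T Ω u) (hΩ : IsOpen Ω)
    {t : ℝ} (ht : t ∈ Icc 0 T) :
    AEStronglyMeasurable (fun x => momentKernel (x, u t x)) (volume.restrict Ω) := by
  obtain ⟨U, hU, -, hUe⟩ := hu.1 t ht
  have hc : Continuous fun x => momentKernel (x, U x) :=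
    contDiff_momentKernel.continuous.comp (continuous_id.prodMk hU.continuous)
  refine hc.aestronglyMeasurable.congr ?_
  filter_upwards [ae_restrict_mem hΩ.measurableSet] with x hx
  rw [hUe (subset_closure hx)]

lemma exists_momentKernel_bound_at (hu : IsContinuousSmooth T Ω u) (hΩ : IsOpen Ω)
    (hb : Bornology.IsBounded Ω) {t : ℝ} (ht : t ∈ Icc 0 T) :
    ∃ C ≥ 0, ∀ x ∈ Ω, ‖momentKernel (x, u t x)‖ ≤ C := by
  obtain ⟨R, hR, C, hC0, hC, hΩR, hev⟩ := exists_local_bounds hu hΩ hb ht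
  have h := hev.self_of_nhdsWithin ht
  exact ⟨C, hC0, fun x hx => (hC _ (by rw [Prod.norm_def]; exact max_le (hΩR x hx) (h x hx).1)).1⟩

lemma memLp_momentDensity (hu : IsContinuousSmooth T Ω u) (hΩ : IsOpen Ω)
    (hb : Bornology.IsBounded Ω) {t : ℝ} (ht : t ∈ Icc 0 T) :
    MemLp (momentDensity ρ u t) 2 (volume.restrict Ω) := by
  obtain ⟨C, hC0, hC⟩ := exists_momentKernel_bound_at hu hΩ hb ht
  refine (Lp.memLp (ρ t)).of_le_mul (c := C)
    ((Lp.aestronglyMeasurable (ρ t)).smul (aestronglyMeasurable_momentKernel hu hΩ ht)) ?_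
  filter_upwards [ae_restrict_mem hΩ.measurableSet] with x hx
  rw [momentDensity, norm_smul, mul_comm]
  exact mul_le_mul_of_nonneg_right (hC x hx) (norm_nonneg _)

/-- From `a p - b q = (a - b) p + b (p - q)`, with sup bounds on the factors `p` and `p - q`. -/
lemma eLpNorm_smul_sub_smul_le {α F : Type*} [MeasurableSpace α] {μ : Measure α}
    [NormedAddCommGroup F] [NormedSpace ℝ F] {a b : α → ℝ} {p q : α → F} {C D : ℝ}
    (ha : AEStronglyMeasurable a μ) (hb : AEStronglyMeasurable b μ)
    (hp : AEStronglyMeasurable p μ) (hq : AEStronglyMeasurable q μ)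
    (hC : ∀ᵐ x ∂μ, ‖p x‖ ≤ C) (hD : ∀ᵐ x ∂μ, ‖p x - q x‖ ≤ D) :
    eLpNorm (fun x => a x • p x - b x • q x) 2 μ ≤
      ENNReal.ofReal C * eLpNorm (a - b) 2 μ + ENNReal.ofReal D * eLpNorm b 2 μ := by
  have hdec : (fun x => a x • p x - b x • q x) =
      (fun x => (a - b) x • p x) + fun x => b x • (p x - q x) := by
    funext x
    simp only [Pi.sub_apply, Pi.add_apply, sub_smul, smul_sub]
    abel
  rw [hdec]
  refine (eLpNorm_add_le ((ha.sub hb).smul hp) (hb.smul (hp.sub hq)) one_le_two).trans ?_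
  refine add_le_add (eLpNorm_le_mul_eLpNorm_of_ae_le_mul ?_ 2)
    (eLpNorm_le_mul_eLpNorm_of_ae_le_mul ?_ 2)
  · filter_upwards [hC] with x hx
    rw [Pi.smul_apply', norm_smul, mul_comm]
    exact mul_le_mul_of_nonneg_right hx (norm_nonneg _)
  · filter_upwards [hD] with x hx
    rw [Pi.smul_apply', norm_smul, mul_comm]
    exact mul_le_mul_of_nonneg_right hx (norm_nonneg _)

lemma tendsto_momentDensity (hu : IsContinuousSmooth T Ω u) (hΩ : IsOpen Ω)
    (hb : Bornology.IsBounded Ω) (hρ : ContinuousOn ρ (Icc 0 T)) {t₀ : ℝ} (ht₀ : t₀ ∈ Icc 0 T) :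
    Tendsto (fun t => eLpNorm (momentDensity ρ u t - momentDensity ρ u t₀) 2 (volume.restrict Ω))
      (𝓝[Icc 0 T] t₀) (𝓝 0) := by
  obtain ⟨R, hR, C, hC0, hC, hΩR, hev⟩ := exists_local_bounds hu hΩ hb ht₀
  have hev₀ := hev.self_of_nhdsWithin ht₀
  have hbound : ∀ δ > 0, ∀ᶠ t in 𝓝[Icc 0 T] t₀,
      eLpNorm (momentDensity ρ u t - momentDensity ρ u t₀) 2 (volume.restrict Ω) ≤
        ENNReal.ofReal (C * ‖ρ t - ρ t₀‖ + C * δ * ‖ρ t₀‖) := by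
    intro δ hδ
    filter_upwards [hev, hu.tendsto_sub ht₀ hδ, self_mem_nhdsWithin] with t h1 h2 ht
    have hm := aestronglyMeasurable_momentKernel hu hΩ ht
    have hm₀ := aestronglyMeasurable_momentKernel hu hΩ ht₀
    have key := eLpNorm_smul_sub_smul_le (C := C) (D := C * δ)
      (Lp.aestronglyMeasurable (ρ t)) (Lp.aestronglyMeasurable (ρ t₀)) hm hm₀
      (by
        filter_upwards [ae_restrict_mem hΩ.measurableSet] with x hx
        exact (hC _ (by rw [Prod.norm_def]; exact max_le (hΩR x hx) (h1 x hx).1)).1)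
      (by
        filter_upwards [ae_restrict_mem hΩ.measurableSet] with x hx
        refine (momentKernel_sub_le hC (hΩR x hx) (h1 x hx).1 (hev₀ x hx).1).trans ?_
        exact mul_le_mul_of_nonneg_left (h2 x hx).le hC0)
    refine key.trans_eq ?_
    rw [ENNReal.ofReal_add (by positivity) (by positivity),
      ENNReal.ofReal_mul (p := C) (q := ‖ρ t - ρ t₀‖) hC0,
      ENNReal.ofReal_mul (q := ‖ρ t₀‖) (mul_nonneg hC0 hδ.le), ofReal_norm, ofReal_norm,
      Lp.enorm_def, Lp.enorm_def, eLpNorm_congr_ae (Lp.coeFn_sub (ρ t) (ρ t₀))]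
  rw [ENNReal.tendsto_nhds_zero]
  intro ε hε
  rcases eq_or_ne ε ⊤ with rfl | hεt
  · exact Eventually.of_forall fun _ => le_top
  have hεr : 0 < ε.toReal := ENNReal.toReal_pos hε.ne' hεt
  -- Chosen so that `C δ ‖ρ t₀‖ ≤ ε / 2`; the added one keeps the denominator positive.
  set δ := ε.toReal / (2 * (C * ‖ρ t₀‖ + 1)) with hδ
  have hden : 0 < 2 * (C * ‖ρ t₀‖ + 1) := by positivity
  have hδpos : 0 < δ := div_pos hεr hden
  have hδε : C * δ * ‖ρ t₀‖ ≤ ε.toReal / 2 := by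
    have : C * δ * ‖ρ t₀‖ = (C * ‖ρ t₀‖) * ε.toReal / (2 * (C * ‖ρ t₀‖ + 1)) := by
      rw [hδ]; ring
    rw [this, div_le_div_iff₀ hden two_pos]
    nlinarith [mul_nonneg hC0 (norm_nonneg (ρ t₀))]
  have hlim : Tendsto (fun t => C * ‖ρ t - ρ t₀‖) (𝓝[Icc 0 T] t₀) (𝓝 0) := by
    have h := ((hρ t₀ ht₀).sub (continuousWithinAt_const (b := ρ t₀))).norm.const_mul C
    simpa [ContinuousWithinAt] using h
  filter_upwards [hbound δ hδpos, hlim.eventually (gt_mem_nhds (half_pos hεr))] with t h1 h2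
  refine h1.trans ?_
  refine (ENNReal.ofReal_le_ofReal (by linarith : _ ≤ ε.toReal)).trans ?_
  rw [ENNReal.ofReal_toReal hεt]

lemma isFiniteMeasure_restrict_of_bounded (hb : Bornology.IsBounded Ω) :
    IsFiniteMeasure ((volume : Measure E3).restrict Ω) :=
  ⟨by rw [Measure.restrict_apply_univ]; exact hb.measure_lt_top⟩

lemma lintegral_enorm_le_eLpNorm_two {F : Type*} [NormedAddCommGroup F] {f : E3 → F}
    (hf : AEStronglyMeasurable f (volume.restrict Ω)) :
    ∫⁻ x in Ω, ‖f x‖ₑ ≤ eLpNorm f 2 (volume.restrict Ω) * volume Ω ^ (1 / 2 : ℝ) := by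
  rw [← eLpNorm_one_eq_lintegral_enorm]
  refine (eLpNorm_le_eLpNorm_mul_rpow_measure_univ one_le_two hf).trans_eq ?_
  rw [Measure.restrict_apply_univ]
  norm_num

lemma tendsto_lintegral_momentDensity (hu : IsContinuousSmooth T Ω u) (hΩ : IsOpen Ω)
    (hb : Bornology.IsBounded Ω) (hρ : ContinuousOn ρ (Icc 0 T)) {t₀ : ℝ} (ht₀ : t₀ ∈ Icc 0 T) :
    Tendsto (fun t => ∫⁻ x in Ω, ‖momentDensity ρ u t x - momentDensity ρ u t₀ x‖ₑ)
      (𝓝[Icc 0 T] t₀) (𝓝 0) := by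
  have h := tendsto_momentDensity hu hΩ hb hρ ht₀
  have hfin : volume Ω ^ (1 / 2 : ℝ) ≠ ⊤ := ENNReal.rpow_ne_top_of_nonneg (by norm_num)
    hb.measure_lt_top.ne
  have h2 := ENNReal.Tendsto.mul_const h (b := volume Ω ^ (1 / 2 : ℝ)) (Or.inr hfin)
  rw [zero_mul] at h2
  refine tendsto_of_tendsto_of_tendsto_of_le_of_le' tendsto_const_nhds h2
    (Eventually.of_forall fun _ => bot_le) ?_
  filter_upwards [self_mem_nhdsWithin] with t ht
  exact lintegral_enorm_le_eLpNorm_two ((memLp_momentDensity hu hΩ hb ht).sub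
    (memLp_momentDensity hu hΩ hb ht₀)).aestronglyMeasurable

lemma integrableOn_momentDensity (hu : IsContinuousSmooth T Ω u) (hΩ : IsOpen Ω)
    (hb : Bornology.IsBounded Ω) {t : ℝ} (ht : t ∈ Icc 0 T) :
    IntegrableOn (momentDensity ρ u t) Ω := by
  have := isFiniteMeasure_restrict_of_bounded hb
  exact (memLp_momentDensity hu hΩ hb ht).integrable one_le_two

lemma integrableOn_add_and_lintegral_le {G : Type*} [NormedAddCommGroup G] {p q : E3 → G}
    (hp : IntegrableOn p Ω) (hq : IntegrableOn q Ω) :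
    IntegrableOn (fun x => p x + q x) Ω ∧
    ∫⁻ x in Ω, ‖p x + q x‖ₑ ≤ (∫⁻ x in Ω, ‖p x‖ₑ) + ∫⁻ x in Ω, ‖q x‖ₑ := by
  refine ⟨Integrable.add hp hq, ?_⟩
  rw [← lintegral_add_left' hp.aestronglyMeasurable.enorm]
  exact lintegral_mono fun x => enorm_add_le _ _

lemma integrableOn_smulRight_add_smul {F : Type*} [NormedAddCommGroup F] [NormedSpace ℝ F]
    (hΩ : IsOpen Ω) {g : E3 → E3 →L[ℝ] ℝ} {a : E3 → ℝ} {Φ : E3 → F} {C C' : ℝ}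
    (hg : IntegrableOn g Ω) (ha : IntegrableOn a Ω) (hΦs : ContDiff ℝ ∞ Φ)
    (hΦb : ∀ x ∈ Ω, ‖Φ x‖ ≤ C) (hΦd : ∀ x ∈ Ω, ‖fderiv ℝ Φ x‖ ≤ C') :
    IntegrableOn (fun x => (g x).smulRight (Φ x) + a x • fderiv ℝ Φ x) Ω ∧
    ∫⁻ x in Ω, ‖(g x).smulRight (Φ x) + a x • fderiv ℝ Φ x‖ₑ ≤
      ENNReal.ofReal C * (∫⁻ x in Ω, ‖g x‖ₑ) + ENNReal.ofReal C' * (∫⁻ x in Ω, ‖a x‖ₑ) := by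
  have hi1 : IntegrableOn (fun x => (g x).smulRight (Φ x)) Ω := by
    refine Integrable.mono' (hg.norm.const_mul C) ?_ ?_
    · exact (ContinuousLinearMap.smulRightL ℝ E3 F).aestronglyMeasurable_comp₂
        hg.aestronglyMeasurable hΦs.continuous.aestronglyMeasurable
    · filter_upwards [ae_restrict_mem hΩ.measurableSet] with x hx
      rw [ContinuousLinearMap.norm_smulRight_apply, mul_comm]
      exact mul_le_mul_of_nonneg_right (hΦb x hx) (norm_nonneg _)
  have hi2 : IntegrableOn (fun x => a x • fderiv ℝ Φ x) Ω := by
    refine Integrable.mono' (ha.norm.const_mul C') ?_ ?_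
    · exact ha.aestronglyMeasurable.smul
        (hΦs.continuous_fderiv (by simp)).aestronglyMeasurable
    · filter_upwards [ae_restrict_mem hΩ.measurableSet] with x hx
      rw [norm_smul, mul_comm]
      exact mul_le_mul_of_nonneg_right (hΦd x hx) (norm_nonneg _)
  obtain ⟨hi, hle⟩ := integrableOn_add_and_lintegral_le (G := E3 →L[ℝ] F) hi1 hi2
  refine ⟨hi, hle.trans (add_le_add ?_ ?_)⟩
  · rw [← lintegral_const_mul' _ _ ENNReal.ofReal_ne_top]
    refine setLIntegral_mono' hΩ.measurableSet fun x hx => ?_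
    rw [← ofReal_norm, ContinuousLinearMap.norm_smulRight_apply, mul_comm,
      ENNReal.ofReal_mul' (norm_nonneg _), ofReal_norm (g x)]
    gcongr
    exact hΦb x hx
  · rw [← lintegral_const_mul' _ _ ENNReal.ofReal_ne_top]
    refine setLIntegral_mono' hΩ.measurableSet fun x hx => ?_
    rw [enorm_smul, mul_comm, ← ofReal_norm (fderiv ℝ Φ x)]
    gcongr
    exact hΦd x hx

/-- Locally uniform `W^{1,1}` bounds for the moment density. -/
lemma exists_weakFDeriv_momentDensity (hu : IsContinuousSmooth T Ω u) (hΩ : IsOpen Ω)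
    (hb : Bornology.IsBounded Ω) (hρ : IsContinuousH1 T Ω ρ) {t₀ : ℝ} (ht₀ : t₀ ∈ Icc 0 T) :
    ∃ B ≥ (0 : ℝ), ∀ᶠ t in 𝓝[Icc 0 T] t₀, ∃ f' : E3 → E3 →L[ℝ] Moments,
      IntegrableOn f' Ω ∧ HasWeakFDerivOn Ω (momentDensity ρ u t) f' ∧
      (∫⁻ x in Ω, ‖momentDensity ρ u t x‖ₑ) + (∫⁻ x in Ω, ‖f' x‖ₑ) ≤ ENNReal.ofReal B := by
  have := isFiniteMeasure_restrict_of_bounded hb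
  obtain ⟨Dρ, hweak, hρc, hDρc⟩ := hρ
  obtain ⟨R, hR, C, hC0, hC, hΩR, hev⟩ := exists_local_bounds hu hΩ hb ht₀
  set V : ℝ := (volume Ω ^ (1 / 2 : ℝ)).toReal with hV
  have hVfin : volume Ω ^ (1 / 2 : ℝ) ≠ ⊤ := ENNReal.rpow_ne_top_of_nonneg (by norm_num)
    hb.measure_lt_top.ne
  -- Chain rule for `x ↦ momentKernel (x, U x)`: the inner map has derivative of norm at most `max 1
  -- R`.
  set C' : ℝ := C * max 1 R with hC'
  have hC'0 : 0 ≤ C' := by positivity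
  set N₀ := ‖ρ t₀‖ + 1
  set N₁ := ‖Dρ t₀‖ + 1
  have hN₀ : ∀ᶠ t in 𝓝[Icc 0 T] t₀, ‖ρ t‖ ≤ N₀ :=
    ((hρc t₀ ht₀).norm.eventually (gt_mem_nhds (lt_add_one _))).mono fun _ h => h.le
  have hN₁ : ∀ᶠ t in 𝓝[Icc 0 T] t₀, ‖Dρ t‖ ≤ N₁ :=
    ((hDρc t₀ ht₀).norm.eventually (gt_mem_nhds (lt_add_one _))).mono fun _ h => h.le
  have hN₀0 : 0 ≤ N₀ := by positivity
  have hN₁0 : 0 ≤ N₁ := by positivity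
  have hV0 : 0 ≤ V := ENNReal.toReal_nonneg
  refine ⟨C * (N₀ * V) + (C * (N₁ * V) + C' * (N₀ * V)), by positivity, ?_⟩
  filter_upwards [hev, hN₀, hN₁, self_mem_nhdsWithin] with t h1 hρN hDN ht
  obtain ⟨U, hU, -, hUe⟩ := hu.1 t ht
  -- The Leibniz rule requires a factor that is smooth on the whole space, so `u t` is replaced by a
  -- smooth field that coincides with it on `Ω`.
  set Φ : E3 → Moments := fun x => momentKernel (x, U x) with hΦ
  have hΦs : ContDiff ℝ ∞ Φ := contDiff_momentKernel.comp (contDiff_id.prodMk hU)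
  have hρi : IntegrableOn (ρ t) Ω := (Lp.memLp (ρ t)).integrable one_le_two
  have hDi : IntegrableOn (Dρ t) Ω := (Lp.memLp (Dρ t)).integrable one_le_two
  have hUx : ∀ x ∈ Ω, U x = u t x := fun x hx => (hUe (subset_closure hx)).symm
  have hUd : ∀ x ∈ Ω, fderiv ℝ U x = fderiv ℝ (u t) x := fun x hx => by
    refine Filter.EventuallyEq.fderiv_eq ?_
    filter_upwards [hΩ.mem_nhds hx] with y hy
    exact hUx y hy
  have hmem : ∀ x ∈ Ω, ‖((x, U x) : E3 × E3)‖ ≤ R := fun x hx => by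
    rw [Prod.norm_def, hUx x hx]; exact max_le (hΩR x hx) (h1 x hx).1
  have hΦb : ∀ x ∈ Ω, ‖Φ x‖ ≤ C := fun x hx => (hC _ (hmem x hx)).1
  have hΦd : ∀ x ∈ Ω, ‖fderiv ℝ Φ x‖ ≤ C' := by
    intro x hx
    have hd : HasFDerivAt Φ ((fderiv ℝ momentKernel (x, U x)).comp
        ((ContinuousLinearMap.id ℝ E3).prod (fderiv ℝ U x))) x :=
      by
        have h1 : HasFDerivAt momentKernel (fderiv ℝ momentKernel (x, U x)) (x, U x) :=
          (contDiff_momentKernel.differentiable (by simp) (x, U x)).hasFDerivAt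
        have h2 : HasFDerivAt (fun y => ((y, U y) : E3 × E3))
            ((ContinuousLinearMap.id ℝ E3).prod (fderiv ℝ U x)) x :=
          (hasFDerivAt_id x).prodMk (hU.differentiable (by simp) x).hasFDerivAt
        exact HasFDerivAt.comp x h1 h2
    rw [hd.fderiv]
    refine (ContinuousLinearMap.opNorm_comp_le _ _).trans ?_
    refine mul_le_mul (hC _ (hmem x hx)).2 ?_ (norm_nonneg _) hC0
    refine ContinuousLinearMap.opNorm_le_bound _ (by positivity) fun y => ?_
    rw [ContinuousLinearMap.prod_apply, Prod.norm_def]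
    refine max_le ?_ ?_
    · rw [ContinuousLinearMap.id_apply]
      exact le_mul_of_one_le_left (norm_nonneg _) (le_max_left _ _)
    · refine (ContinuousLinearMap.le_opNorm _ _).trans ?_
      refine mul_le_mul_of_nonneg_right ?_ (norm_nonneg _)
      rw [hUd x hx]
      exact (h1 x hx).2.trans (le_max_right _ _)
  have hI0 : ∫⁻ x in Ω, ‖ρ t x‖ₑ ≤ ENNReal.ofReal (N₀ * V) := by
    refine (lintegral_enorm_le_eLpNorm_two (Lp.aestronglyMeasurable (ρ t))).trans ?_
    rw [ENNReal.ofReal_mul hN₀0, hV, ENNReal.ofReal_toReal hVfin, ← Lp.enorm_def, ← ofReal_norm]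
    gcongr
  have hI1 : ∫⁻ x in Ω, ‖Dρ t x‖ₑ ≤ ENNReal.ofReal (N₁ * V) := by
    refine (lintegral_enorm_le_eLpNorm_two (Lp.aestronglyMeasurable (Dρ t))).trans ?_
    rw [ENNReal.ofReal_mul hN₁0, hV, ENNReal.ofReal_toReal hVfin, ← Lp.enorm_def, ← ofReal_norm]
    gcongr
  obtain ⟨hi, hle⟩ := integrableOn_smulRight_add_smul hΩ hDi hρi hΦs hΦb hΦd
  refine ⟨_, hi, ?_, ?_⟩
  · intro φ hφ hφc hφΩ v
    have := HasWeakFDerivOn.smul_contDiff hρi hDi (hweak t ht) hΦs φ hφ hφc hφΩ v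
    rw [← this]
    refine setIntegral_congr_fun hΩ.measurableSet fun x hx => ?_
    simp only [momentDensity, hΦ, hUx x hx]
  · rw [ENNReal.ofReal_add (by positivity) (by positivity),
      ENNReal.ofReal_add (by positivity) (by positivity), ENNReal.ofReal_mul hC0,
      ENNReal.ofReal_mul hC0, ENNReal.ofReal_mul hC'0]
    refine add_le_add ?_ ?_
    · calc ∫⁻ x in Ω, ‖momentDensity ρ u t x‖ₑ
          ≤ ∫⁻ x in Ω, ENNReal.ofReal C * ‖ρ t x‖ₑ := by
            refine setLIntegral_mono' hΩ.measurableSet fun x hx => ?_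
            rw [momentDensity, ← hUx x hx, enorm_smul, mul_comm, ← ofReal_norm (momentKernel _)]
            gcongr
            exact hΦb x hx
        _ ≤ _ := by
            rw [lintegral_const_mul' _ _ ENNReal.ofReal_ne_top]
            gcongr
    · refine hle.trans ?_
      gcongr

end Density

/-! ### Rigid configurations -/

/-- A configuration: the pair `(A, b)` stands for the affine map `y ↦ A y + b`. -/
abbrev Config : Type := (E3 →L[ℝ] E3) × E3

/-- The configuration is an isometry. -/
def IsRigid (X : Config) : Prop := ∀ y, ‖X.1 y‖ = ‖y‖

namespace IsRigid

variable {X : Config}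

/-- The linear part of a rigid configuration. -/
def linearEquiv (h : IsRigid X) : E3 ≃ₗᵢ[ℝ] E3 :=
  LinearIsometry.toLinearIsometryEquiv ⟨X.1, h⟩ rfl

lemma linearEquiv_apply (h : IsRigid X) (y : E3) : h.linearEquiv y = X.1 y := rfl

/-- A rigid configuration as an isometric bijection. -/
def isometryEquiv (h : IsRigid X) : E3 ≃ᵢ E3 :=
  h.linearEquiv.toIsometryEquiv.trans (IsometryEquiv.addRight X.2)

lemma coe_isometryEquiv (h : IsRigid X) : ⇑h.isometryEquiv = affineMap X := rfl

lemma isometry (h : IsRigid X) : Isometry (affineMap X) := h.isometryEquiv.isometry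

lemma measurableEmbedding (h : IsRigid X) : MeasurableEmbedding (affineMap X) :=
  h.isometryEquiv.toHomeomorph.measurableEmbedding

lemma measurePreserving (h : IsRigid X) : MeasurePreserving (affineMap X) := by
  have h1 : MeasurePreserving (fun y : E3 => y + X.2) := measurePreserving_add_right volume X.2
  exact h1.comp h.linearEquiv.measurePreserving

lemma measurableSet_image (h : IsRigid X) {S : Set E3} (hS : MeasurableSet S) :
    MeasurableSet (affineMap X '' S) := h.measurableEmbedding.measurableSet_image.2 hS

/-- The linear part maps the unit ball onto itself, while it multiplies volumes by the absolute
value of its determinant. -/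
lemma abs_det (h : IsRigid X) : |X.1.det| = 1 := by
  have h1 := Measure.addHaar_image_linearMap (volume : Measure E3) (X.1 : E3 →ₗ[ℝ] E3)
    (Metric.ball 0 1)
  have h2 : (X.1 : E3 →ₗ[ℝ] E3) '' Metric.ball 0 1 = Metric.ball 0 1 := by
    have := h.linearEquiv.image_ball 0 1
    rw [map_zero] at this
    exact this
  rw [h2] at h1
  have hpos : volume (Metric.ball (0 : E3) 1) ≠ 0 := (Metric.measure_ball_pos _ _ one_pos).ne'
  have hfin : volume (Metric.ball (0 : E3) 1) ≠ ⊤ := measure_ball_lt_top.ne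
  have h3 : ENNReal.ofReal |X.1.det| = 1 := by
    have h4 : 1 * volume (Metric.ball (0 : E3) 1) =
      ENNReal.ofReal |X.1.det| * volume (Metric.ball (0 : E3) 1) := by rw [one_mul]; exact h1
    exact ((ENNReal.mul_left_inj hpos hfin).1 h4).symm
  rw [← ENNReal.toReal_ofReal (abs_nonneg X.1.det), h3]
  rfl

end IsRigid

lemma isRigid_id : IsRigid ((ContinuousLinearMap.id ℝ E3, 0) : Config) := fun _ => rfl

lemma affineMap_id : affineMap ((ContinuousLinearMap.id ℝ E3, 0) : Config) = id := by
  funext y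
  simp [affineMap]

lemma isClosed_isRigid : IsClosed {X : Config | IsRigid X} := by
  have : {X : Config | IsRigid X} = ⋂ y : E3, {X : Config | ‖X.1 y‖ = ‖y‖} := by
    ext X; simp [IsRigid]
  rw [this]
  refine isClosed_iInter fun y => isClosed_eq ?_ continuous_const
  exact ((ContinuousLinearMap.apply ℝ E3 y).continuous.comp continuous_fst).norm

/-- Around a rigid configuration the determinant stays away from zero. -/
lemma IsRigid.exists_half_le_det {X₀ : Config} (h : IsRigid X₀) :
    ∃ r > 0, ∀ X ∈ Metric.closedBall X₀ r, 1 / 2 ≤ |X.1.det| := by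
  have hc : Continuous fun X : Config => |X.1.det| :=
    (ContinuousLinearMap.continuous_det.comp continuous_fst).abs
  have hev : ∀ᶠ X in 𝓝 X₀, 1 / 2 < |X.1.det| := by
    refine hc.continuousAt.eventually (lt_mem_nhds ?_)
    change 1 / 2 < |X₀.1.det|
    rw [h.abs_det]; norm_num
  obtain ⟨r, hr, hball⟩ := Metric.nhds_basis_closedBall.mem_iff.1 hev
  exact ⟨r, hr, fun X hX => (hball hX).le⟩

/-! ### Moments of a body in a given configuration -/

section BodyMoments

variable {T : ℝ} {Ω S₀ : Set E3} {u : ℝ → E3 → E3} {ρ : ℝ → L2 Ω ℝ}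

/-- The moments, at time `t`, of the body `S₀` in the configuration `X`. -/
def bodyMoments (S₀ : Set E3) (ρ : ℝ → L2 Ω ℝ) (u : ℝ → E3 → E3) (t : ℝ) (X : Config) : Moments :=
  ∫ y in S₀, Ω.indicator (momentDensity ρ u t) (affineMap X y)

lemma integrable_indicator_affineMap {F : Type*} [NormedAddCommGroup F]
    (hΩ : MeasurableSet Ω) {f : E3 → F} (hf : IntegrableOn f Ω) {X : Config}
    (hX : 1 / 2 ≤ |X.1.det|) : Integrable (fun y => Ω.indicator f (affineMap X y)) := by
  have hi : Integrable (Ω.indicator f) := (integrable_indicator_iff hΩ).2 hf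
  have hq := quasiMeasurePreserving_affineMap X (det_ne_zero_of_half_le hX)
  refine ⟨hi.aestronglyMeasurable.comp_quasiMeasurePreserving hq, ?_⟩
  refine (lintegral_comp_affineMap_le X hX (G := fun x => ‖Ω.indicator f x‖ₑ)
    hi.aestronglyMeasurable.enorm).trans_lt ?_
  exact ENNReal.mul_lt_top ENNReal.ofNat_lt_top hi.hasFiniteIntegral

lemma enorm_setIntegral_sub_le {α F : Type*} [MeasurableSpace α] {μ : Measure α}
    [NormedAddCommGroup F] [NormedSpace ℝ F] {f g : α → F} (hf : Integrable f μ)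
    (hg : Integrable g μ) : ‖(∫ x, f x ∂μ) - ∫ x, g x ∂μ‖ₑ ≤ ∫⁻ x, ‖f x - g x‖ₑ ∂μ := by
  rw [← integral_sub hf hg]
  exact enorm_integral_le_lintegral_enorm _

lemma norm_le_of_enorm_le {F : Type*} [NormedAddCommGroup F] {x : F} {c : ℝ} (hc : 0 ≤ c)
    (h : ‖x‖ₑ ≤ ENNReal.ofReal c) : ‖x‖ ≤ c := by
  rw [← ofReal_norm] at h
  exact (ENNReal.ofReal_le_ofReal_iff hc).1 h

/-- This is where the spatial regularity of `ρ` enters. The moment density has W^{1,1} norm bounded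
uniformly for times near `t₀`, and the extension by zero of such a function, composed with an affine
map, is Lipschitz in that map with respect to L¹. The ball is convex, so the determinants are also
controlled on segments between its points. -/
lemma exists_bodyMoments_sub_le (hΩ : IsRegularDomain Ω) (hS : MeasurableSet S₀)
    (hSb : Bornology.IsBounded S₀) (hu : IsContinuousSmooth T Ω u) (hρ : IsContinuousH1 T Ω ρ)
    {t₀ : ℝ} (ht₀ : t₀ ∈ Icc 0 T) {X₀ : Config} {r : ℝ}
    (hr : ∀ X ∈ Metric.closedBall X₀ r, 1 / 2 ≤ |X.1.det|) :
    ∃ K : ℝ≥0, ∀ᶠ t in 𝓝[Icc 0 T] t₀,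
      LipschitzOnWith K (bodyMoments S₀ ρ u t) (Metric.closedBall X₀ r) := by
  obtain ⟨C, hC0, hC⟩ := hΩ.exists_lintegral_affineMap_sub_le (F := Moments) hS hSb
  obtain ⟨B, hB0, hB⟩ := exists_weakFDeriv_momentDensity hu hΩ.isOpen hΩ.isBounded hρ ht₀
  refine ⟨(C * B).toNNReal, ?_⟩
  filter_upwards [hB, self_mem_nhdsWithin] with t ⟨f', hf'i, hf'w, hle⟩ ht
  refine LipschitzOnWith.of_dist_le_mul fun Y hY X hX => ?_
  have hfi := integrableOn_momentDensity (ρ := ρ) hu hΩ.isOpen hΩ.isBounded ht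
  have hiY := (integrable_indicator_affineMap hΩ.isOpen.measurableSet hfi (hr Y hY)).restrict
    (s := S₀)
  have hiX := (integrable_indicator_affineMap hΩ.isOpen.measurableSet hfi (hr X hX)).restrict
    (s := S₀)
  have hseg : ∀ s ∈ Icc (0 : ℝ) 1, 1 / 2 ≤ |(X + s • (Y - X)).1.det| := fun s hs =>
    hr _ ((convex_closedBall X₀ r).add_smul_sub_mem hX hY hs)
  rw [dist_eq_norm, dist_eq_norm, Real.coe_toNNReal _ (mul_nonneg hC0 hB0)]
  refine norm_le_of_enorm_le (mul_nonneg (mul_nonneg hC0 hB0) (norm_nonneg _)) ?_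
  refine (enorm_setIntegral_sub_le hiY hiX).trans ?_
  refine (hC _ f' hfi hf'i hf'w X Y hseg).trans ?_
  rw [mul_right_comm, ENNReal.ofReal_mul (p := C * ‖Y - X‖) (q := B)
    (mul_nonneg hC0 (norm_nonneg _))]
  exact mul_le_mul_right hle _

lemma enorm_bodyMoments_sub_le (hΩ : IsOpen Ω) (hb : Bornology.IsBounded Ω)
    (hu : IsContinuousSmooth T Ω u) {s t : ℝ} (hs : s ∈ Icc 0 T) (ht : t ∈ Icc 0 T) {X : Config}
    (hX : 1 / 2 ≤ |X.1.det|) :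
    ‖bodyMoments S₀ ρ u t X - bodyMoments S₀ ρ u s X‖ₑ ≤
      2 * ∫⁻ x in Ω, ‖momentDensity ρ u t x - momentDensity ρ u s x‖ₑ := by
  have hft := integrableOn_momentDensity (ρ := ρ) hu hΩ hb ht
  have hfs := integrableOn_momentDensity (ρ := ρ) hu hΩ hb hs
  have hit := (integrable_indicator_affineMap hΩ.measurableSet hft hX).restrict (s := S₀)
  have his := (integrable_indicator_affineMap hΩ.measurableSet hfs hX).restrict (s := S₀)
  refine (enorm_setIntegral_sub_le hit his).trans ?_
  refine (setLIntegral_le_lintegral _ _).trans ?_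
  have hi := ((integrable_indicator_iff hΩ.measurableSet).2 hft).sub
    ((integrable_indicator_iff hΩ.measurableSet).2 hfs)
  refine (lintegral_comp_affineMap_le X hX (G := fun x => ‖Ω.indicator (momentDensity ρ u t) x -
    Ω.indicator (momentDensity ρ u s) x‖ₑ) hi.aestronglyMeasurable.enorm).trans ?_
  refine mul_le_mul_right (le_of_eq ?_) _
  rw [← lintegral_indicator hΩ.measurableSet]
  refine lintegral_congr fun x => ?_
  by_cases hx : x ∈ Ω <;> simp [hx]

/-- For a fixed configuration the change of variables costs a factor 2, so the continuity is that of
the moment density in L¹. -/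
lemma continuousWithinAt_bodyMoments (hΩ : IsOpen Ω) (hb : Bornology.IsBounded Ω)
    (hu : IsContinuousSmooth T Ω u) (hρ : ContinuousOn ρ (Icc 0 T)) {t₀ : ℝ}
    (ht₀ : t₀ ∈ Icc 0 T) {X : Config} (hX : 1 / 2 ≤ |X.1.det|) :
    ContinuousWithinAt (fun t => bodyMoments S₀ ρ u t X) (Icc 0 T) t₀ := by
  rw [ContinuousWithinAt, tendsto_iff_edist_tendsto_0]
  have h := ENNReal.Tendsto.const_mul (a := 2) (tendsto_lintegral_momentDensity hu hΩ hb hρ ht₀)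
    (Or.inr ENNReal.ofNat_ne_top)
  rw [mul_zero] at h
  refine tendsto_of_tendsto_of_tendsto_of_le_of_le' tendsto_const_nhds h
    (Eventually.of_forall fun _ => bot_le) ?_
  filter_upwards [self_mem_nhdsWithin] with t ht
  rw [edist_eq_enorm_sub]
  exact enorm_bodyMoments_sub_le hΩ hb hu ht₀ ht hX

/-- For a rigid configuration, the moments of the body are those of the density `ρ` restricted to
the displaced body. -/
lemma bodyMoments_eq_moments (hΩ : MeasurableSet Ω) (hS : MeasurableSet S₀) {X : Config}
    (hX : IsRigid X) (t : ℝ) :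
    bodyMoments S₀ ρ u t X =
      moments Ω (fun x => ρ t x * charFn (affineMap X '' S₀) x) (u t) := by
  rw [bodyMoments, moments,
    ← hX.measurePreserving.setIntegral_image_emb hX.measurableEmbedding
      (Ω.indicator (momentDensity ρ u t)) S₀,
    ← integral_indicator (hX.measurableSet_image hS), ← integral_indicator hΩ]
  refine integral_congr_ae (Eventually.of_forall fun x => ?_)
  by_cases h1 : x ∈ Ω <;> by_cases h2 : x ∈ affineMap X '' S₀ <;>
    simp [h1, h2, charFn, momentDensity]

end BodyMoments

/-! ### The velocity of a configuration -/

/-- The velocity of the configuration `X` in the rigid field with moments `M`. -/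
def configVelocity (z : Moments × Config) : Config :=
  ((crossL (momAngular z.1)).comp z.2.1, momLinear z.1 + crossL (momAngular z.1) z.2.2)

lemma affineMap_configVelocity (M : Moments) (X : Config) (y : E3) :
    affineMap (configVelocity (M, X)) y = momLinear M + cross (momAngular M) (affineMap X y) := by
  simp only [affineMap, configVelocity, ContinuousLinearMap.comp_apply, crossL_apply,
    cross_add_right]
  abel

lemma contDiffAt_configVelocity {M : Moments} (hM : M.1 ≠ 0) (hJ : (momInertia M).det ≠ 0)
    (X : Config) : ContDiffAt ℝ 1 configVelocity (M, X) := by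
  have hω' : ContDiffAt ℝ 1 (fun z : Moments × Config => momAngular z.1) (M, X) :=
    ContDiffAt.comp (g := momAngular) (M, X) (contDiffAt_momAngular hM hJ) contDiffAt_fst
  have hω : ContDiffAt ℝ 1 (fun z : Moments × Config => crossL (momAngular z.1)) (M, X) :=
    crossL.contDiff.contDiffAt.comp (M, X) hω'
  have hA : ContDiffAt ℝ 1 (fun z : Moments × Config => z.2.1) (M, X) :=
    (contDiff_fst.comp contDiff_snd).contDiffAt
  have hb : ContDiffAt ℝ 1 (fun z : Moments × Config => z.2.2) (M, X) :=
    (contDiff_snd.comp contDiff_snd).contDiffAt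
  have hl : ContDiffAt ℝ 1 (fun z : Moments × Config => momLinear z.1) (M, X) :=
    ContDiffAt.comp (g := momLinear) (M, X) (contDiffAt_momLinear hM hJ) contDiffAt_fst
  exact (hω.clm_comp hA).prodMk (hl.add (hω.clm_apply hb))

/-- `V` is Lipschitz near one point because it is C¹ there, and the map `X ↦ (M t X, X)` is
Lipschitz uniformly in `t`. The case of an `M` that does not depend on `X` is used for prescribed
moments. -/
lemma IsLipschitzNear.of_comp {E F : Type*} [NormedAddCommGroup E] [NormedSpace ℝ E]
    [NormedAddCommGroup F] [NormedSpace ℝ F] {T t₀ : ℝ} {X₀ : E} (ht₀ : t₀ ∈ Icc 0 T)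
    {M : ℝ → E → F} {V : F × E → E} (hV : ContDiffAt ℝ 1 V (M t₀ X₀, X₀)) {r : ℝ} (hr : 0 < r)
    {K : ℝ≥0} (hlip : ∀ᶠ t in 𝓝[Icc 0 T] t₀, LipschitzOnWith K (M t) (Metric.closedBall X₀ r))
    (hcont : ∀ t ∈ Icc 0 T, ∀ X ∈ Metric.closedBall X₀ r,
      ContinuousWithinAt (fun t => M t X) (Icc 0 T) t) :
    IsLipschitzNear T (fun t X => V (M t X, X)) t₀ X₀ := by
  obtain ⟨K', N, hN, hVlip⟩ := hV.exists_lipschitzOnWith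
  obtain ⟨δ, hδ, hball⟩ := Metric.nhds_basis_closedBall.mem_iff.1 hN
  set z₀ := (M t₀ X₀, X₀) with hz₀
  have hX₀ : X₀ ∈ Metric.closedBall X₀ r := Metric.mem_closedBall_self hr.le
  have hnear : ∀ᶠ t in 𝓝[Icc 0 T] t₀, dist (M t X₀) (M t₀ X₀) < δ / 2 :=
    (hcont t₀ ht₀ X₀ hX₀).eventually (Metric.ball_mem_nhds _ (half_pos hδ))
  obtain ⟨ε, hε, hεsub⟩ := (nhdsWithin_hasBasis Metric.nhds_basis_closedBall _).mem_iff.1 (hlip.and hnear)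
  -- Gives `(K + 1) r' ≤ δ / 2`; with `M t X₀` within `δ / 2` of `M t₀ X₀`, the pair stays in the
  -- ball of radius `δ` on which `V` is Lipschitz.
  set r' := min r (δ / (2 * (K + 1))) with hr'
  have hK : (0 : ℝ) < 2 * (K + 1) := by positivity
  have hr'pos : 0 < r' := lt_min hr (div_pos hδ hK)
  have hsub : Metric.closedBall X₀ r' ⊆ Metric.closedBall X₀ r :=
    Metric.closedBall_subset_closedBall (min_le_left _ _)
  have hr'2 : (K + 1) * r' ≤ δ / 2 := by
    have h1 : r' ≤ δ / (2 * (K + 1)) := min_le_right _ _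
    rw [le_div_iff₀ hK] at h1
    linarith
  have hmem : ∀ t ∈ Icc 0 T ∩ Metric.closedBall t₀ ε, ∀ X ∈ Metric.closedBall X₀ r',
      (M t X, X) ∈ Metric.closedBall z₀ δ := by
    intro t ht X hX
    obtain ⟨h1, h2⟩ := hεsub ⟨ht.2, ht.1⟩
    rw [Metric.mem_closedBall, Prod.dist_eq]
    have hX' := Metric.mem_closedBall.1 hX
    have h3 := h1.dist_le_mul X (hsub hX) X₀ hX₀
    have hK0 : (0 : ℝ) ≤ K := K.2
    refine max_le ?_ ?_
    · refine (dist_triangle _ (M t X₀) _).trans ?_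
      nlinarith
    · change dist X X₀ ≤ δ
      nlinarith
  refine ⟨ε, hε, r', hr'pos, K' * max K 1, ⟨‖V z₀‖ + K' * δ, by positivity⟩, fun t ht => ⟨?_, ?_⟩, ?_⟩
  · obtain ⟨h1, h2⟩ := hεsub ⟨ht.2, ht.1⟩
    refine (hVlip.mono hball).comp (g := V) (f := fun X => (M t X, X)) ?_ (hmem t ht)
    exact (h1.mono hsub).prodMk LipschitzWith.id.lipschitzOnWith
  · intro X hX
    have h1 := (hVlip.mono hball).dist_le_mul _ (hmem t ht X hX) z₀
      (Metric.mem_closedBall_self hδ.le)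
    have h2 := Metric.mem_closedBall.1 (hmem t ht X hX)
    change ‖V (M t X, X)‖ ≤ ‖V z₀‖ + K' * δ
    rw [dist_eq_norm] at h1
    have h3 : ‖V (M t X, X)‖ ≤ ‖V z₀‖ + ‖V (M t X, X) - V z₀‖ := by
      have := norm_add_le (V z₀) (V (M t X, X) - V z₀)
      rwa [add_sub_cancel] at this
    have h4 : (K' : ℝ) * dist (M t X, X) z₀ ≤ K' * δ := mul_le_mul_of_nonneg_left h2 K'.2
    linarith
  · intro X hX
    have h1 : ContinuousOn (fun t => (M t X, X)) (Icc 0 T ∩ Metric.closedBall t₀ ε) := fun t ht =>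
      (((hcont t ht.1 X (hsub hX)).mono inter_subset_left).prodMk continuousWithinAt_const)
    exact (hVlip.mono hball).continuousOn.comp h1 fun t ht => hmem t ht X hX

section BodyField

variable {T : ℝ} {Ω S₀ : Set E3} {u : ℝ → E3 → E3} {ρ : ℝ → L2 Ω ℝ}

/-- The velocity of the configuration `X` of the body `S₀` in its own rigid field. -/
def bodyField (S₀ : Set E3) (ρ : ℝ → L2 Ω ℝ) (u : ℝ → E3 → E3) (t : ℝ) (X : Config) : Config :=
  configVelocity (bodyMoments S₀ ρ u t X, X)

lemma isLipschitzNear_bodyField (hΩ : IsRegularDomain Ω) (hS : MeasurableSet S₀)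
    (hSb : Bornology.IsBounded S₀) (hu : IsContinuousSmooth T Ω u) (hρ : IsContinuousH1 T Ω ρ)
    {t₀ : ℝ} (ht₀ : t₀ ∈ Icc 0 T) {X₀ : Config} (hX₀ : IsRigid X₀)
    (hm : (bodyMoments S₀ ρ u t₀ X₀).1 ≠ 0)
    (hJ : (momInertia (bodyMoments S₀ ρ u t₀ X₀)).det ≠ 0) :
    IsLipschitzNear T (bodyField S₀ ρ u) t₀ X₀ := by
  obtain ⟨r, hr, hdet⟩ := hX₀.exists_half_le_det
  obtain ⟨K, hK⟩ := exists_bodyMoments_sub_le hΩ hS hSb hu hρ ht₀ hdet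
  obtain ⟨-, -, hρc, -⟩ := hρ
  exact IsLipschitzNear.of_comp ht₀ (contDiffAt_configVelocity hm hJ X₀) hr hK
    fun t ht X hX => continuousWithinAt_bodyMoments hΩ.isOpen hΩ.isBounded hu hρc ht (hdet X hX)

end BodyField

/-! ### Motions in a given rigid field -/

/-- The velocity of a configuration in the rigid field `x ↦ a(t) + w(t) × x`. -/
def linField (a w : ℝ → E3) (t : ℝ) (X : Config) : Config :=
  ((crossL (w t)).comp X.1, a t + crossL (w t) X.2)

lemma affineMap_linField (a w : ℝ → E3) (t : ℝ) (X : Config) (y : E3) :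
    affineMap (linField a w t X) y = a t + cross (w t) (affineMap X y) := by
  simp only [affineMap, linField, ContinuousLinearMap.comp_apply, crossL_apply, cross_add_right]
  abel

section Flow

variable {a w : ℝ → E3} {t₀ t₁ : ℝ} {X : ℝ → Config}

lemma hasDerivWithinAt_affineMap {X : ℝ → Config} {X' : Config} {s : Set ℝ} {t : ℝ}
    (h : HasDerivWithinAt X X' s t) (y : E3) :
    HasDerivWithinAt (fun τ => affineMap (X τ) y) (affineMap X' y) s t := by
  have h1 : HasDerivWithinAt (fun τ => (X τ).1 y) (X'.1 y) s t := by
    have := ((ContinuousLinearMap.apply ℝ E3 y).comp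
      (ContinuousLinearMap.fst ℝ (E3 →L[ℝ] E3) E3)).hasFDerivAt.comp_hasDerivWithinAt t h
    exact this
  have h2 : HasDerivWithinAt (fun τ => (X τ).2) X'.2 s t :=
    (ContinuousLinearMap.snd ℝ (E3 →L[ℝ] E3) E3).hasFDerivAt.comp_hasDerivWithinAt t h
  exact h1.add h2

lemma inner_cross_self (w x : E3) : inner ℝ x (cross w x) = 0 := by
  have := inner_cross_add_inner_cross w x x
  rw [real_inner_comm] at this
  linarith

/-- Solutions in a rigid field that start rigid remain rigid. -/
lemma IsSolutionOn.isRigid (hX : IsSolutionOn (linField a w) t₀ t₁ X) (h0 : IsRigid (X t₀)) :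
    ∀ t ∈ Icc t₀ t₁, IsRigid (X t) := by
  intro t ht y
  have hd : ∀ τ ∈ Icc t₀ t₁, HasDerivWithinAt (fun τ => (X τ).1 y)
      (cross (w τ) ((X τ).1 y)) (Icc t₀ t₁) τ := by
    intro τ hτ
    have := ((ContinuousLinearMap.apply ℝ E3 y).comp
      (ContinuousLinearMap.fst ℝ (E3 →L[ℝ] E3) E3)).hasFDerivAt.comp_hasDerivWithinAt τ (hX τ hτ)
    exact this
  -- The velocity `w × A y` is orthogonal to `A y`, so `|A y|²` has derivative zero.
  have hn : ∀ τ ∈ Icc t₀ t₁, HasDerivWithinAt (fun τ => ‖(X τ).1 y‖ ^ 2) 0 (Icc t₀ t₁) τ := by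
    intro τ hτ
    have := (hd τ hτ).norm_sq
    rwa [inner_cross_self, mul_zero] at this
  have hc := constant_of_has_deriv_right_zero (f := fun τ => ‖(X τ).1 y‖ ^ 2)
    (fun τ hτ => (hn τ hτ).continuousWithinAt)
    (fun τ hτ => hasDerivWithinAt_Ici_of_Icc (hn τ (Ico_subset_Icc_self hτ)) hτ) t ht
  simp only [h0 y] at hc
  exact (pow_left_inj₀ (norm_nonneg _) (norm_nonneg _) two_ne_zero).1 hc

end Flow

/-! ### The inverse of a rigid configuration -/

/-- The inverse of a rigid configuration. -/
def invConfig (X : Config) : Config := (star X.1, -(star X.1 X.2))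

lemma affineMap_invConfig (X : Config) (x : E3) :
    affineMap (invConfig X) x = star X.1 (x - X.2) := by
  rw [affineMap, invConfig, map_sub, sub_eq_add_neg]

lemma IsRigid.star_comp {X : Config} (h : IsRigid X) (y : E3) : star X.1 (X.1 y) = y := by
  have h1 := (ContinuousLinearMap.norm_map_iff_adjoint_comp_self X.1).1 h
  rw [← ContinuousLinearMap.star_eq_adjoint] at h1
  exact congrArg (fun L : E3 →L[ℝ] E3 => L y) h1

lemma IsRigid.invConfig_affineMap {X : Config} (h : IsRigid X) (y : E3) :
    affineMap (invConfig X) (affineMap X y) = y := by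
  rw [affineMap_invConfig, affineMap, add_sub_cancel_right, h.star_comp]

lemma IsRigid.affineMap_invConfig_self {X : Config} (h : IsRigid X) (x : E3) :
    affineMap X (affineMap (invConfig X) x) = x := by
  obtain ⟨y, rfl⟩ := h.isometryEquiv.surjective x
  rw [h.coe_isometryEquiv, h.invConfig_affineMap]

lemma IsRigid.inv {X : Config} (h : IsRigid X) : IsRigid (invConfig X) := by
  intro x
  obtain ⟨y, rfl⟩ := h.linearEquiv.surjective x
  rw [h.linearEquiv_apply]
  change ‖star X.1 (X.1 y)‖ = _
  rw [h.star_comp, h y]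

lemma star_crossL (w : E3) : star (crossL w) = -crossL w := by
  rw [ContinuousLinearMap.star_eq_adjoint, eq_comm, ContinuousLinearMap.eq_adjoint_iff]
  intro x y
  have := inner_cross_add_inner_cross w x y
  rw [neg_apply, inner_neg_left, crossL_apply, crossL_apply]
  linarith

instance instContinuousStarCLM : ContinuousStar (E3 →L[ℝ] E3) :=
  ⟨(ContinuousLinearMap.adjoint (𝕜 := ℝ) (E := E3) (F := E3)).continuous⟩

lemma continuous_invConfig : Continuous invConfig := by
  have h : Continuous fun X : Config => star X.1 := continuous_fst.star
  exact h.prodMk (h.clm_apply continuous_snd).neg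

/-- The derivative of the inverse configuration along a rigid motion. -/
lemma hasDerivWithinAt_invConfig {a w : ℝ → E3} {X : ℝ → Config} {s : Set ℝ} {t : ℝ}
    (h : HasDerivWithinAt X (linField a w t (X t)) s t) :
    HasDerivWithinAt (fun τ => invConfig (X τ))
      (-((star (X t).1).comp (crossL (w t))), -(star (X t).1 (a t))) s t := by
  have h1 : HasDerivWithinAt (fun τ => (X τ).1) ((crossL (w t)).comp (X t).1) s t :=
    (ContinuousLinearMap.fst ℝ (E3 →L[ℝ] E3) E3).hasFDerivAt.comp_hasDerivWithinAt t h
  have h2 : HasDerivWithinAt (fun τ => (X τ).2) (a t + crossL (w t) (X t).2) s t :=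
    (ContinuousLinearMap.snd ℝ (E3 →L[ℝ] E3) E3).hasFDerivAt.comp_hasDerivWithinAt t h
  have h3 : HasDerivWithinAt (fun τ => star (X τ).1) (-((star (X t).1).comp (crossL (w t)))) s t := by
    have h4 := h1.star
    have h5 : star ((crossL (w t)).comp (X t).1) = -((star (X t).1).comp (crossL (w t))) := by
      change star (crossL (w t) * (X t).1) = -(star (X t).1 * crossL (w t))
      rw [star_mul, star_crossL]
      ext1 x
      exact map_neg (star (X t).1) (crossL (w t) x)
    rwa [h5] at h4
  refine h3.prodMk ?_
  have h6 := (h3.clm_apply h2).neg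
  have h7 : -(star (X t).1 (a t)) = -((-((star (X t).1).comp (crossL (w t)))) (X t).2 +
      star (X t).1 (a t + crossL (w t) (X t).2)) := by
    rw [map_add, neg_apply, ContinuousLinearMap.comp_apply]
    abel
  rw [h7]
  exact h6

/-- Since `(X⁻¹)' = -A* (a + w × x)`, functions composed with `X(t)⁻¹` satisfy the advection
equation of the field; they are the moving test functions below. -/
lemma hasDerivWithinAt_affineMap_invConfig {a w : ℝ → E3} {X : ℝ → Config} {s : Set ℝ} {t : ℝ}
    (h : HasDerivWithinAt X (linField a w t (X t)) s t) (x : E3) :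
    HasDerivWithinAt (fun τ => affineMap (invConfig (X τ)) x)
      (-(star (X t).1 (a t + cross (w t) x))) s t := by
  have := hasDerivWithinAt_affineMap (hasDerivWithinAt_invConfig h) x
  convert this using 1
  simp only [affineMap, neg_apply, ContinuousLinearMap.comp_apply, map_add,
    crossL_apply]
  abel

/-! ### Weak derivatives of continuous functions of one variable -/

section OneDim

open scoped Convolution

open ContinuousLinearMap in
-- A continuous function with continuous weak derivative is differentiable: near `t` the
-- mollifications of `g` have as derivatives the mollifications of `h`, which converge uniformly
-- because `h` is uniformly continuous.
lemma hasDerivAt_of_weak {g h : ℝ → ℝ} {t₀ t₁ : ℝ} (hg : Continuous g) (hh : UniformContinuous h)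
    (hw : ∀ ψ : ℝ → ℝ, ContDiff ℝ ∞ ψ → HasCompactSupport ψ → tsupport ψ ⊆ Ioo t₀ t₁ →
      ∫ t, (deriv ψ t * g t + ψ t * h t) = 0) {t : ℝ} (ht : t ∈ Ioo t₀ t₁) :
    HasDerivAt g (h t) t := by
  obtain ⟨δ, hδ, hball⟩ := Metric.isOpen_iff.1 isOpen_Ioo t ht
  set φ : ℕ → ContDiffBump (0 : ℝ) := fun n =>
    ⟨1 / (2 * ((n : ℝ) + 1)), 1 / ((n : ℝ) + 1), by positivity,
      one_div_lt_one_div_of_lt (by positivity) (by linarith [(n.cast_nonneg : (0 : ℝ) ≤ n)])⟩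
    with hφ
  have hφ0 : Tendsto (fun n => (φ n).rOut) atTop (𝓝 0) := tendsto_one_div_add_atTop_nhds_zero_nat
  have hconv : ∀ n x, HasDerivAt ((φ n).normed volume ⋆[lsmul ℝ ℝ, volume] g)
      ((deriv ((φ n).normed volume) ⋆[lsmul ℝ ℝ, volume] g) x) x := fun n x =>
    ((φ n).hasCompactSupport_normed (μ := volume)).hasDerivAt_convolution_left (lsmul ℝ ℝ)
      ((φ n).contDiff_normed (n := 1)) hg.locallyIntegrable x
  have hder : ∀ᶠ n in atTop, ∀ x ∈ Metric.ball t (δ / 2),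
      HasDerivAt ((φ n).normed volume ⋆[lsmul ℝ ℝ, volume] g)
        (((φ n).normed volume ⋆[lsmul ℝ ℝ, volume] h) x) x := by
    filter_upwards [hφ0.eventually (gt_mem_nhds (half_pos hδ))] with n hn x hx
    have h1 := hconv n x
    set ψ : ℝ → ℝ := fun y => (φ n).normed volume (x - y) with hψ
    have hψs : ContDiff ℝ ∞ ψ := (φ n).contDiff_normed.comp (contDiff_const.sub contDiff_id)
    have hψsupp : tsupport ψ ⊆ Metric.closedBall x (φ n).rOut := by
      refine closure_minimal ?_ Metric.isClosed_closedBall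
      intro y hy
      have : x - y ∈ Function.support ((φ n).normed volume) := hy
      rw [(φ n).support_normed_eq] at this
      rw [Metric.mem_closedBall, dist_comm, dist_eq_norm]
      simpa using (Metric.mem_ball.1 this).le
    have hψc : HasCompactSupport ψ :=
      HasCompactSupport.intro' (isCompact_closedBall x (φ n).rOut) Metric.isClosed_closedBall
        fun y hy => image_eq_zero_of_notMem_tsupport fun h => hy (hψsupp h)
    have hsub : tsupport ψ ⊆ Ioo t₀ t₁ := by
      refine hψsupp.trans (Subset.trans ?_ hball)
      intro y hy
      have h2 := Metric.mem_closedBall.1 hy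
      have h3 := Metric.mem_ball.1 hx
      have := dist_triangle y x t
      exact Metric.mem_ball.2 (by linarith)
    have hψd : ∀ y, deriv ψ y = - deriv ((φ n).normed volume) (x - y) := fun y =>
      deriv_comp_const_sub _ _ _
    have key := hw ψ hψs hψc hsub
    have hi1 : Integrable fun y => deriv ψ y * g y :=
      ((hψs.continuous_deriv (by simp)).mul hg).integrable_of_hasCompactSupport
        hψc.deriv.mul_right
    have hi2 : Integrable fun y => ψ y * h y :=
      (hψs.continuous.mul hh.continuous).integrable_of_hasCompactSupport hψc.mul_right
    rw [integral_add hi1 hi2] at key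
    have e1 : (deriv ((φ n).normed volume) ⋆[lsmul ℝ ℝ, volume] g) x = - ∫ y, deriv ψ y * g y := by
      rw [convolution_eq_swap, ← integral_neg]
      refine integral_congr_ae (Eventually.of_forall fun y => ?_)
      simp only [lsmul_apply, smul_eq_mul, hψd]
      ring
    have e2 : ((φ n).normed volume ⋆[lsmul ℝ ℝ, volume] h) x = ∫ y, ψ y * h y := by
      rw [convolution_eq_swap]
      rfl
    rw [e1] at h1
    rw [e2]
    convert h1 using 1
    linarith
  refine hasDerivAt_of_tendstoUniformlyOn (l := atTop) Metric.isOpen_ball ?_ hder ?_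
    (Metric.mem_ball_self (half_pos hδ))
  · rw [Metric.tendstoUniformlyOn_iff]
    intro ε hε
    obtain ⟨η, hη, hηε⟩ := Metric.uniformContinuous_iff.1 hh (ε / 2) (half_pos hε)
    filter_upwards [hφ0.eventually (gt_mem_nhds hη)] with n hn x _
    rw [dist_comm]
    refine ((φ n).dist_normed_convolution_le hh.continuous.aestronglyMeasurable
      fun y hy => ?_).trans_lt (half_lt_self hε)
    exact (hηε ((Metric.mem_ball.1 hy).trans hn)).le
  · intro x _
    exact ContDiffBump.convolution_tendsto_right_of_continuous hφ0 hg x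

lemma uniformContinuous_IccExtend {g : ℝ → ℝ} {a b : ℝ} (hab : a ≤ b)
    (hg : ContinuousOn g (Icc a b)) :
    UniformContinuous (IccExtend hab ((Icc a b).domRestrict g)) := by
  have h1 : UniformContinuous ((Icc a b).domRestrict g) :=
    CompactSpace.uniformContinuous_of_continuous hg.domRestrict
  exact h1.comp (LipschitzWith.projIcc hab).uniformContinuous

end OneDim

/-! ### Pairings with curves in `L¹` -/

section Pairing

variable {α : Type*} [MeasurableSpace α] {μ : Measure α} {T t₀ t₁ : ℝ} {f : ℝ → α → ℝ}

lemma abs_integral_mul_le {p q : α → ℝ} {B : ℝ} (hp : Integrable p μ)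
    (hq : ∀ x, |q x| ≤ B) : |∫ x, p x * q x ∂μ| ≤ B * ∫ x, |p x| ∂μ := by
  rw [← integral_const_mul]
  refine (abs_integral_le_integral_abs).trans ?_
  refine integral_mono_of_nonneg (Eventually.of_forall fun x => abs_nonneg _)
    (hp.abs.const_mul B) (Eventually.of_forall fun x => ?_)
  simp only [abs_mul]
  rw [mul_comm]
  exact mul_le_mul_of_nonneg_right (hq x) (abs_nonneg _)

lemma integrable_mul_of_bounded {p q : α → ℝ} {B : ℝ} (hp : Integrable p μ)
    (hqm : AEStronglyMeasurable q μ) (hq : ∀ x, |q x| ≤ B) :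
    Integrable (fun x => p x * q x) μ :=
  hp.mul_bdd (c := B) hqm (Eventually.of_forall hq)

lemma continuousWithinAt_integral_mul {s : Set ℝ} {τ : ℝ} (hτ : τ ∈ s)
    (hf : ∀ t ∈ s, Integrable (f t) μ)
    (hfc : Tendsto (fun t => ∫ x, |f t x - f τ x| ∂μ) (𝓝[s] τ) (𝓝 0))
    {Ψ : ℝ → α → ℝ} (hΨm : ∀ t ∈ s, AEStronglyMeasurable (Ψ t) μ) {B : ℝ}
    (hB : ∀ t ∈ s, ∀ x, |Ψ t x| ≤ B) {e : ℝ → ℝ} (he : Tendsto e (𝓝[s] τ) (𝓝 0))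
    (hΨ : ∀ t ∈ s, ∀ x, |Ψ t x - Ψ τ x| ≤ e t) :
    ContinuousWithinAt (fun t => ∫ x, f t x * Ψ t x ∂μ) s τ := by
  rw [ContinuousWithinAt, tendsto_iff_dist_tendsto_zero]
  have hlim : Tendsto (fun t => B * (∫ x, |f t x - f τ x| ∂μ) + e t * ∫ x, |f τ x| ∂μ)
      (𝓝[s] τ) (𝓝 0) := by
    have := (hfc.const_mul B).add (he.mul_const (∫ x, |f τ x| ∂μ))
    simpa using this
  refine tendsto_of_tendsto_of_tendsto_of_le_of_le' tendsto_const_nhds hlim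
    (Eventually.of_forall fun _ => dist_nonneg) ?_
  filter_upwards [self_mem_nhdsWithin] with t ht
  have hi1 : Integrable (fun x => (f t x - f τ x) * Ψ t x) μ :=
    integrable_mul_of_bounded ((hf t ht).sub (hf τ hτ)) (hΨm t ht) (hB t ht)
  have hi2 : Integrable (fun x => f τ x * (Ψ t x - Ψ τ x)) μ := integrable_mul_of_bounded (hf τ hτ) ((hΨm t ht).sub (hΨm τ hτ)) (hΨ t ht)
  have e1 : (∫ x, f t x * Ψ t x ∂μ) - ∫ x, f τ x * Ψ τ x ∂μ =
      (∫ x, (f t x - f τ x) * Ψ t x ∂μ) + ∫ x, f τ x * (Ψ t x - Ψ τ x) ∂μ := by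
    rw [← integral_sub (integrable_mul_of_bounded (hf t ht) (hΨm t ht) (hB t ht))
      (integrable_mul_of_bounded (hf τ hτ) (hΨm τ hτ) (hB τ hτ)), ← integral_add hi1 hi2]
    refine integral_congr_ae (Eventually.of_forall fun x => ?_)
    simp only
    ring
  rw [Real.dist_eq, e1]
  refine (abs_add_le _ _).trans (add_le_add ?_ ?_)
  · exact abs_integral_mul_le ((hf t ht).sub (hf τ hτ)) (hB t ht)
  · exact abs_integral_mul_le (hf τ hτ) (hΨ t ht)

/-- A product rule in which `f` is only continuous in L¹ and is differentiable only in its pairing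
with the fixed function `Ψ τ`. The remaining term `∫ (f t - f τ)(Ψ t - Ψ τ)` is `o(|t - τ|)`, one
factor tending to zero in L¹ and the other being Lipschitz in time. -/
lemma hasDerivAt_integral_mul {s : Set ℝ} {τ : ℝ} (hs : s ∈ 𝓝 τ)
    (hf : ∀ t ∈ s, Integrable (f t) μ)
    (hfc : Tendsto (fun t => ∫ x, |f t x - f τ x| ∂μ) (𝓝 τ) (𝓝 0))
    {Ψ Ψ' : ℝ → α → ℝ} (hΨm : ∀ t ∈ s, AEStronglyMeasurable (Ψ t) μ)
    (hΨ'm : AEStronglyMeasurable (Ψ' τ) μ) {B L : ℝ}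
    (hB : ∀ t ∈ s, ∀ x, |Ψ t x| ≤ B) (hL : ∀ t ∈ s, ∀ x, |Ψ' t x| ≤ L)
    (hd : ∀ t ∈ s, ∀ x, HasDerivAt (fun t => Ψ t x) (Ψ' t x) t)
    (hlip : ∀ t ∈ s, ∀ x, |Ψ t x - Ψ τ x| ≤ L * |t - τ|)
    {g' : ℝ} (hg : HasDerivAt (fun t => ∫ x, f t x * Ψ τ x ∂μ) g' τ) :
    HasDerivAt (fun t => ∫ x, f t x * Ψ t x ∂μ) (g' + ∫ x, f τ x * Ψ' τ x ∂μ) τ := by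
  have hτ : τ ∈ s := mem_of_mem_nhds hs
  have h2 : HasDerivAt (fun t => ∫ x, f τ x * Ψ t x ∂μ) (∫ x, f τ x * Ψ' τ x ∂μ) τ := by
    refine (hasDerivAt_integral_of_dominated_loc_of_deriv_le (F := fun t x => f τ x * Ψ t x)
      (F' := fun t x => f τ x * Ψ' t x) (bound := fun x => L * |f τ x|) hs ?_
      (integrable_mul_of_bounded (hf τ hτ) (hΨm τ hτ) (hB τ hτ))
      ((hf τ hτ).aestronglyMeasurable.mul hΨ'm) ?_ ((hf τ hτ).abs.const_mul L) ?_).2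
    · filter_upwards [hs] with t ht
      exact (hf τ hτ).aestronglyMeasurable.mul (hΨm t ht)
    · refine Eventually.of_forall fun x t ht => ?_
      rw [Real.norm_eq_abs, abs_mul, mul_comm]
      exact mul_le_mul_of_nonneg_right (hL t ht x) (abs_nonneg _)
    · exact Eventually.of_forall fun x t ht => (hd t ht x).const_mul _
  have h3 : HasDerivAt (fun t => ∫ x, (f t x - f τ x) * (Ψ t x - Ψ τ x) ∂μ) 0 τ := by
    rw [hasDerivAt_iff_isLittleO]
    simp only [sub_self, mul_zero, integral_zero, sub_zero, smul_zero]
    rw [Asymptotics.isLittleO_iff]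
    intro c hc
    have hlim : Tendsto (fun t => L * ∫ x, |f t x - f τ x| ∂μ) (𝓝 τ) (𝓝 0) := by
      simpa using hfc.const_mul L
    filter_upwards [hs, hlim.eventually (gt_mem_nhds hc)] with t ht htc
    rw [Real.norm_eq_abs, Real.norm_eq_abs]
    refine (abs_integral_mul_le ((hf t ht).sub (hf τ hτ)) (hlip t ht)).trans ?_
    rw [mul_right_comm]
    exact mul_le_mul_of_nonneg_right htc.le (abs_nonneg _)
  have h4 := ((hg.add h2).add h3).sub_const (∫ x, f τ x * Ψ τ x ∂μ)
  rw [add_zero] at h4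
  refine h4.congr_of_eventuallyEq ?_
  filter_upwards [hs] with t ht
  have i1 := integrable_mul_of_bounded (hf t ht) (hΨm τ hτ) (hB τ hτ)
  have i2 := integrable_mul_of_bounded (hf τ hτ) (hΨm t ht) (hB t ht)
  have i3 : Integrable (fun x => (f t x - f τ x) * (Ψ t x - Ψ τ x)) μ :=
    integrable_mul_of_bounded ((hf t ht).sub (hf τ hτ)) ((hΨm t ht).sub (hΨm τ hτ))
    (hlip t ht)
  have i5 : Integrable (fun x => f t x * Ψ τ x + f τ x * Ψ t x) μ := i1.add i2
  have i6 : Integrable (fun x => f t x * Ψ τ x + f τ x * Ψ t x +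
      (f t x - f τ x) * (Ψ t x - Ψ τ x)) μ := i5.add i3
  have i4 := integrable_mul_of_bounded (hf τ hτ) (hΨm τ hτ) (hB τ hτ)
  simp only [Pi.add_apply]
  rw [← integral_add i1 i2, ← integral_add i5 i3, ← integral_sub i6 i4]
  refine integral_congr_ae (Eventually.of_forall fun x => ?_)
  simp only
  ring

end Pairing

/-! ### Uniqueness for the transport equation in a rigid field -/

section Uniqueness

variable {T t₀ t₁ : ℝ} {f : ℝ → E3 → ℝ} {f₀ : E3 → ℝ} {v : ℝ → E3 → E3} {a w : ℝ → E3}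

lemma InSolutionClass.integrable (hf : InSolutionClass T f) {t : ℝ} (ht : t ∈ Icc 0 T) :
    Integrable (f t) :=
  memLp_one_iff_integrable.1 (hf.memLp 1 le_rfl ENNReal.one_ne_top t ht)

lemma InSolutionClass.tendsto_integral_abs (hf : InSolutionClass T f) {t : ℝ} (ht : t ∈ Icc 0 T) :
    Tendsto (fun s => ∫ x, |f s x - f t x|) (𝓝[Icc 0 T] t) (𝓝 0) := by
  have h := (ENNReal.continuousAt_toReal ENNReal.zero_ne_top).tendsto.comp
    (hf.continuous 1 le_rfl ENNReal.one_ne_top t ht)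
  rw [ENNReal.toReal_zero] at h
  refine h.congr' ?_
  filter_upwards [self_mem_nhdsWithin] with s hs
  have hi : Integrable (f s - f t) := (hf.integrable hs).sub (hf.integrable ht)
  rw [Function.comp_apply, eLpNorm_one_eq_lintegral_enorm,
    ← integral_norm_eq_lintegral_enorm hi.aestronglyMeasurable]
  rfl

lemma hasFDerivAt_mul_prod {ψ : ℝ → ℝ} {Φ : E3 → ℝ} (hψ : Differentiable ℝ ψ)
    (hΦ : Differentiable ℝ Φ) (z : ℝ × E3) (y : E3) :
    fderiv ℝ (fun z : ℝ × E3 => ψ z.1 * Φ z.2) z (1, y) =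
      deriv ψ z.1 * Φ z.2 + ψ z.1 * fderiv ℝ Φ z.2 y := by
  have h1 : HasFDerivAt (fun z : ℝ × E3 => ψ z.1)
      ((fderiv ℝ ψ z.1).comp (ContinuousLinearMap.fst ℝ ℝ E3)) z :=
    (hψ z.1).hasFDerivAt.comp z hasFDerivAt_fst
  have h2 : HasFDerivAt (fun z : ℝ × E3 => Φ z.2)
      ((fderiv ℝ Φ z.2).comp (ContinuousLinearMap.snd ℝ ℝ E3)) z :=
    (hΦ z.2).hasFDerivAt.comp z hasFDerivAt_snd
  have h3 : HasFDerivAt (fun z : ℝ × E3 => ψ z.1 * Φ z.2) _ z := h1.mul h2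
  rw [h3.fderiv]
  simp
  ring

lemma continuous_crossL_apply {α : Type*} [TopologicalSpace α] {p q : α → E3} (hp : Continuous p)
    (hq : Continuous q) : Continuous fun x => cross (p x) (q x) :=
  (crossL.continuous.comp hp).clm_apply hq

/-- The weak formulation tested with `ψ(t) Φ(x)`, followed by Fubini. -/
lemma IsTransportSolution.setIntegral_product (hf : IsTransportSolution T v f₀ f)
    (ht₀ : 0 ≤ t₀) (ht₁ : t₁ ≤ T) (ha : Continuous a) (hw : Continuous w)
    (hv : ∀ t ∈ Ioo t₀ t₁, ∀ x, v t x = a t + cross (w t) x) {Φ : E3 → ℝ} (hΦ : ContDiff ℝ ∞ Φ)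
    (hΦc : HasCompactSupport Φ) {ψ : ℝ → ℝ} (hψ : ContDiff ℝ ∞ ψ) (hψc : HasCompactSupport ψ)
    (hψs : tsupport ψ ⊆ Ioo t₀ t₁) :
    ∫ t in Ioo 0 T, (deriv ψ t * (∫ x, f t x * Φ x) +
      ψ t * ∫ x, f t x * fderiv ℝ Φ x (a t + cross (w t) x)) = 0 := by
  set φ : ℝ × E3 → ℝ := fun z => ψ z.1 * Φ z.2 with hφ
  set ζ : ℝ × E3 → ℝ := fun z => deriv ψ z.1 * Φ z.2 +
    ψ z.1 * fderiv ℝ Φ z.2 (a z.1 + cross (w z.1) z.2) with hζ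
  have hK : IsCompact (tsupport ψ ×ˢ tsupport Φ) := hψc.prod hΦc
  have hφout : ∀ z ∉ tsupport ψ ×ˢ tsupport Φ, φ z = 0 := by
    intro z hz
    by_cases h : z.1 ∈ tsupport ψ
    · rw [hφ]; simp only
      rw [image_eq_zero_of_notMem_tsupport fun h' => hz ⟨h, h'⟩, mul_zero]
    · rw [hφ]; simp only
      rw [image_eq_zero_of_notMem_tsupport h, zero_mul]
  have hζout : ∀ z ∉ tsupport ψ ×ˢ tsupport Φ, ζ z = 0 := by
    intro z hz
    by_cases h : z.1 ∈ tsupport ψ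
    · have h2 : z.2 ∉ tsupport Φ := fun h' => hz ⟨h, h'⟩
      rw [hζ]; simp only
      rw [image_eq_zero_of_notMem_tsupport h2, image_eq_zero_of_notMem_tsupport
        fun h' => h2 (tsupport_fderiv_subset ℝ h')]
      simp
    · rw [hζ]; simp only
      rw [image_eq_zero_of_notMem_tsupport h, image_eq_zero_of_notMem_tsupport
        fun h' => h (tsupport_deriv_subset h')]
      simp
  have hφc : HasCompactSupport φ := HasCompactSupport.intro' hK hK.isClosed hφout
  have hζc : HasCompactSupport ζ := HasCompactSupport.intro' hK hK.isClosed hζout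
  have hφs : ContDiff ℝ ∞ φ := (hψ.comp contDiff_fst).mul (hΦ.comp contDiff_snd)
  have hφt : tsupport φ ⊆ Ioo 0 T ×ˢ univ := by
    have h1 : tsupport φ ⊆ tsupport ψ ×ˢ tsupport Φ :=
      closure_minimal (fun z hz => by_contra fun h => hz (hφout z h)) hK.isClosed
    intro z hz
    have h2 := hψs (h1 hz).1
    exact ⟨⟨ht₀.trans_lt h2.1, h2.2.trans_le ht₁⟩, mem_univ _⟩
  have key := hf.equation φ hφs hφc hφt
  have hψd : Differentiable ℝ ψ := hψ.differentiable (by simp)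
  have hΦd : Differentiable ℝ Φ := hΦ.differentiable (by simp)
  -- The velocity enters multiplied by `ψ`, so its rigid form is needed only on the support of `ψ`.
  have hcongr : ∀ z : ℝ × E3, f z.1 z.2 * fderiv ℝ φ z (1, v z.1 z.2) = f z.1 z.2 * ζ z := by
    intro z
    rw [hφ, hasFDerivAt_mul_prod hψd hΦd, hζ]
    by_cases h : z.1 ∈ tsupport ψ
    · simp only [hv z.1 (hψs h)]
    · simp only [image_eq_zero_of_notMem_tsupport h, zero_mul]
  simp only [hcongr] at key
  have hζcont : Continuous ζ := by
    have h1 : Continuous fun z : ℝ × E3 => fderiv ℝ Φ z.2 :=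
      (hΦ.continuous_fderiv (by simp)).comp continuous_snd
    have h2 : Continuous fun z : ℝ × E3 => a z.1 + cross (w z.1) z.2 :=
      (ha.comp continuous_fst).add
        (continuous_crossL_apply (hw.comp continuous_fst) continuous_snd)
    exact (((hψ.continuous_deriv (by simp)).comp continuous_fst).mul
      (hΦ.continuous.comp continuous_snd)).add
      ((hψ.continuous.comp continuous_fst).mul (h1.clm_apply h2))
  have hζi : Integrable ζ := hζcont.integrable_of_hasCompactSupport hζc
  have hfi : IntegrableOn (fun z : ℝ × E3 => f z.1 z.2 * ζ z) (Ioo 0 T ×ˢ univ) :=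
    hf.inClass.bounded.integrable_mul (q := 1) (memLp_one_iff_integrable.2 hζi.integrableOn)
  rw [Measure.volume_eq_prod, setIntegral_prod _ (by rw [← Measure.volume_eq_prod]; exact hfi)] at key
  refine Eq.trans ?_ key
  refine setIntegral_congr_fun (measurableSet_Ioo (a := (0 : ℝ)) (b := T)) fun t ht => ?_
  simp only [Measure.restrict_univ, hζ]
  have hti := hf.inClass.integrable (Ioo_subset_Icc_self ht)
  obtain ⟨B₁, hB₁⟩ := hΦc.exists_bound_of_continuous hΦ.continuous
  have hqc : Continuous fun x => fderiv ℝ Φ x (a t + cross (w t) x) :=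
    (hΦ.continuous_fderiv (by simp)).clm_apply
      (continuous_const.add (continuous_crossL_apply continuous_const continuous_id))
  have hqs : HasCompactSupport fun x => fderiv ℝ Φ x (a t + cross (w t) x) :=
    HasCompactSupport.intro' hΦc (isClosed_tsupport _) fun x hx => by
      rw [image_eq_zero_of_notMem_tsupport fun h' => hx (tsupport_fderiv_subset ℝ h')]
      simp
  obtain ⟨B₂, hB₂⟩ := hqs.exists_bound_of_continuous hqc
  have i1 := (integrable_mul_of_bounded hti hΦ.continuous.aestronglyMeasurable hB₁).const_mul
    (deriv ψ t)
  have i2 := (integrable_mul_of_bounded hti hqc.aestronglyMeasurable hB₂).const_mul (ψ t)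
  rw [← integral_const_mul, ← integral_const_mul, ← integral_add i1 i2]
  refine integral_congr_ae (Eventually.of_forall fun x => ?_)
  simp only
  ring

lemma continuous_extend {g : ℝ → E3} (h : t₀ ≤ t₁) (hg : ContinuousOn g (Icc t₀ t₁)) :
    Continuous (IccExtend h ((Icc t₀ t₁).domRestrict g)) :=
  hg.domRestrict.Icc_extend'

lemma extend_eq {F : Type*} {g : ℝ → F} (h : t₀ ≤ t₁) {t : ℝ} (ht : t ∈ Icc t₀ t₁) :
    IccExtend h ((Icc t₀ t₁).domRestrict g) t = g t := by
  rw [IccExtend_of_mem h _ ht, domRestrict_apply]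

lemma norm_cross_le (p q : E3) : ‖cross p q‖ ≤ ‖crossL‖ * ‖p‖ * ‖q‖ :=
  crossL.le_opNorm₂ p q

/-- Along a transport solution, the pairing with a fixed test function is differentiable. -/
lemma IsTransportSolution.hasDerivAt_pairing (hf : IsTransportSolution T v f₀ f)
    (ht₀ : 0 ≤ t₀) (ht₁ : t₁ ≤ T) (ha : ContinuousOn a (Icc t₀ t₁))
    (hw : ContinuousOn w (Icc t₀ t₁))
    (hv : ∀ t ∈ Ioo t₀ t₁, ∀ x, v t x = a t + cross (w t) x) {Φ : E3 → ℝ} (hΦ : ContDiff ℝ ∞ Φ)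
    (hΦc : HasCompactSupport Φ) {τ : ℝ} (hτ : τ ∈ Ioo t₀ t₁) :
    HasDerivAt (fun t => ∫ x, f t x * Φ x)
      (∫ x, f τ x * fderiv ℝ Φ x (a τ + cross (w τ) x)) τ := by
  have hle : t₀ ≤ t₁ := (hτ.1.trans hτ.2).le
  have hsub : Icc t₀ t₁ ⊆ Icc 0 T := Icc_subset_Icc ht₀ ht₁
  set g : ℝ → ℝ := fun t => ∫ x, f t x * Φ x with hg
  set h : ℝ → ℝ := fun t => ∫ x, f t x * fderiv ℝ Φ x (a t + cross (w t) x) with hh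
  have hint : ∀ t ∈ Icc t₀ t₁, Integrable (f t) := fun t ht => hf.inClass.integrable (hsub ht)
  have hL1 : ∀ t ∈ Icc t₀ t₁,
      Tendsto (fun s => ∫ x, |f s x - f t x|) (𝓝[Icc t₀ t₁] t) (𝓝 0) := fun t ht =>
    (hf.inClass.tendsto_integral_abs (hsub ht)).mono_left (nhdsWithin_mono _ hsub)
  obtain ⟨B₁, hB₁⟩ := hΦc.exists_bound_of_continuous hΦ.continuous
  have hgc : ContinuousOn g (Icc t₀ t₁) := fun t ht =>
    continuousWithinAt_integral_mul (Ψ := fun _ => Φ) (e := fun _ => 0) ht hint (hL1 t ht)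
      (fun _ _ => hΦ.continuous.aestronglyMeasurable) (fun _ _ => hB₁) tendsto_const_nhds
      (fun _ _ x => by simp)
  obtain ⟨D, hD⟩ := (hΦc.fderiv ℝ).exists_bound_of_continuous (hΦ.continuous_fderiv (by simp))
  obtain ⟨R, hR⟩ := hΦc.isBounded.exists_norm_le
  have hD0 : 0 ≤ D := (norm_nonneg _).trans (hD 0)
  have hC0 : 0 ≤ ‖crossL‖ := norm_nonneg crossL
  have hlinb : ∀ (p q : E3) (x : E3), |fderiv ℝ Φ x (p + cross q x)| ≤
      D * (‖p‖ + ‖crossL‖ * ‖q‖ * max R 0) := by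
    intro p q x
    by_cases hx : x ∈ tsupport Φ
    · refine ((fderiv ℝ Φ x).le_opNorm _).trans ?_
      refine mul_le_mul (hD x) ?_ (norm_nonneg _) hD0
      refine (norm_add_le _ _).trans (add_le_add le_rfl ((norm_cross_le q x).trans ?_))
      exact mul_le_mul_of_nonneg_left ((hR x hx).trans (le_max_left _ _)) (by positivity)
    · rw [image_eq_zero_of_notMem_tsupport fun h' => hx (tsupport_fderiv_subset ℝ h')]
      simp only [zero_apply, abs_zero]
      positivity
  obtain ⟨Ba, hBa⟩ := isCompact_Icc.exists_bound_of_continuousOn ha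
  obtain ⟨Bw, hBw⟩ := isCompact_Icc.exists_bound_of_continuousOn hw
  have hhc : ContinuousOn h (Icc t₀ t₁) := by
    intro t ht
    refine continuousWithinAt_integral_mul
      (Ψ := fun t x => fderiv ℝ Φ x (a t + cross (w t) x))
      (B := D * (Ba + ‖crossL‖ * Bw * max R 0))
      (e := fun s => D * (‖a s - a t‖ + ‖crossL‖ * ‖w s - w t‖ * max R 0)) ht hint (hL1 t ht)
      ?_ ?_ ?_ ?_
    · intro s _
      exact ((hΦ.continuous_fderiv (by simp)).clm_apply (continuous_const.add
        (continuous_crossL_apply continuous_const continuous_id))).aestronglyMeasurable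
    · intro s hs x
      refine (hlinb _ _ x).trans ?_
      have h1 := hBa s hs
      have h2 := hBw s hs
      gcongr
    · have h1 : Tendsto (fun s => ‖a s - a t‖) (𝓝[Icc t₀ t₁] t) (𝓝 0) :=
        tendsto_iff_norm_sub_tendsto_zero.1 (ha t ht)
      have h2 : Tendsto (fun s => ‖w s - w t‖) (𝓝[Icc t₀ t₁] t) (𝓝 0) :=
        tendsto_iff_norm_sub_tendsto_zero.1 (hw t ht)
      have := (h1.add ((h2.const_mul ‖crossL‖).mul_const (max R 0))).const_mul D
      simpa using this
    · intro s _ x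
      have h1 : fderiv ℝ Φ x (a s + cross (w s) x) - fderiv ℝ Φ x (a t + cross (w t) x) =
          fderiv ℝ Φ x ((a s - a t) + cross (w s - w t) x) := by
        rw [← map_sub, cross_sub_left]
        congr 1
        abel
      rw [h1]
      exact hlinb _ _ x
  -- The two pairings are continuous on `[t₀, t₁]`; constant continuation outside makes them
  -- uniformly continuous on the line without changing anything on the support of `ψ`.
  have hweak : ∀ ψ : ℝ → ℝ, ContDiff ℝ ∞ ψ → HasCompactSupport ψ → tsupport ψ ⊆ Ioo t₀ t₁ →
      ∫ t, (deriv ψ t * IccExtend hle ((Icc t₀ t₁).domRestrict g) t +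
        ψ t * IccExtend hle ((Icc t₀ t₁).domRestrict h) t) = 0 := by
    intro ψ hψ hψc hψs
    have key := hf.setIntegral_product ht₀ ht₁ (continuous_extend hle ha) (continuous_extend hle hw)
      (fun t ht x => by
        rw [extend_eq hle (Ioo_subset_Icc_self ht), extend_eq hle (Ioo_subset_Icc_self ht)]
        exact hv t ht x) hΦ hΦc hψ hψc hψs
    rw [← key, ← integral_indicator measurableSet_Ioo]
    refine integral_congr_ae (Eventually.of_forall fun t => ?_)
    by_cases ht : t ∈ tsupport ψ
    · have h1 := hψs ht
      have h2 : t ∈ Icc t₀ t₁ := Ioo_subset_Icc_self h1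
      have h3 : t ∈ Ioo 0 T := ⟨ht₀.trans_lt h1.1, h1.2.trans_le ht₁⟩
      simp only [indicator_of_mem h3, extend_eq hle h2]
      rfl
    · have h4 : ψ t = 0 := image_eq_zero_of_notMem_tsupport ht
      have h5 : deriv ψ t = 0 :=
        image_eq_zero_of_notMem_tsupport fun h' => ht (tsupport_deriv_subset h')
      by_cases h3 : t ∈ Ioo 0 T <;> simp [h3, h4, h5]
  have hfin := hasDerivAt_of_weak (uniformContinuous_IccExtend hle hgc).continuous
    (uniformContinuous_IccExtend hle hhc) hweak hτ
  rw [extend_eq hle (Ioo_subset_Icc_self hτ)] at hfin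
  refine hfin.congr_of_eventuallyEq ?_
  filter_upwards [Icc_mem_nhds hτ.1 hτ.2] with t ht
  rw [extend_eq hle ht]

end Uniqueness

/-! ### Constancy of transport solutions along rigid motions -/

section Uniqueness

variable {T t₀ t₁ : ℝ} {f : ℝ → E3 → ℝ} {f₀ : E3 → ℝ} {v : ℝ → E3 → E3} {a w : ℝ → E3}
  {X : ℝ → Config}

lemma contDiff_affineMap (X : Config) : ContDiff ℝ ∞ (affineMap X) :=
  X.1.contDiff.add contDiff_const

lemma hasFDerivAt_comp_affineMap {Φ : E3 → ℝ} (hΦ : Differentiable ℝ Φ) (X : Config) (x : E3) :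
    HasFDerivAt (fun x => Φ (affineMap X x)) ((fderiv ℝ Φ (affineMap X x)).comp X.1) x := by
  have h1 : HasFDerivAt (affineMap X) X.1 x := X.1.hasFDerivAt.add_const X.2
  exact (hΦ (affineMap X x)).hasFDerivAt.comp x h1

lemma norm_le_of_isRigid {X : Config} (h : IsRigid X) (x : E3) :
    ‖x‖ ≤ ‖affineMap (invConfig X) x‖ + ‖X.2‖ := by
  have h1 := h.affineMap_invConfig_self x
  rw [affineMap] at h1
  calc ‖x‖ = ‖X.1 (affineMap (invConfig X) x) + X.2‖ := by rw [h1]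
    _ ≤ _ := (norm_add_le _ _).trans (by rw [h])

lemma IsRigid.norm_star {X : Config} (h : IsRigid X) (x : E3) : ‖star X.1 x‖ = ‖x‖ := h.inv x

lemma IsRigid.integral_mul_comp {X : Config} (h : IsRigid X) (g Φ : E3 → ℝ) :
    ∫ x, g x * Φ (affineMap (invConfig X) x) = ∫ y, g (affineMap X y) * Φ y := by
  rw [← h.measurePreserving.integral_comp h.measurableEmbedding]
  simp only [h.invConfig_affineMap]

lemma hasCompactSupport_comp_affineMap {Φ : E3 → ℝ} (hΦc : HasCompactSupport Φ) {X : Config}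
    (h : IsRigid X) : HasCompactSupport fun x => Φ (affineMap X x) :=
  hΦc.comp_homeomorph h.isometryEquiv.toHomeomorph

/-- A transport solution in a rigid field is constant along the motions of the field. -/
theorem IsTransportSolution.comp_flow_ae_eq (hf : IsTransportSolution T v f₀ f)
    (ht₀ : 0 ≤ t₀) (ht₁ : t₁ ≤ T) (ha : ContinuousOn a (Icc t₀ t₁))
    (hw : ContinuousOn w (Icc t₀ t₁))
    (hv : ∀ t ∈ Ioo t₀ t₁, ∀ x, v t x = a t + cross (w t) x)
    (hX : IsSolutionOn (linField a w) t₀ t₁ X) (h0 : IsRigid (X t₀)) :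
    ∀ t ∈ Icc t₀ t₁, (fun y => f t (affineMap (X t) y)) =ᵐ[volume]
      fun y => f t₀ (affineMap (X t₀) y) := by
  intro t ht
  rcases ht.1.eq_or_lt with rfl | htlt
  · exact ae_eq_refl _
  have hrig := hX.isRigid h0
  have hsub : Icc t₀ t₁ ⊆ Icc 0 T := Icc_subset_Icc ht₀ ht₁
  have ht₀' : t₀ ∈ Icc t₀ t₁ := ⟨le_rfl, ht.1.trans ht.2⟩
  have hint : ∀ t ∈ Icc t₀ t₁, Integrable (f t) := fun t ht => hf.inClass.integrable (hsub ht)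
  have hintX : ∀ t ∈ Icc t₀ t₁, Integrable fun y => f t (affineMap (X t) y) := fun t ht =>
    (hrig t ht).measurePreserving.integrable_comp_of_integrable (hint t ht)
  have hL1 : ∀ t ∈ Icc t₀ t₁,
      Tendsto (fun s => ∫ x, |f s x - f t x|) (𝓝[Icc t₀ t₁] t) (𝓝 0) := fun t ht =>
    (hf.inClass.tendsto_integral_abs (hsub ht)).mono_left (nhdsWithin_mono _ hsub)
  refine ae_eq_of_integral_contDiff_smul_eq (hintX t ht).locallyIntegrable
    (hintX t₀ ht₀').locallyIntegrable fun Φ hΦ hΦc => ?_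
  have hΦd : Differentiable ℝ Φ := hΦ.differentiable (by simp)
  -- The test function carried by the motion, a solution of the dual advection equation. Its pairing
  -- with `f t` equals the pairing of `f t ∘ X t` with `Φ`.
  set Ψ : ℝ → E3 → ℝ := fun t x => Φ (affineMap (invConfig (X t)) x) with hΨ
  set Ψ' : ℝ → E3 → ℝ := fun t x => fderiv ℝ Φ (affineMap (invConfig (X t)) x)
    (-(star (X t).1 (a t + cross (w t) x))) with hΨ'
  have hFeq : ∀ t ∈ Icc t₀ t₁, ∫ x, f t x * Ψ t x = ∫ y, Φ y • f t (affineMap (X t) y) := by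
    intro t ht
    rw [(hrig t ht).integral_mul_comp]
    simp only [smul_eq_mul, mul_comm]
  obtain ⟨B, hB⟩ := hΦc.exists_bound_of_continuous hΦ.continuous
  obtain ⟨D, hD⟩ := (hΦc.fderiv ℝ).exists_bound_of_continuous (hΦ.continuous_fderiv (by simp))
  have hD0 : 0 ≤ D := (norm_nonneg _).trans (hD 0)
  have hC0 : 0 ≤ ‖crossL‖ := norm_nonneg crossL
  obtain ⟨R, hR⟩ := hΦc.isBounded.exists_norm_le
  obtain ⟨Ba, hBa⟩ := isCompact_Icc.exists_bound_of_continuousOn ha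
  obtain ⟨Bw, hBw⟩ := isCompact_Icc.exists_bound_of_continuousOn hw
  obtain ⟨Bb, hBb⟩ := isCompact_Icc.exists_bound_of_continuousOn
    (continuous_snd.comp_continuousOn hX.continuousOn)
  have hBa0 : 0 ≤ Ba := (norm_nonneg _).trans (hBa t ht)
  have hBw0 : 0 ≤ Bw := (norm_nonneg _).trans (hBw t ht)
  have hBb0 : 0 ≤ Bb := (norm_nonneg _).trans (hBb t ht)
  -- The gradient bound of `Φ` times a bound for the speed of the field on the moved support, whose
  -- points have norm at most `max R 0 + Bb`.
  set L := D * (Ba + ‖crossL‖ * Bw * (max R 0 + Bb)) with hL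
  have hL0 : 0 ≤ L := by positivity
  have hLb : ∀ t ∈ Icc t₀ t₁, ∀ x, |Ψ' t x| ≤ L := by
    intro t ht x
    by_cases hx : affineMap (invConfig (X t)) x ∈ tsupport Φ
    · refine ((fderiv ℝ Φ _).le_opNorm _).trans ?_
      refine mul_le_mul (hD _) ?_ (norm_nonneg _) hD0
      rw [norm_neg, (hrig t ht).norm_star]
      refine (norm_add_le _ _).trans (add_le_add (hBa t ht) ((norm_cross_le _ x).trans ?_))
      have h1 : ‖x‖ ≤ max R 0 + Bb := (norm_le_of_isRigid (hrig t ht) x).trans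
        (add_le_add ((hR _ hx).trans (le_max_left _ _)) (hBb t ht))
      have h2 := hBw t ht
      gcongr
    · rw [hΨ']
      simp only
      rw [image_eq_zero_of_notMem_tsupport fun h' => hx (tsupport_fderiv_subset ℝ h')]
      simpa using hL0
  have hder : ∀ t ∈ Icc t₀ t₁, ∀ x, HasDerivWithinAt (fun t => Ψ t x) (Ψ' t x) (Icc t₀ t₁) t :=
    fun t ht x => (hΦd _).hasFDerivAt.comp_hasDerivWithinAt t
      (hasDerivWithinAt_affineMap_invConfig (hX t ht) x)
  have hlip : ∀ s ∈ Icc t₀ t₁, ∀ t ∈ Icc t₀ t₁, ∀ x, |Ψ t x - Ψ s x| ≤ L * |t - s| :=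
    fun s hs t ht x => (convex_Icc t₀ t₁).norm_image_sub_le_of_norm_hasDerivWithin_le
      (f := fun t => Ψ t x) (fun t ht => hder t ht x) (fun t ht => hLb t ht x) hs ht
  have hΨcd : ∀ t, ContDiff ℝ ∞ (Ψ t) := fun t => hΦ.comp (contDiff_affineMap _)
  have hΨm : ∀ t, AEStronglyMeasurable (Ψ t) volume := fun t =>
    (hΨcd t).continuous.aestronglyMeasurable
  have hΨ'c : ∀ t, Continuous (Ψ' t) := fun t =>
    ((hΦ.continuous_fderiv (by simp)).comp (continuous_affineMap _)).clm_apply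
      ((star (X t).1).continuous.comp (continuous_const.add
        (continuous_crossL_apply continuous_const continuous_id))).neg
  have hFc : ContinuousOn (fun t => ∫ x, f t x * Ψ t x) (Icc t₀ t₁) := fun τ hτ =>
    continuousWithinAt_integral_mul (B := B) (e := fun t => L * |t - τ|) hτ hint (hL1 τ hτ)
      (fun t _ => hΨm t) (fun t _ x => hB _)
      (by
        have : ContinuousAt (fun t => L * |t - τ|) τ := by fun_prop
        simpa [ContinuousAt] using this.tendsto.mono_left nhdsWithin_le_nhds)
      (fun t ht x => hlip τ hτ t ht x)
  have hFd : ∀ τ ∈ Ioo t₀ t₁, HasDerivAt (fun t => ∫ x, f t x * Ψ t x) 0 τ := by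
    intro τ hτ
    have hτ' := Ioo_subset_Icc_self hτ
    have hnhds : Icc t₀ t₁ ∈ 𝓝 τ := Icc_mem_nhds hτ.1 hτ.2
    have hg := hf.hasDerivAt_pairing ht₀ ht₁ ha hw hv (hΨcd τ)
      (hasCompactSupport_comp_affineMap hΦc (hrig τ hτ').inv) hτ
    have h1 := hasDerivAt_integral_mul (s := Ioo t₀ t₁) (f := f) (Ψ := Ψ) (Ψ' := Ψ') (B := B) (L := L)
      (Ioo_mem_nhds hτ.1 hτ.2)
      (fun t ht => hint t (Ioo_subset_Icc_self ht))
      (by simpa [nhdsWithin_eq_nhds.2 hnhds] using hL1 τ hτ') (fun t _ => hΨm t)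
      (hΨ'c τ).aestronglyMeasurable (fun t _ x => hB _)
      (fun t ht => hLb t (Ioo_subset_Icc_self ht))
      (fun t ht x => (hder t (Ioo_subset_Icc_self ht) x).hasDerivAt (Icc_mem_nhds ht.1 ht.2))
      (fun t ht => hlip τ hτ' t (Ioo_subset_Icc_self ht)) hg
    -- The contribution of the equation for `f` and that of the moving test function cancel.
    have h2 : (∫ x, f τ x * fderiv ℝ (Ψ τ) x (a τ + cross (w τ) x)) + ∫ x, f τ x * Ψ' τ x = 0 := by
      rw [← eq_neg_iff_add_eq_zero, ← integral_neg]
      refine integral_congr_ae (Eventually.of_forall fun x => ?_)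
      simp only [hΨ, hΨ']
      rw [(hasFDerivAt_comp_affineMap hΦd _ x).fderiv, ContinuousLinearMap.comp_apply, map_neg,
        mul_neg, neg_neg]
      rfl
    rwa [h2] at h1
  -- The mean value theorem needs the derivative inside the interval only, where the equation
  -- provides it; continuity up to the endpoints comes from the solution class.
  obtain ⟨c, -, hc⟩ := exists_hasDerivAt_eq_slope (fun t => ∫ x, f t x * Ψ t x) (fun _ => 0) htlt
    (hFc.mono (Icc_subset_Icc_right ht.2))
    (fun τ hτ => hFd τ ⟨hτ.1, hτ.2.trans_le ht.2⟩)
  have h3 : (∫ x, f t x * Ψ t x) = ∫ x, f t₀ x * Ψ t₀ x := by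
    have h4 : t - t₀ ≠ 0 := sub_ne_zero.2 htlt.ne'
    rcases div_eq_zero_iff.1 hc.symm with h | h
    · linarith
    · exact absurd h h4
  rw [← hFeq t ht, ← hFeq t₀ ht₀', h3]

end Uniqueness

/-! ### Existence for the transport equation in a rigid field -/

section Existence

variable {T : ℝ} {f₀ : E3 → ℝ} {v : ℝ → E3 → E3} {a w : ℝ → E3} {X : ℝ → Config}

lemma continuous_affineMap_uncurry {α : Type*} [TopologicalSpace α] {Y : α → Config} {y : α → E3}
    (hY : Continuous Y) (hy : Continuous y) : Continuous fun p => affineMap (Y p) (y p) :=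
  ((continuous_fst.comp hY).clm_apply hy).add (continuous_snd.comp hY)

/-- Composition with measure-preserving maps is continuous into `L^p`, `p < ∞`, when the maps
converge in the compact-open topology. -/
lemma tendsto_eLpNorm_comp_affineMap {Y : ℝ → Config} (hY : Continuous Y)
    (hYr : ∀ t, IsRigid (Y t)) {p : ℝ≥0∞} (hp1 : 1 ≤ p) (hp : p ≠ ⊤) (hf₀ : MemLp f₀ p volume)
    (t : ℝ) :
    Tendsto (fun s => eLpNorm ((fun x => f₀ (affineMap (Y s) x)) - fun x => f₀ (affineMap (Y t) x))
      p volume) (𝓝 t) (𝓝 0) := by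
  have : Fact (1 ≤ p) := ⟨hp1⟩
  set g : ℝ → C(E3, E3) := fun s => ⟨affineMap (Y s), continuous_affineMap _⟩ with hg
  have hgc : Continuous g := by
    refine ContinuousMap.continuous_of_continuous_uncurry _ ?_
    exact continuous_affineMap_uncurry (hY.comp continuous_fst) continuous_snd
  have hm : ∀ s, MeasurePreserving (g s) volume volume := fun s => (hYr s).measurePreserving
  have h := (tendsto_const_nhds (x := hf₀.toLp f₀) (f := 𝓝 t)).compMeasurePreservingLp
    (hgc.tendsto t) hm (hm t) hp
  rw [tendsto_iff_edist_tendsto_0] at h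
  refine h.congr fun s => ?_
  rw [Lp.toLp_compMeasurePreserving, Lp.toLp_compMeasurePreserving, Lp.edist_toLp_toLp]
  rfl

lemma inSolutionClass_comp_inv (hXc : Continuous X) (hXr : ∀ t, IsRigid (X t))
    (hm : Measurable f₀) {B : ℝ} (hB : ∀ x, |f₀ x| ≤ B)
    (hLp : ∀ p : ℝ≥0∞, 1 ≤ p → p ≠ ⊤ → MemLp f₀ p volume) :
    InSolutionClass T (fun t x => f₀ (affineMap (invConfig (X t)) x)) := by
  have hYc : Continuous fun t => invConfig (X t) := continuous_invConfig.comp hXc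
  refine ⟨?_, ?_, ?_⟩
  · refine memLp_top_of_bound (C := B) ?_ (Eventually.of_forall fun z => hB _)
    have h1 : Continuous fun z : ℝ × E3 => affineMap (invConfig (X z.1)) z.2 :=
      continuous_affineMap_uncurry (hYc.comp continuous_fst) continuous_snd
    exact (hm.comp h1.measurable).aestronglyMeasurable
  · intro p hp1 hp t _
    exact (hLp p hp1 hp).comp_measurePreserving (hXr t).inv.measurePreserving
  · intro p hp1 hp t _
    exact (tendsto_eLpNorm_comp_affineMap hYc (fun t => (hXr t).inv) hp1 hp (hLp p hp1 hp) t).mono_left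
      nhdsWithin_le_nhds

/-- Transport by a rigid motion solves the transport equation. -/
theorem isTransportSolution_comp_inv (hT : 0 < T) (ha : Continuous a) (hw : Continuous w)
    (hv : ∀ t ∈ Icc 0 T, ∀ x, v t x = a t + cross (w t) x) (hXc : Continuous X)
    (hXr : ∀ t, IsRigid (X t)) (hX : IsSolutionOn (linField a w) 0 T X)
    (hX0 : affineMap (X 0) = id) (hm : Measurable f₀) {B : ℝ} (hB : ∀ x, |f₀ x| ≤ B)
    (hLp : ∀ p : ℝ≥0∞, 1 ≤ p → p ≠ ⊤ → MemLp f₀ p volume) :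
    IsTransportSolution T v f₀ (fun t x => f₀ (affineMap (invConfig (X t)) x)) := by
  refine ⟨inSolutionClass_comp_inv hXc hXr hm hB hLp, ?_, ?_⟩
  · intro φ hφ hφc hφs
    have hφd : Differentiable ℝ φ := hφ.differentiable (by simp)
    have hφ'c : Continuous (fderiv ℝ φ) := hφ.continuous_fderiv (by simp)
    set κ : ℝ × E3 → ℝ := fun z => fderiv ℝ φ z (1, a z.1 + cross (w z.1) z.2) with hκ
    have hκc : Continuous κ := hφ'c.clm_apply (continuous_const.prodMk
      ((ha.comp continuous_fst).add
        (continuous_crossL_apply (hw.comp continuous_fst) continuous_snd)))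
    have hκout : ∀ z ∉ tsupport φ, κ z = 0 := fun z hz => by
      rw [hκ]
      simp only
      rw [image_eq_zero_of_notMem_tsupport fun h' => hz (tsupport_fderiv_subset ℝ h')]
      rfl
    have hκs : HasCompactSupport κ := HasCompactSupport.intro' hφc (isClosed_tsupport _) hκout
    have hYc : Continuous fun t => invConfig (X t) := continuous_invConfig.comp hXc
    have hZ : Continuous fun z : ℝ × E3 => affineMap (invConfig (X z.1)) z.2 :=
      continuous_affineMap_uncurry (hYc.comp continuous_fst) continuous_snd
    have hXz : Continuous fun z : ℝ × E3 => (z.1, affineMap (X z.1) z.2) :=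
      continuous_fst.prodMk (continuous_affineMap_uncurry (hXc.comp continuous_fst) continuous_snd)
    set θ : ℝ × E3 → ℝ := fun z => κ (z.1, affineMap (X z.1) z.2) with hθ
    have hθc : Continuous θ := hκc.comp hXz
    have hθs : HasCompactSupport θ := by
      have hK := hφc.isCompact.image (continuous_fst.prodMk hZ)
      refine HasCompactSupport.intro' hK hK.isClosed fun z hz => hκout _ fun h => hz ?_
      refine ⟨_, h, ?_⟩
      simp only [(hXr z.1).invConfig_affineMap]
    have e0 : ∫ z in Ioo 0 T ×ˢ univ, f₀ (affineMap (invConfig (X z.1)) z.2) *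
        fderiv ℝ φ z (1, v z.1 z.2) =
        ∫ z in Ioo 0 T ×ˢ univ, f₀ (affineMap (invConfig (X z.1)) z.2) * κ z := by
      refine setIntegral_congr_fun (measurableSet_Ioo.prod MeasurableSet.univ) fun z hz => ?_
      simp only [hκ, hv z.1 (Ioo_subset_Icc_self hz.1)]
    have i1 : Integrable (fun z : ℝ × E3 => κ z * f₀ (affineMap (invConfig (X z.1)) z.2)) :=
      integrable_mul_of_bounded (hκc.integrable_of_hasCompactSupport hκs)
        (hm.comp hZ.measurable).aestronglyMeasurable (fun z => hB _)
    have i2 : Integrable (fun z : ℝ × E3 => θ z * f₀ z.2) :=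
      integrable_mul_of_bounded (hθc.integrable_of_hasCompactSupport hθs)
        (hm.comp measurable_snd).aestronglyMeasurable (fun z => hB _)
    rw [e0]
    simp only [mul_comm (f₀ _)]
    -- The change of variables `x = X(t) y` turns the integral into `∫ f₀(y) ∫ θ(t, y) dt dy`, where
    -- `θ(·, y)` is the time derivative of `φ` along the trajectory of `y`.
    rw [Measure.volume_eq_prod, setIntegral_prod _
      (by rw [← Measure.volume_eq_prod]; exact i1.integrableOn)]
    simp only [Measure.restrict_univ]
    have e1 : ∀ t, ∫ x, κ (t, x) * f₀ (affineMap (invConfig (X t)) x) =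
        ∫ y, θ (t, y) * f₀ y := fun t => (hXr t).integral_mul_comp (fun x => κ (t, x)) f₀
    simp only [e1]
    rw [integral_integral_swap (f := fun t y => θ (t, y) * f₀ y) (μ := volume.restrict (Ioo 0 T))
      (ν := volume) (by
        have := i2.integrableOn (s := Ioo 0 T ×ˢ univ)
        rw [IntegrableOn, Measure.volume_eq_prod, ← Measure.prod_restrict,
          Measure.restrict_univ] at this
        exact this)]
    refine integral_eq_zero_of_ae (Eventually.of_forall fun y => ?_)
    simp only [Pi.zero_apply]
    rw [integral_mul_const]
    have hd : ∀ t ∈ Icc 0 T, HasDerivWithinAt (fun t => φ (t, affineMap (X t) y)) (θ (t, y))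
        (Icc 0 T) t := by
      intro t ht
      have h1 := hasDerivWithinAt_affineMap (hX t ht) y
      rw [affineMap_linField] at h1
      exact (hφd _).hasFDerivAt.comp_hasDerivWithinAt t ((hasDerivWithinAt_id t _).prodMk h1)
    -- `φ` vanishes at the times 0 and `T`, so the inner time integral is zero.
    have hz : ∀ t ∉ Ioo 0 T, ∀ x, φ (t, x) = 0 := fun t ht x =>
      image_eq_zero_of_notMem_tsupport fun h => ht (hφs h).1
    have hftc := intervalIntegral.integral_eq_sub_of_hasDerivAt_of_le hT.le
      (fun t ht => (hd t ht).continuousWithinAt)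
      (fun t ht => (hd t (Ioo_subset_Icc_self ht)).hasDerivAt (Icc_mem_nhds ht.1 ht.2))
      (Continuous.intervalIntegrable (hθc.comp (continuous_id.prodMk continuous_const)) 0 T)
    rw [hz T (by simp), hz 0 (by simp), sub_zero, intervalIntegral.integral_of_le hT.le,
      integral_Ioc_eq_integral_Ioo] at hftc
    have h3 : ∫ t in Ioo 0 T, θ (t, y) = 0 := hftc
    rw [h3, zero_mul]
  · refine Eventually.of_forall fun x => ?_
    have h := (hXr 0).affineMap_invConfig_self x
    rw [hX0] at h
    exact congrArg f₀ h

end Existence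

/-! ### Affine families in `C^∞_loc` -/

/-- The derivatives of an affine map are its linear part and then zero. One bound for all orders
reduces every seminorm of `C^∞_loc` to the norm of configurations. -/
lemma norm_iteratedFDeriv_affineMap_le (X : Config) (k : ℕ) (x : E3) :
    ‖iteratedFDeriv ℝ k (affineMap X) x‖ ≤ ‖X‖ * (1 + ‖x‖) := by
  have hfd : fderiv ℝ (affineMap X) = fun _ => X.1 := by
    funext x
    have h1 : HasFDerivAt (affineMap X) X.1 x := X.1.hasFDerivAt.add_const X.2
    exact h1.fderiv
  have h1 : ‖X.1‖ ≤ ‖X‖ := norm_fst_le X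
  have h2 : ‖X.2‖ ≤ ‖X‖ := norm_snd_le X
  have h0 : 0 ≤ ‖X‖ * ‖x‖ := by positivity
  match k with
  | 0 =>
    rw [norm_iteratedFDeriv_zero]
    calc ‖affineMap X x‖ ≤ ‖X.1‖ * ‖x‖ + ‖X.2‖ :=
          (norm_add_le _ _).trans (add_le_add (X.1.le_opNorm x) le_rfl)
      _ ≤ ‖X‖ * ‖x‖ + ‖X‖ := add_le_add (mul_le_mul_of_nonneg_right h1 (norm_nonneg _)) h2
      _ = _ := by ring
  | 1 =>
    rw [norm_iteratedFDeriv_one, hfd]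
    simp only
    nlinarith
  | k + 2 =>
    rw [← norm_iteratedFDeriv_fderiv, hfd, iteratedFDeriv_succ_const]
    simp only [Pi.zero_apply, norm_zero]
    positivity

lemma affineMap_sub (X Y : Config) : (fun y => affineMap X y - affineMap Y y) = affineMap (X - Y) := by
  funext y
  simp only [affineMap, Prod.fst_sub, Prod.snd_sub, sub_apply]
  abel

lemma affineMap_smul (c : ℝ) (X : Config) (y : E3) : c • affineMap X y = affineMap (c • X) y := by
  simp only [affineMap, Prod.smul_fst, Prod.smul_snd, smul_apply, smul_add]

lemma isContinuousSmoothLoc_affineMap {T : ℝ} {Y : ℝ × ℝ → Config} (hY : Continuous Y) :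
    IsContinuousSmoothLoc T (fun q => affineMap (Y q)) := by
  refine ⟨fun q _ => contDiff_affineMap _, fun k K hK q _ => ?_⟩
  obtain ⟨R, hR⟩ := hK.isBounded.exists_norm_le
  rw [Metric.tendstoUniformlyOn_iff]
  intro ε hε
  have hlim : Tendsto (fun q' => ‖Y q - Y q'‖ * (1 + max R 0)) (𝓝 q) (𝓝 0) := by
    have : ContinuousAt (fun q' => ‖Y q - Y q'‖ * (1 + max R 0)) q :=
      ((continuous_const.sub hY).norm.mul continuous_const).continuousAt
    simpa [ContinuousAt] using this.tendsto
  filter_upwards [nhdsWithin_le_nhds (hlim.eventually (gt_mem_nhds hε))] with q' hq' x hx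
  have h1 : iteratedFDeriv ℝ k (affineMap (Y q)) x - iteratedFDeriv ℝ k (affineMap (Y q')) x =
      iteratedFDeriv ℝ k (affineMap (Y q - Y q')) x := by
    rw [← affineMap_sub]
    exact (iteratedFDeriv_sub_apply
      ((contDiff_affineMap (Y q)).of_le (by exact_mod_cast le_top)).contDiffAt
      ((contDiff_affineMap (Y q')).of_le (by exact_mod_cast le_top)).contDiffAt).symm
  rw [dist_eq_norm, h1]
  refine (norm_iteratedFDeriv_affineMap_le _ k x).trans_lt (lt_of_le_of_lt ?_ hq')
  refine mul_le_mul_of_nonneg_left ?_ (norm_nonneg _)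
  linarith [hR x hx, le_max_left R 0]

lemma isC1SmoothLoc_affineMap {T : ℝ} {Y A B : ℝ × ℝ → Config} (hY : Continuous Y)
    (hA : Continuous A) (hB : Continuous B)
    (hd : ∀ q ∈ Icc 0 T ×ˢ Icc 0 T,
      (fun q' => Y q' - Y q - (q'.1 - q.1) • A q - (q'.2 - q.2) • B q)
        =o[𝓝[Icc 0 T ×ˢ Icc 0 T] q] fun q' => q' - q) :
    IsC1SmoothLoc T (fun q => affineMap (Y q)) := by
  refine ⟨isContinuousSmoothLoc_affineMap hY, fun q => affineMap (A q), fun q => affineMap (B q),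
    isContinuousSmoothLoc_affineMap hA, isContinuousSmoothLoc_affineMap hB, ?_⟩
  intro k K hK q hq ε hε
  obtain ⟨R, hR⟩ := hK.isBounded.exists_norm_le
  have hR0 : 0 < 1 + max R 0 := by positivity
  filter_upwards [(Asymptotics.isLittleO_iff.1 (hd q hq)) (div_pos hε hR0)] with q' hq' x hx
  have h1 : (fun y => affineMap (Y q') y - affineMap (Y q) y - (q'.1 - q.1) • affineMap (A q) y -
      (q'.2 - q.2) • affineMap (B q) y) =
      affineMap (Y q' - Y q - (q'.1 - q.1) • A q - (q'.2 - q.2) • B q) := by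
    rw [← affineMap_sub, ← affineMap_sub, ← affineMap_sub]
    simp only [affineMap_smul]
  rw [h1]
  refine (norm_iteratedFDeriv_affineMap_le _ k x).trans ?_
  have h2 : 1 + ‖x‖ ≤ 1 + max R 0 := by linarith [hR x hx, le_max_left R 0]
  refine (mul_le_mul hq' h2 (by positivity) (by positivity)).trans_eq ?_
  field_simp

/-! ### The propagator of a rigid field -/

lemma hasFDerivWithinAt_bilin {E F G : Type*} [NormedAddCommGroup E] [NormedSpace ℝ E]
    [NormedAddCommGroup F] [NormedSpace ℝ F] [NormedAddCommGroup G] [NormedSpace ℝ G]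
    (b : E →L[ℝ] F →L[ℝ] G) {f : ℝ → E} {g : ℝ → F} {f' : E} {g' : F} {s₁ s₂ : Set ℝ} {q : ℝ × ℝ}
    (hf : HasDerivWithinAt f f' s₁ q.1) (hg : HasDerivWithinAt g g' s₂ q.2) :
    HasFDerivWithinAt (fun q : ℝ × ℝ => b (f q.1) (g q.2))
      ((ContinuousLinearMap.fst ℝ ℝ ℝ).smulRight (b f' (g q.2)) +
        (ContinuousLinearMap.snd ℝ ℝ ℝ).smulRight (b (f q.1) g')) (s₁ ×ˢ s₂) q := by
  have h1 : HasFDerivWithinAt (fun q : ℝ × ℝ => f q.1)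
      ((ContinuousLinearMap.toSpanSingleton ℝ f').comp (ContinuousLinearMap.fst ℝ ℝ ℝ))
      (s₁ ×ˢ s₂) q :=
    hf.hasFDerivWithinAt.comp q hasFDerivWithinAt_fst fun _ h => h.1
  have h2 : HasFDerivWithinAt (fun q : ℝ × ℝ => g q.2)
      ((ContinuousLinearMap.toSpanSingleton ℝ g').comp (ContinuousLinearMap.snd ℝ ℝ ℝ))
      (s₁ ×ˢ s₂) q :=
    hg.hasFDerivWithinAt.comp q hasFDerivWithinAt_snd fun _ h => h.2
  have h3 := b.hasFDerivWithinAt_of_bilinear h1 h2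
  refine h3.congr_fderiv ?_
  ext <;> simp

lemma isLittleO_of_hasFDerivWithinAt {G : Type*} [NormedAddCommGroup G] [NormedSpace ℝ G]
    {f : ℝ × ℝ → G} {p r : G} {s : Set (ℝ × ℝ)} {q : ℝ × ℝ}
    (h : HasFDerivWithinAt f ((ContinuousLinearMap.fst ℝ ℝ ℝ).smulRight p +
        (ContinuousLinearMap.snd ℝ ℝ ℝ).smulRight r) s q) :
    (fun q' => f q' - f q - (q'.1 - q.1) • p - (q'.2 - q.2) • r) =o[𝓝[s] q] fun q' => q' - q := by
  refine h.isLittleO.congr_left fun q' => ?_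
  simp [sub_sub, add_assoc]

/-- The composition of two configurations. -/
def compConfig (Y Z : Config) : Config := (Y.1.comp Z.1, Y.1 Z.2 + Y.2)

lemma affineMap_compConfig (Y Z : Config) (y : E3) :
    affineMap (compConfig Y Z) y = affineMap Y (affineMap Z y) := by
  simp only [affineMap, compConfig, ContinuousLinearMap.comp_apply, map_add, add_assoc]

lemma continuous_compConfig {α : Type*} [TopologicalSpace α] {Y Z : α → Config} (hY : Continuous Y)
    (hZ : Continuous Z) : Continuous fun x => compConfig (Y x) (Z x) :=
  (hY.fst.clm_comp hZ.fst).prodMk ((hY.fst.clm_apply hZ.snd).add hY.snd)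

/-- Composition is bilinear up to the translation of the outer map, so the product rule holds
jointly in both times. In the second partial derivative only the linear part of the outer map acts,
since it is applied to a velocity. -/
lemma isLittleO_compConfig {Y Z : ℝ → Config} {Y' Z' : Config} {s₁ s₂ : Set ℝ} {q : ℝ × ℝ}
    (hY : HasDerivWithinAt Y Y' s₁ q.1) (hZ : HasDerivWithinAt Z Z' s₂ q.2) :
    (fun q' : ℝ × ℝ => compConfig (Y q'.1) (Z q'.2) - compConfig (Y q.1) (Z q.2) -
      (q'.1 - q.1) • compConfig Y' (Z q.2) -
      (q'.2 - q.2) • compConfig ((Y q.1).1, 0) Z') =o[𝓝[s₁ ×ˢ s₂] q] fun q' => q' - q := by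
  have hY1 : HasDerivWithinAt (fun t => (Y t).1) Y'.1 s₁ q.1 :=
    (ContinuousLinearMap.fst ℝ (E3 →L[ℝ] E3) E3).hasFDerivAt.comp_hasDerivWithinAt q.1 hY
  have hY2 : HasDerivWithinAt (fun t => (Y t).2) Y'.2 s₁ q.1 :=
    (ContinuousLinearMap.snd ℝ (E3 →L[ℝ] E3) E3).hasFDerivAt.comp_hasDerivWithinAt q.1 hY
  have hZ1 : HasDerivWithinAt (fun t => (Z t).1) Z'.1 s₂ q.2 :=
    (ContinuousLinearMap.fst ℝ (E3 →L[ℝ] E3) E3).hasFDerivAt.comp_hasDerivWithinAt q.2 hZ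
  have hZ2 : HasDerivWithinAt (fun t => (Z t).2) Z'.2 s₂ q.2 :=
    (ContinuousLinearMap.snd ℝ (E3 →L[ℝ] E3) E3).hasFDerivAt.comp_hasDerivWithinAt q.2 hZ
  have h1 := isLittleO_of_hasFDerivWithinAt
    (hasFDerivWithinAt_bilin (ContinuousLinearMap.compL ℝ E3 E3 E3) hY1 hZ1)
  have h2 := isLittleO_of_hasFDerivWithinAt
    (hasFDerivWithinAt_bilin (ContinuousLinearMap.id ℝ (E3 →L[ℝ] E3)) hY1 hZ2)
  have h3 : (fun q' : ℝ × ℝ => (Y q'.1).2 - (Y q.1).2 - (q'.1 - q.1) • Y'.2)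
      =o[𝓝[s₁ ×ˢ s₂] q] fun q' => q' - q := by
    have h4 : HasFDerivWithinAt (fun q : ℝ × ℝ => (Y q.1).2)
        ((ContinuousLinearMap.toSpanSingleton ℝ Y'.2).comp (ContinuousLinearMap.fst ℝ ℝ ℝ))
        (s₁ ×ˢ s₂) q :=
      hY2.hasFDerivWithinAt.comp q hasFDerivWithinAt_fst fun _ h => h.1
    refine h4.isLittleO.congr_left fun q' => ?_
    simp
  refine Asymptotics.IsLittleO.prod_left ?_ ?_
  · exact h1
  · refine (h2.add h3).congr_left fun q' => ?_
    simp only [compConfig, Prod.snd_sub, Prod.smul_snd, ContinuousLinearMap.id_apply, smul_add,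
      add_zero]
    abel

section Propagator

variable {T : ℝ} {v : ℝ → E3 → E3} {a w : ℝ → E3} {X : ℝ → Config}

/-- The propagator of a rigid motion. -/
def rigidPropagator (X : ℝ → Config) (t s : ℝ) (y : E3) : E3 :=
  affineMap (X t) (affineMap (invConfig (X s)) y)

lemma isPropagator_rigidPropagator (hv : ∀ t ∈ Icc 0 T, ∀ x, v t x = a t + cross (w t) x)
    (hXr : ∀ t, IsRigid (X t)) (hX : IsSolutionOn (linField a w) 0 T X) :
    IsPropagator T v (rigidPropagator X) := by
  intro s _ y
  refine ⟨(hXr s).affineMap_invConfig_self y, fun t ht => ?_⟩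
  have h := hasDerivWithinAt_affineMap (hX t ht) (affineMap (invConfig (X s)) y)
  rw [affineMap_linField, ← hv t ht] at h
  exact h

lemma isometry_rigidPropagator (hXr : ∀ t, IsRigid (X t)) (t s : ℝ) :
    Isometry (rigidPropagator X t s) :=
  (hXr t).isometry.comp (hXr s).inv.isometry

/-- Pulled back by `X(τ)⁻¹`, any trajectory of the field has derivative zero. -/
lemma IsPropagator.eq_rigidPropagator (hv : ∀ t ∈ Icc 0 T, ∀ x, v t x = a t + cross (w t) x)
    (hXr : ∀ t, IsRigid (X t)) (hX : IsSolutionOn (linField a w) 0 T X)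
    {η : ℝ → ℝ → E3 → E3} (hη : IsPropagator T v η) {t s : ℝ} (ht : t ∈ Icc 0 T)
    (hs : s ∈ Icc 0 T) (y : E3) : η t s y = rigidPropagator X t s y := by
  set c : ℝ → E3 := fun τ => affineMap (invConfig (X τ)) (η τ s y) with hc
  have hd : ∀ τ ∈ Icc 0 T, HasDerivWithinAt c 0 (Icc 0 T) τ := by
    intro τ hτ
    have h1 := hasDerivWithinAt_invConfig (hX τ hτ)
    have h2 := (hη s hs y).2 τ hτ
    rw [hv τ hτ] at h2
    have h3 : HasDerivWithinAt (fun τ => (invConfig (X τ)).1)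
        (-((star (X τ).1).comp (crossL (w τ)))) (Icc 0 T) τ :=
      (ContinuousLinearMap.fst ℝ (E3 →L[ℝ] E3) E3).hasFDerivAt.comp_hasDerivWithinAt τ h1
    have h4 : HasDerivWithinAt (fun τ => (invConfig (X τ)).2) (-(star (X τ).1 (a τ)))
        (Icc 0 T) τ :=
      (ContinuousLinearMap.snd ℝ (E3 →L[ℝ] E3) E3).hasFDerivAt.comp_hasDerivWithinAt τ h1
    have h5 := (h3.clm_apply h2).add h4
    have h6 : (-((star (X τ).1).comp (crossL (w τ)))) (η τ s y) +
        (invConfig (X τ)).1 (a τ + cross (w τ) (η τ s y)) + -(star (X τ).1 (a τ)) = 0 := by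
      rw [neg_apply, ContinuousLinearMap.comp_apply, crossL_apply]
      change _ + star (X τ).1 (a τ + cross (w τ) (η τ s y)) + _ = 0
      rw [map_add]
      abel
    rw [h6] at h5
    exact h5
  have hconst := constant_of_has_deriv_right_zero (fun τ hτ => (hd τ hτ).continuousWithinAt)
    (fun τ hτ => hasDerivWithinAt_Ici_of_Icc (hd τ (Ico_subset_Icc_self hτ)) hτ)
  have h1 : c t = c s := (hconst t ht).trans (hconst s hs).symm
  have h2 : c s = affineMap (invConfig (X s)) y := by rw [hc]; simp only [(hη s hs y).1]
  rw [rigidPropagator, ← h2, ← h1, (hXr t).affineMap_invConfig_self]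

/-- The velocity of the inverse of a configuration that moves in the field `x ↦ a(t) + w(t) × x`. -/
def invField (a w : ℝ → E3) (t : ℝ) (X : Config) : Config :=
  (-((star X.1).comp (crossL (w t))), -(star X.1 (a t)))

/-- The two times are separated in `X(t) ∘ X(s)⁻¹`, so it suffices to differentiate the motion and
its inverse in one variable each. -/
lemma isC1SmoothLoc_rigidPropagator (ha : Continuous a) (hw : Continuous w) (hXc : Continuous X)
    (hX : IsSolutionOn (linField a w) 0 T X) :
    IsC1SmoothLoc T (fun q => rigidPropagator X q.1 q.2) := by
  have hYc : Continuous fun t => invConfig (X t) := continuous_invConfig.comp hXc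
  have hXd : Continuous fun t => linField a w t (X t) :=
    ((crossL.continuous.comp hw).clm_comp hXc.fst).prodMk
      (ha.add ((crossL.continuous.comp hw).clm_apply hXc.snd))
  have hWd : Continuous fun t => invField a w t (X t) := by
    have h : Continuous fun t => star (X t).1 := hXc.fst.star
    exact (h.clm_comp (crossL.continuous.comp hw)).neg.prodMk (h.clm_apply ha).neg
  have hW : ∀ t ∈ Icc 0 T,
      HasDerivWithinAt (fun τ => invConfig (X τ)) (invField a w t (X t)) (Icc 0 T) t :=
    fun t ht => hasDerivWithinAt_invConfig (hX t ht)
  have hd := fun q (hq : q ∈ Icc 0 T ×ˢ Icc 0 T) =>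
    isLittleO_compConfig (hX q.1 hq.1) (hW q.2 hq.2)
  have h := isC1SmoothLoc_affineMap (T := T)
    (Y := fun q => compConfig (X q.1) (invConfig (X q.2)))
    (A := fun q => compConfig (linField a w q.1 (X q.1)) (invConfig (X q.2)))
    (B := fun q => compConfig ((X q.1).1, 0) (invField a w q.2 (X q.2)))
    (continuous_compConfig (hXc.comp continuous_fst) (hYc.comp continuous_snd))
    (continuous_compConfig (hXd.comp continuous_fst) (hYc.comp continuous_snd))
    (continuous_compConfig ((hXc.comp continuous_fst).fst.prodMk continuous_const)
      (hWd.comp continuous_snd))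
    hd
  have h2 : (fun q : ℝ × ℝ => affineMap (compConfig (X q.1) (invConfig (X q.2)))) =
      fun q => rigidPropagator X q.1 q.2 := by
    funext q y
    rw [affineMap_compConfig]
    rfl
  rwa [h2] at h

end Propagator

/-! ### Moments of the solid density -/

/-- From `c p - d q = (c - d)(p - q) + d (p - q) + (c - d) q` and Hölder's inequality. No sup bound
on the scalar factors is needed. -/
lemma eLpNorm_one_smul_sub_smul_le {α F : Type*} [MeasurableSpace α] {μ : Measure α}
    [NormedAddCommGroup F] [NormedSpace ℝ F] {c d : α → ℝ} {p q : α → F}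
    (hc : AEStronglyMeasurable c μ) (hd : AEStronglyMeasurable d μ)
    (hp : AEStronglyMeasurable p μ) (hq : AEStronglyMeasurable q μ) :
    eLpNorm (fun x => c x • p x - d x • q x) 1 μ ≤
      (eLpNorm (c - d) 2 μ + eLpNorm d 2 μ) * eLpNorm (p - q) 2 μ +
        eLpNorm (c - d) 2 μ * eLpNorm q 2 μ := by
  have hdec : (fun x => c x • p x - d x • q x) =
      ((c - d) • (p - q) + d • (p - q)) + (c - d) • q := by
    funext x
    simp only [Pi.sub_apply, Pi.add_apply, Pi.smul_apply', sub_smul, smul_sub]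
    abel
  rw [hdec]
  refine (eLpNorm_add_le (((hc.sub hd).smul (hp.sub hq)).add (hd.smul (hp.sub hq)))
    ((hc.sub hd).smul hq) le_rfl).trans ?_
  refine add_le_add ?_ (eLpNorm_smul_le_mul_eLpNorm hq (hc.sub hd))
  refine (eLpNorm_add_le ((hc.sub hd).smul (hp.sub hq)) (hd.smul (hp.sub hq)) le_rfl).trans ?_
  rw [add_mul]
  exact add_le_add (eLpNorm_smul_le_mul_eLpNorm (hp.sub hq) (hc.sub hd))
    (eLpNorm_smul_le_mul_eLpNorm (hp.sub hq) hd)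

section SolidMoments

variable {T : ℝ} {Ω S₀ : Set E3} {u : ℝ → E3 → E3} {ρ : ℝ → L2 Ω ℝ} {χ : ℝ → E3 → ℝ}

/-- The moments of the solid density `ρ χ` at time `t`. -/
def solidMoments (ρ : ℝ → L2 Ω ℝ) (χ : ℝ → E3 → ℝ) (u : ℝ → E3 → E3) (t : ℝ) : Moments :=
  moments Ω (solidDensity ρ χ t) (u t)

lemma solidDensity_smul (t : ℝ) (x : E3) :
    solidDensity ρ χ t x • momentKernel (x, u t x) = χ t x • momentDensity ρ u t x := by
  rw [solidDensity, momentDensity, smul_smul, mul_comm]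

lemma integrableOn_solidDensity_smul (hΩ : IsOpen Ω) (hb : Bornology.IsBounded Ω)
    (hu : IsContinuousSmooth T Ω u) {t : ℝ} (ht : t ∈ Icc 0 T) (hχ : MemLp (χ t) 2 volume) :
    IntegrableOn (fun x => solidDensity ρ χ t x • momentKernel (x, u t x)) Ω := by
  simp only [solidDensity_smul]
  exact memLp_one_iff_integrable.1
    ((memLp_momentDensity hu hΩ hb ht).smul (p := 2) (hχ.restrict Ω))

lemma solidVelocity_eq (hΩ : IsOpen Ω) (hb : Bornology.IsBounded Ω)
    (hu : IsContinuousSmooth T Ω u) {t : ℝ} (ht : t ∈ Icc 0 T) (hχ : MemLp (χ t) 2 volume) (x : E3) :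
    solidVelocity ρ χ u t x =
      momLinear (solidMoments ρ χ u t) + cross (momAngular (solidMoments ρ χ u t)) x :=
  rigidProj_eq_moments (integrableOn_solidDensity_smul hΩ hb hu ht hχ) x

lemma mass_solidDensity (hΩ : IsOpen Ω) (hb : Bornology.IsBounded Ω)
    (hu : IsContinuousSmooth T Ω u) {t : ℝ} (ht : t ∈ Icc 0 T) (hχ : MemLp (χ t) 2 volume) :
    mass Ω (solidDensity ρ χ t) = (solidMoments ρ χ u t).1 :=
  mass_eq_moments (integrableOn_solidDensity_smul hΩ hb hu ht hχ)

lemma inertia_solidDensity (hΩ : IsOpen Ω) (hb : Bornology.IsBounded Ω)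
    (hu : IsContinuousSmooth T Ω u) {t : ℝ} (ht : t ∈ Icc 0 T) (hχ : MemLp (χ t) 2 volume) :
    inertia Ω (solidDensity ρ χ t) = momInertia (solidMoments ρ χ u t) :=
  inertia_eq_moments (integrableOn_solidDensity_smul hΩ hb hu ht hχ)

lemma solidMoments_congr {χ' : ℝ → E3 → ℝ} {t : ℝ} (h : χ t =ᵐ[volume] χ' t) :
    solidMoments ρ χ u t = solidMoments ρ χ' u t := by
  refine integral_congr_ae ?_
  filter_upwards [ae_restrict_of_ae h] with x hx
  rw [solidDensity_smul, solidDensity_smul, hx]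

/-- Products of L²-continuous curves are L¹-continuous. Nothing is assumed on the structure of `χ`,
so this applies to an arbitrary competitor in the uniqueness proof. -/
lemma continuousOn_solidMoments (hΩ : IsOpen Ω) (hb : Bornology.IsBounded Ω)
    (hu : IsContinuousSmooth T Ω u) (hρ : ContinuousOn ρ (Icc 0 T))
    (hχ : ∀ t ∈ Icc 0 T, MemLp (χ t) 2 volume)
    (hχc : ∀ t ∈ Icc 0 T,
      Tendsto (fun s => eLpNorm (χ s - χ t) 2 volume) (𝓝[Icc 0 T] t) (𝓝 0)) :
    ContinuousOn (solidMoments ρ χ u) (Icc 0 T) := by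
  intro t ht
  rw [ContinuousWithinAt, tendsto_iff_edist_tendsto_0]
  have hq := tendsto_momentDensity hu hΩ hb hρ ht
  have hp : Tendsto (fun s => eLpNorm (χ s - χ t) 2 (volume.restrict Ω)) (𝓝[Icc 0 T] t) (𝓝 0) :=
    tendsto_of_tendsto_of_tendsto_of_le_of_le tendsto_const_nhds (hχc t ht) (fun _ => bot_le)
      fun s => eLpNorm_restrict_le _ _ _ _
  have hd : eLpNorm (χ t) 2 (volume.restrict Ω) ≠ ⊤ := ((hχ t ht).restrict Ω).eLpNorm_ne_top
  have hft : eLpNorm (momentDensity ρ u t) 2 (volume.restrict Ω) ≠ ⊤ :=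
    (memLp_momentDensity hu hΩ hb ht).eLpNorm_ne_top
  have hlim := (ENNReal.Tendsto.mul (hp.add (tendsto_const_nhds (x := eLpNorm (χ t) 2
      (volume.restrict Ω)))) (Or.inr ENNReal.zero_ne_top) hq
      (Or.inr (by rw [zero_add]; exact hd))).add
    (ENNReal.Tendsto.mul_const hp (Or.inr hft))
  rw [mul_zero, zero_mul, add_zero] at hlim
  refine tendsto_of_tendsto_of_tendsto_of_le_of_le' tendsto_const_nhds hlim
    (Eventually.of_forall fun _ => bot_le) ?_
  filter_upwards [self_mem_nhdsWithin] with s hs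
  rw [edist_eq_enorm_sub]
  refine (enorm_setIntegral_sub_le (integrableOn_solidDensity_smul hΩ hb hu hs (hχ s hs))
    (integrableOn_solidDensity_smul hΩ hb hu ht (hχ t ht))).trans ?_
  rw [← eLpNorm_one_eq_lintegral_enorm]
  simp only [solidDensity_smul]
  exact eLpNorm_one_smul_sub_smul_le ((hχ s hs).restrict Ω).aestronglyMeasurable
    ((hχ t ht).restrict Ω).aestronglyMeasurable
    (memLp_momentDensity hu hΩ hb hs).aestronglyMeasurable
    (memLp_momentDensity hu hΩ hb ht).aestronglyMeasurable

/-! ### Moments of a body in a rigid configuration -/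

lemma measurable_charFn {S : Set E3} (hS : MeasurableSet S) : Measurable (charFn S) :=
  measurable_const.indicator hS

lemma charFn_nonneg (S : Set E3) (x : E3) : 0 ≤ charFn S x :=
  indicator_nonneg (fun _ _ => zero_le_one) x

lemma abs_charFn_le (S : Set E3) (x : E3) : |charFn S x| ≤ 1 := by
  by_cases h : x ∈ S <;> simp [charFn, h]

lemma memLp_charFn {S : Set E3} (hS : MeasurableSet S) (hb : Bornology.IsBounded S) (p : ℝ≥0∞) :
    MemLp (charFn S) p volume :=
  memLp_indicator_const p hS 1 (Or.inr hb.measure_lt_top.ne)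

lemma IsRigid.isBounded_image {X : Config} (hX : IsRigid X) {S : Set E3}
    (hb : Bornology.IsBounded S) : Bornology.IsBounded (affineMap X '' S) :=
  hX.isometry.lipschitz.isBounded_image hb

lemma IsRigid.charFn_image {X : Config} (hX : IsRigid X) (S : Set E3) (x : E3) :
    charFn (affineMap X '' S) x = charFn S (affineMap (invConfig X) x) := by
  have h : x ∈ affineMap X '' S ↔ affineMap (invConfig X) x ∈ S := by
    constructor
    · rintro ⟨y, hy, rfl⟩
      rwa [hX.invConfig_affineMap]
    · exact fun h => ⟨_, h, hX.affineMap_invConfig_self x⟩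
  by_cases h1 : x ∈ affineMap X '' S
  · simp [charFn, h1, h.1 h1]
  · simp [charFn, h1, mt h.2 h1]

lemma solidMoments_charFn (hΩ : MeasurableSet Ω) (hS : MeasurableSet S₀) {X : Config}
    (hX : IsRigid X) {t : ℝ} (h : χ t =ᵐ[volume] charFn (affineMap X '' S₀)) :
    solidMoments ρ χ u t = bodyMoments S₀ ρ u t X := by
  rw [bodyMoments_eq_moments hΩ hS hX]
  exact solidMoments_congr (χ' := fun _ => charFn (affineMap X '' S₀)) h

/-- A body with positive mass has a nondegenerate inertia matrix. -/
lemma det_momInertia_bodyMoments_pos (hΩ : IsRegularDomain Ω) (hS : MeasurableSet S₀)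
    (hSb : Bornology.IsBounded S₀) (hu : IsContinuousSmooth T Ω u) {t : ℝ} (ht : t ∈ Icc 0 T)
    (hρ0 : ∀ᵐ x ∂(volume.restrict Ω), 0 ≤ ρ t x) {X : Config} (hX : IsRigid X)
    (hm : 0 < (bodyMoments S₀ ρ u t X).1) : 0 < (momInertia (bodyMoments S₀ ρ u t X)).det := by
  set χ : ℝ → E3 → ℝ := fun _ => charFn (affineMap X '' S₀) with hχ
  have hM := solidMoments_charFn (ρ := ρ) (u := u) (χ := χ) (t := t) hΩ.isOpen.measurableSet hS hX
    (ae_eq_refl _)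
  have hL : MemLp (χ t) 2 volume := memLp_charFn (hX.measurableSet_image hS)
    (hX.isBounded_image hSb) 2
  rw [← hM] at hm ⊢
  rw [← mass_solidDensity hΩ.isOpen hΩ.isBounded hu ht hL] at hm
  rw [← inertia_solidDensity hΩ.isOpen hΩ.isBounded hu ht hL]
  refine det_inertia_pos hΩ.isOpen.measurableSet hΩ.isBounded ?_ ?_ hm
  · exact memLp_one_iff_integrable.1 ((hL.restrict Ω).mul (p := 2) (q := 2) (Lp.memLp (ρ t)))
  · filter_upwards [hρ0] with x hx
    exact mul_nonneg hx (charFn_nonneg _ x)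

/-- Near a rigid configuration in which the body has positive mass, its velocity is Lipschitz. -/
lemma isLipschitzNear_bodyField_of_mass_pos (hΩ : IsRegularDomain Ω) (hS : MeasurableSet S₀)
    (hSb : Bornology.IsBounded S₀) (hu : IsContinuousSmooth T Ω u) (hρ : IsContinuousH1 T Ω ρ)
    {t : ℝ} (ht : t ∈ Icc 0 T) (hρ0 : ∀ᵐ x ∂(volume.restrict Ω), 0 ≤ ρ t x) {X : Config}
    (hX : IsRigid X) (hm : 0 < (bodyMoments S₀ ρ u t X).1) :
    IsLipschitzNear T (bodyField S₀ ρ u) t X :=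
  isLipschitzNear_bodyField hΩ hS hSb hu hρ ht hX hm.ne'
    (det_momInertia_bodyMoments_pos hΩ hS hSb hu ht hρ0 hX hm).ne'

/-- Lipschitz continuity in the configuration, uniform for nearby times, together with continuity in
time for the configuration `X₀`. -/
lemma continuousWithinAt_bodyMoments_uncurry (hΩ : IsRegularDomain Ω) (hS : MeasurableSet S₀)
    (hSb : Bornology.IsBounded S₀) (hu : IsContinuousSmooth T Ω u) (hρ : IsContinuousH1 T Ω ρ)
    {t₀ : ℝ} (ht₀ : t₀ ∈ Icc 0 T) {X₀ : Config} (hX₀ : IsRigid X₀) :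
    ContinuousWithinAt (fun q : ℝ × Config => bodyMoments S₀ ρ u q.1 q.2) (Icc 0 T ×ˢ univ)
      (t₀, X₀) := by
  obtain ⟨r, hr, hdet⟩ := hX₀.exists_half_le_det
  obtain ⟨K, hK⟩ := exists_bodyMoments_sub_le hΩ hS hSb hu hρ ht₀ hdet
  obtain ⟨-, -, hρc, -⟩ := hρ
  have hX₀r : X₀ ∈ Metric.closedBall X₀ r := Metric.mem_closedBall_self hr.le
  have hc := continuousWithinAt_bodyMoments (S₀ := S₀) hΩ.isOpen hΩ.isBounded hu hρc ht₀
    (hdet X₀ hX₀r)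
  have hfst : Tendsto (Prod.fst : ℝ × Config → ℝ) (𝓝[Icc 0 T ×ˢ univ] (t₀, X₀)) (𝓝[Icc 0 T] t₀) := by
    rw [nhdsWithin_prod_eq]
    exact tendsto_fst
  have hsnd : Tendsto (Prod.snd : ℝ × Config → Config) (𝓝[Icc 0 T ×ˢ univ] (t₀, X₀)) (𝓝 X₀) :=
    continuous_snd.continuousAt.tendsto.mono_left nhdsWithin_le_nhds
  rw [ContinuousWithinAt, tendsto_iff_dist_tendsto_zero]
  have hlim : Tendsto (fun q : ℝ × Config => K * dist q.2 X₀ +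
      dist (bodyMoments S₀ ρ u q.1 X₀) (bodyMoments S₀ ρ u t₀ X₀))
      (𝓝[Icc 0 T ×ˢ univ] (t₀, X₀)) (𝓝 0) := by
    have h1 := ((tendsto_iff_dist_tendsto_zero.1 hsnd).const_mul (K : ℝ)).add
      ((tendsto_iff_dist_tendsto_zero.1 hc).comp hfst)
    simpa using h1
  refine tendsto_of_tendsto_of_tendsto_of_le_of_le' tendsto_const_nhds hlim
    (Eventually.of_forall fun _ => dist_nonneg) ?_
  filter_upwards [hfst.eventually hK, hsnd.eventually (Metric.closedBall_mem_nhds X₀ hr)]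
    with q h1 h2
  exact (dist_triangle _ (bodyMoments S₀ ρ u q.1 X₀) _).trans
    (add_le_add (h1.dist_le_mul _ h2 _ hX₀r) le_rfl)

lemma continuousWithinAt_bodyMoments_comp (hΩ : IsRegularDomain Ω) (hS : MeasurableSet S₀)
    (hSb : Bornology.IsBounded S₀) (hu : IsContinuousSmooth T Ω u) (hρ : IsContinuousH1 T Ω ρ)
    {s : Set ℝ} (hs : s ⊆ Icc 0 T) {t₀ : ℝ} (ht₀ : t₀ ∈ s) {X : ℝ → Config}
    (hX : ContinuousWithinAt X s t₀) (hXr : IsRigid (X t₀)) :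
    ContinuousWithinAt (fun t => bodyMoments S₀ ρ u t (X t)) s t₀ :=
  (continuousWithinAt_bodyMoments_uncurry hΩ hS hSb hu hρ (hs ht₀) hXr).comp
    (f := fun t => (t, X t)) (continuousWithinAt_id.prodMk hX) fun _ ht => ⟨hs ht, mem_univ _⟩

/-- A body of positive mass meets `Ω`. -/
lemma exists_mem_of_mass_ne_zero {t : ℝ} {X : Config} (hm : (bodyMoments S₀ ρ u t X).1 ≠ 0) :
    ∃ y ∈ S₀, affineMap X y ∈ Ω := by
  by_contra! h
  refine hm ?_
  have h1 : bodyMoments S₀ ρ u t X = 0 :=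
    setIntegral_eq_zero_of_forall_eq_zero fun y hy => indicator_of_notMem (h y hy) _
  rw [h1]
  rfl

end SolidMoments

/-! ### Motions of the body -/

/-- The standing assumptions on the domain, the body, the velocity and the density. -/
structure IsBodyData (T : ℝ) (Ω S₀ : Set E3) (u : ℝ → E3 → E3) (ρ : ℝ → L2 Ω ℝ) : Prop where
  domain : IsRegularDomain Ω
  measurableSet : MeasurableSet S₀
  isBounded : Bornology.IsBounded S₀
  velocity : IsContinuousSmooth T Ω u
  density : IsContinuousH1 T Ω ρ
  nonneg : ∀ t ∈ Icc 0 T, ∀ᵐ x ∂(volume.restrict Ω), 0 ≤ ρ t x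

/-- `X` moves the body `S₀` from rest position on `[0,s]` by its own rigid field, and the mass of
the body is positive. -/
structure IsBodySolution {Ω : Set E3} (S₀ : Set E3) (u : ℝ → E3 → E3) (ρ : ℝ → L2 Ω ℝ) (s : ℝ)
    (X : ℝ → Config) : Prop where
  start : X 0 = (ContinuousLinearMap.id ℝ E3, 0)
  solves : IsSolutionOn (bodyField S₀ ρ u) 0 s X
  mass_pos : ∀ t ∈ Icc 0 s, 0 < (bodyMoments S₀ ρ u t (X t)).1

section Motion

variable {T s σ : ℝ} {Ω S₀ : Set E3} {u : ℝ → E3 → E3} {ρ : ℝ → L2 Ω ℝ} {X Y : ℝ → Config}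

lemma configVelocity_eq_linField (M : ℝ → Moments) (t : ℝ) (Z : Config) :
    configVelocity (M t, Z) =
      linField (fun t => momLinear (M t)) (fun t => momAngular (M t)) t Z := rfl

lemma IsSolutionOn.linField_of_bodyField {t₀ t₁ : ℝ}
    (hX : IsSolutionOn (bodyField S₀ ρ u) t₀ t₁ X) {M : ℝ → Moments}
    (hM : ∀ t ∈ Icc t₀ t₁, M t = bodyMoments S₀ ρ u t (X t)) :
    IsSolutionOn (linField (fun t => momLinear (M t)) (fun t => momAngular (M t))) t₀ t₁ X := by
  intro t ht
  have h := hX t ht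
  rw [bodyField, ← hM t ht, configVelocity_eq_linField M] at h
  exact h

lemma isRigid_of_isSolutionOn_bodyField {t₀ t₁ : ℝ} (hX : IsSolutionOn (bodyField S₀ ρ u) t₀ t₁ X)
    (h0 : IsRigid (X t₀)) : ∀ t ∈ Icc t₀ t₁, IsRigid (X t) :=
  (hX.linField_of_bodyField (M := fun t => bodyMoments S₀ ρ u t (X t)) fun _ _ => rfl).isRigid h0

namespace IsBodySolution

lemma isRigid (h : IsBodySolution S₀ u ρ s X) : ∀ t ∈ Icc 0 s, IsRigid (X t) :=
  isRigid_of_isSolutionOn_bodyField h.solves (by rw [h.start]; exact isRigid_id)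

lemma mono (h : IsBodySolution S₀ u ρ s X) {s' : ℝ} (hs : s' ≤ s) : IsBodySolution S₀ u ρ s' X :=
  ⟨h.start, h.solves.mono le_rfl hs, fun t ht => h.mass_pos t ⟨ht.1, ht.2.trans hs⟩⟩

lemma congr (h : IsBodySolution S₀ u ρ s X) (hs : 0 ≤ s) (hXY : EqOn Y X (Icc 0 s)) :
    IsBodySolution S₀ u ρ s Y := by
  refine ⟨(hXY ⟨le_rfl, hs⟩).trans h.start, fun t ht => ?_, fun t ht => ?_⟩
  · rw [hXY ht]
    exact (h.solves t ht).congr hXY (hXY ht)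
  · rw [hXY ht]
    exact h.mass_pos t ht

lemma isLipschitzNear (hd : IsBodyData T Ω S₀ u ρ) (h : IsBodySolution S₀ u ρ s X) (hs : s ≤ T)
    {t : ℝ} (ht : t ∈ Icc 0 s) : IsLipschitzNear T (bodyField S₀ ρ u) t (X t) :=
  have ht' : t ∈ Icc 0 T := ⟨ht.1, ht.2.trans hs⟩
  isLipschitzNear_bodyField_of_mass_pos hd.domain hd.measurableSet hd.isBounded hd.velocity
    hd.density ht' (hd.nonneg t ht') (h.isRigid t ht) (h.mass_pos t ht)

lemma eqOn (hd : IsBodyData T Ω S₀ u ρ) (hs : s ≤ T) (hX : IsBodySolution S₀ u ρ s X)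
    (hY : IsBodySolution S₀ u ρ s Y) : EqOn X Y (Icc 0 s) :=
  hX.solves.eqOn le_rfl hs hY.solves (hX.start.trans hY.start.symm) fun _ ht =>
    hX.isLipschitzNear hd hs (Ico_subset_Icc_self ht)

/-- A body solution can be continued. -/
lemma exists_extension (hd : IsBodyData T Ω S₀ u ρ) (hs : s ∈ Ico 0 T)
    (h : IsBodySolution S₀ u ρ s X) :
    ∃ δ > 0, s + δ ≤ T ∧ ∃ Z, IsBodySolution S₀ u ρ (s + δ) Z := by
  have hss : s ∈ Icc 0 s := ⟨hs.1, le_rfl⟩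
  obtain ⟨δ, hδ, hδT, Z, hZ0, hZ⟩ := exists_isSolutionOn hs (h.isLipschitzNear hd hs.2.le hss)
  have hZr : IsRigid (Z s) := by rw [hZ0]; exact h.isRigid s hss
  have hsZ : s ∈ Icc s (s + δ) := ⟨le_rfl, by linarith⟩
  have hc := continuousWithinAt_bodyMoments_comp hd.domain hd.measurableSet hd.isBounded hd.velocity
    hd.density (Icc_subset_Icc hs.1 hδT) hsZ (hZ.continuousOn s hsZ) hZr
  have hpos : 0 < (bodyMoments S₀ ρ u s (Z s)).1 := by rw [hZ0]; exact h.mass_pos s hss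
  -- The continued curve has positive mass at `s`, hence a little beyond; the step is shortened
  -- accordingly.
  have hev : ∀ᶠ t in 𝓝[Icc s (s + δ)] s, 0 < (bodyMoments S₀ ρ u t (Z t)).1 :=
    (continuous_fst.continuousAt.comp_continuousWithinAt hc).eventually (lt_mem_nhds hpos)
  rw [nhdsWithin_Icc_eq_nhdsGE (by linarith : s < s + δ)] at hev
  obtain ⟨c, hc1, hc2⟩ := mem_nhdsGE_iff_exists_Icc_subset.1 hev
  have hc1' : s < c := hc1
  set δ' := min δ (c - s) with hδ'
  have hδ'pos : 0 < δ' := lt_min hδ (by linarith)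
  have hδ'1 : δ' ≤ δ := min_le_left _ _
  have hδ'2 : δ' ≤ c - s := min_le_right _ _
  refine ⟨δ', hδ'pos, by linarith, fun t => if t ≤ s then X t else Z t, ?_, ?_, ?_⟩
  · simp only [hs.1, if_true]
    exact h.start
  · exact h.solves.concat hs.1 (by linarith) (hZ.mono le_rfl (by linarith)) hZ0.symm
  · intro t ht
    by_cases hts : t ≤ s
    · simp only [hts, if_true]
      exact h.mass_pos t ⟨ht.1, hts⟩
    · simp only [hts, if_false]
      exact hc2 ⟨(not_le.1 hts).le, by linarith [ht.2]⟩

end IsBodySolution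

lemma solidVelocity_image_eq (hd : IsBodyData T Ω S₀ u ρ) {η : ℝ → E3 → E3} {t : ℝ}
    (ht : t ∈ Icc 0 T) {Z : Config} (hZ : IsRigid Z) (hη : η t = affineMap Z) (y : E3) :
    solidVelocity ρ (fun τ => charFn (η τ '' S₀)) u t (η t y) =
      affineMap (bodyField S₀ ρ u t Z) y := by
  have hL : MemLp (charFn (η t '' S₀)) 2 volume := by
    rw [hη]
    exact memLp_charFn (hZ.measurableSet_image hd.measurableSet) (hZ.isBounded_image hd.isBounded) 2
  have hM : solidMoments ρ (fun τ => charFn (η τ '' S₀)) u t = bodyMoments S₀ ρ u t Z :=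
    solidMoments_charFn hd.domain.isOpen.measurableSet hd.measurableSet hZ
      (by simp only [hη]; exact ae_eq_refl _)
  rw [solidVelocity_eq hd.domain.isOpen hd.domain.isBounded hd.velocity ht hL, hM, bodyField,
    affineMap_configVelocity, hη]

lemma bodyMass_eq (hd : IsBodyData T Ω S₀ u ρ) {η : ℝ → E3 → E3} {t : ℝ}
    (ht : t ∈ Icc 0 T) {Z : Config} (hZ : IsRigid Z) (hη : η t = affineMap Z) :
    bodyMass ρ S₀ η t = (bodyMoments S₀ ρ u t Z).1 := by
  have hL : MemLp (charFn (η t '' S₀)) 2 volume := by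
    rw [hη]
    exact memLp_charFn (hZ.measurableSet_image hd.measurableSet) (hZ.isBounded_image hd.isBounded) 2
  have hM : solidMoments ρ (fun τ => charFn (η τ '' S₀)) u t = bodyMoments S₀ ρ u t Z :=
    solidMoments_charFn hd.domain.isOpen.measurableSet hd.measurableSet hZ
      (by simp only [hη]; exact ae_eq_refl _)
  rw [bodyMass, mass_solidDensity (χ := fun τ => charFn (η τ '' S₀)) hd.domain.isOpen
    hd.domain.isBounded hd.velocity ht hL, hM]

lemma Icc_mem_nhdsWithin_Ico {t : ℝ} (ht : t ∈ Ico 0 σ) :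
    Icc 0 ((t + σ) / 2) ∈ 𝓝[Ico 0 σ] t := by
  rw [mem_nhdsWithin_iff_exists_mem_nhds_inter]
  refine ⟨Iio ((t + σ) / 2), Iio_mem_nhds (by linarith [ht.2]), ?_⟩
  rintro x ⟨hx1, hx2⟩
  exact ⟨hx2.1, (mem_Iio.1 hx1).le⟩

lemma hasDerivWithinAt_Ico (h : ∀ s ∈ Ico 0 σ, IsBodySolution S₀ u ρ s X) {t : ℝ}
    (ht : t ∈ Ico 0 σ) : HasDerivWithinAt X (bodyField S₀ ρ u t (X t)) (Ico 0 σ) t := by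
  have hs : (t + σ) / 2 ∈ Ico 0 σ := ⟨by linarith [ht.1, ht.2], by linarith [ht.2]⟩
  exact ((h _ hs).solves t ⟨ht.1, by linarith [ht.2]⟩).mono_of_mem_nhdsWithin
    (Icc_mem_nhdsWithin_Ico ht)

lemma isBodyMotion_of_isBodySolution (hd : IsBodyData T Ω S₀ u ρ) (hσ : σ ∈ Ioc 0 T)
    (h : ∀ s ∈ Ico 0 σ, IsBodySolution S₀ u ρ s X) :
    IsBodyMotion S₀ u ρ σ (fun t => affineMap (X t)) := by
  have hr : ∀ t ∈ Ico 0 σ, IsRigid (X t) := fun t ht => (h t ht).isRigid t ⟨ht.1, le_rfl⟩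
  have hT : ∀ t ∈ Ico 0 σ, t ∈ Icc 0 T := fun t ht => ⟨ht.1, ht.2.le.trans hσ.2⟩
  refine ⟨fun t ht => (hr t ht).isometry, fun y => ?_, fun t ht => ?_, fun t ht y => ?_⟩
  · simp only [(h 0 ⟨le_rfl, hσ.1⟩).start, affineMap_id]
    rfl
  · rw [bodyMass_eq hd (hT t ht) (hr t ht) rfl]
    exact (h t ht).mass_pos t ⟨ht.1, le_rfl⟩
  · rw [solidVelocity_image_eq hd (η := fun t => affineMap (X t)) (hT t ht) (hr t ht) rfl]
    exact hasDerivWithinAt_affineMap (hasDerivWithinAt_Ico h ht) y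

/-- Isometries are rigid configurations. -/
lemma exists_isRigid_of_isometry {f : E3 → E3} (hf : Isometry f) :
    ∃ Z : Config, IsRigid Z ∧ affineMap Z = f := by
  set g := hf.affineIsometryOfStrictConvexSpace with hg
  refine ⟨(g.linearIsometry.toContinuousLinearMap, f 0), fun y => g.linearIsometry.norm_map y, ?_⟩
  funext y
  have h1 := g.map_vadd (0 : E3) y
  simp only [vadd_eq_add, add_zero] at h1
  exact h1.symm

lemma clm_eq_sum (L : E3 →L[ℝ] E3) :
    L = ∑ i : Fin 3, (EuclideanSpace.proj (𝕜 := ℝ) i).smulRight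
      (L (EuclideanSpace.single i 1)) := by
  ext1 x
  have hx : x = ∑ i : Fin 3, x i • EuclideanSpace.single i (1 : ℝ) := by
    have := (EuclideanSpace.basisFun (Fin 3) ℝ).sum_repr x
    simpa using this.symm
  conv_lhs => rw [hx]
  rw [map_sum, sum_apply]
  refine Finset.sum_congr rfl fun i _ => ?_
  rw [map_smul]
  rfl

/-- The image of the origin gives the translation part, and the images of the basis vectors give the
linear part; in finite dimension this determines the derivative in operator norm. -/
lemma hasDerivWithinAt_of_affineMap {X' : Config} {I : Set ℝ} {t : ℝ}
    (h : ∀ y, HasDerivWithinAt (fun τ => affineMap (X τ) y) (affineMap X' y) I t) :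
    HasDerivWithinAt X X' I t := by
  have h2 : HasDerivWithinAt (fun τ => (X τ).2) X'.2 I t := by
    have := h 0
    simpa [affineMap] using this
  have h1 : ∀ y, HasDerivWithinAt (fun τ => (X τ).1 y) (X'.1 y) I t := fun y => by
    have h3 := (h y).fun_sub h2
    simpa [affineMap] using h3
  have h3 : HasDerivWithinAt (fun τ => (X τ).1) X'.1 I t := by
    have h4 : ∀ i : Fin 3, HasDerivWithinAt (fun τ => (EuclideanSpace.proj (𝕜 := ℝ) i).smulRight
        ((X τ).1 (EuclideanSpace.single i 1)))
        ((EuclideanSpace.proj (𝕜 := ℝ) i).smulRight (X'.1 (EuclideanSpace.single i 1))) I t :=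
      fun i => (ContinuousLinearMap.smulRightL ℝ E3 E3
        (EuclideanSpace.proj (𝕜 := ℝ) i)).hasFDerivAt.comp_hasDerivWithinAt t (h1 _)
    have h5 := HasDerivWithinAt.fun_sum (u := Finset.univ) fun i _ => h4 i
    rw [clm_eq_sum X'.1]
    exact h5.congr (fun τ _ => clm_eq_sum (X τ).1) (clm_eq_sum (X t).1)
  exact h3.prodMk h2

/-- Isometries of `ℝ³` are affine, so a motion given by isometries that are differentiable pointwise
is a differentiable curve of configurations. -/
lemma IsBodyMotion.exists_isBodySolution (hd : IsBodyData T Ω S₀ u ρ) (hσ : σ ∈ Ioc 0 T)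
    {η : ℝ → E3 → E3} (hη : IsBodyMotion S₀ u ρ σ η) :
    ∃ X : ℝ → Config, (∀ t ∈ Ico 0 σ, η t = affineMap (X t)) ∧
      ∀ s ∈ Ico 0 σ, IsBodySolution S₀ u ρ s X := by
  have hex : ∀ t ∈ Ico 0 σ, ∃ Z : Config, IsRigid Z ∧ affineMap Z = η t := fun t ht =>
    exists_isRigid_of_isometry (hη.isometry t ht)
  choose! X hXr hXη using hex
  refine ⟨X, fun t ht => (hXη t ht).symm, fun s hs => ⟨?_, ?_, ?_⟩⟩
  · have h0 : (0 : ℝ) ∈ Ico 0 σ := ⟨le_rfl, hσ.1⟩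
    have h1 : ∀ y, (X 0).1 y + (X 0).2 = y := fun y => by
      have := congrFun (hXη 0 h0) y
      rwa [hη.start] at this
    have h2 : (X 0).2 = 0 := by simpa using h1 0
    refine Prod.ext ?_ h2
    ext1 y
    have := h1 y
    rwa [h2, add_zero] at this
  · intro t ht
    have ht' : t ∈ Ico 0 σ := ⟨ht.1, ht.2.trans_lt hs.2⟩
    have hsub : Icc 0 s ⊆ Ico 0 σ := fun x hx => ⟨hx.1, hx.2.trans_lt hs.2⟩
    refine hasDerivWithinAt_of_affineMap fun y => ?_
    have h1 := hη.velocity t ht' y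
    rw [solidVelocity_image_eq hd ⟨ht'.1, ht'.2.le.trans hσ.2⟩ (hXr t ht') (hXη t ht').symm] at h1
    exact (h1.mono hsub).congr (fun x hx => by rw [hXη x (hsub hx)]) (by rw [hXη t ht'])
  · intro t ht
    have ht' : t ∈ Ico 0 σ := ⟨ht.1, ht.2.trans_lt hs.2⟩
    rw [← bodyMass_eq hd ⟨ht'.1, ht'.2.le.trans hσ.2⟩ (hXr t ht') (hXη t ht').symm]
    exact hη.mass_pos t ht'

end Motion

/-! ### Existence of the motion as long as the mass persists -/

section GlobalMotion

variable {T s σ : ℝ} {Ω S₀ : Set E3} {u : ℝ → E3 → E3} {ρ : ℝ → L2 Ω ℝ} {X Y : ℝ → Config}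

lemma isBodySolution_zero (hm : 0 < (bodyMoments S₀ ρ u 0 (ContinuousLinearMap.id ℝ E3, 0)).1) :
    IsBodySolution S₀ u ρ 0 (fun _ => (ContinuousLinearMap.id ℝ E3, 0)) := by
  refine ⟨rfl, fun t ht => ?_, fun t ht => ?_⟩
  · rw [Icc_self] at ht ⊢
    rw [mem_singleton_iff.1 ht]
    exact HasFDerivWithinAt.of_subsingleton subsingleton_singleton
  · rw [Icc_self] at ht
    rw [mem_singleton_iff.1 ht]
    exact hm

/-- The mass persists for a short time. -/
lemma exists_massPersists (hd : IsBodyData T Ω S₀ u ρ) (hT : 0 < T)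
    (hm : 0 < (bodyMoments S₀ ρ u 0 (ContinuousLinearMap.id ℝ E3, 0)).1) :
    ∃ τ ∈ Ioc 0 T, MassPersists S₀ u ρ τ := by
  obtain ⟨δ, hδ, hδT, Z, hZ⟩ := (isBodySolution_zero hm).exists_extension hd ⟨le_rfl, hT⟩
  rw [zero_add] at hδT hZ
  have hcont : ContinuousOn (fun t => (bodyMoments S₀ ρ u t (Z t)).1) (Icc 0 δ) := fun t ht =>
    continuous_fst.continuousAt.comp_continuousWithinAt
      (continuousWithinAt_bodyMoments_comp hd.domain hd.measurableSet hd.isBounded hd.velocity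
        hd.density (Icc_subset_Icc le_rfl hδT) ht (hZ.solves.continuousOn t ht) (hZ.isRigid t ht))
  -- The minimum of the mass along one solution on `[0, δ]` is a lower bound for every motion, since
  -- by uniqueness each of them coincides with this solution.
  obtain ⟨t₀, ht₀, hmin⟩ := isCompact_Icc.exists_isMinOn ⟨0, le_rfl, hδ.le⟩ hcont
  refine ⟨δ, ⟨hδ, hδT⟩, fun σ hσ η hη =>
    ⟨_, hZ.mass_pos t₀ ht₀, fun t ht => ?_⟩⟩
  have hσ' : σ ∈ Ioc 0 T := ⟨hσ.1, hσ.2.trans hδT⟩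
  obtain ⟨X, hXη, hX⟩ := hη.exists_isBodySolution hd hσ'
  have ht' : t ∈ Icc 0 t := ⟨ht.1, le_rfl⟩
  rw [bodyMass_eq hd ⟨ht.1, ht.2.le.trans hσ'.2⟩ ((hX t ht).isRigid t ht') (hXη t ht),
    (hX t ht).eqOn hd (ht.2.le.trans hσ'.2) (hZ.mono (ht.2.le.trans hσ.2)) ht']
  exact hmin ⟨ht.1, ht.2.le.trans hσ.2⟩

/-- Solutions on all shorter intervals fit together. -/
lemma exists_isBodySolution_Ico (hd : IsBodyData T Ω S₀ u ρ) (hσ : σ ∈ Ioc 0 T)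
    (h : ∀ s ∈ Ico 0 σ, ∃ X, IsBodySolution S₀ u ρ s X) :
    ∃ X, ∀ s ∈ Ico 0 σ, IsBodySolution S₀ u ρ s X := by
  choose! Y hY using h
  -- The value at `t` is that of the solution chosen on `[0, t]`; by uniqueness the choices are
  -- compatible.
  refine ⟨fun t => Y t t, fun s hs => (hY s hs).congr hs.1 fun t ht => ?_⟩
  have ht' : t ∈ Ico 0 σ := ⟨ht.1, ht.2.trans_lt hs.2⟩
  exact (hY t ht').eqOn hd (ht'.2.le.trans hσ.2) ((hY s hs).mono ht.2) ⟨ht.1, le_rfl⟩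

/-- Bounded rigid configurations form a compact set, on which the mass is continuous jointly in time
and configuration. A solution whose mass stays above `c` cannot leave such a set. -/
lemma isCompact_rigid_mass_ge (hd : IsBodyData T Ω S₀ u ρ) (R c : ℝ) :
    IsCompact {q : ℝ × Config | (q.1 ∈ Icc 0 T ∧ IsRigid q.2 ∧ ‖q.2‖ ≤ R) ∧
      c ≤ (bodyMoments S₀ ρ u q.1 q.2).1} := by
  have : ProperSpace Config := FiniteDimensional.proper ℝ Config
  have hK : IsCompact (Icc 0 T ×ˢ ({Z : Config | IsRigid Z} ∩ Metric.closedBall 0 R)) :=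
    isCompact_Icc.prod ((isCompact_closedBall _ _).inter_left isClosed_isRigid)
  have hc : ContinuousOn (fun q : ℝ × Config => (bodyMoments S₀ ρ u q.1 q.2).1)
      (Icc 0 T ×ˢ ({Z : Config | IsRigid Z} ∩ Metric.closedBall 0 R)) := fun q hq =>
    continuous_fst.continuousAt.comp_continuousWithinAt
      ((continuousWithinAt_bodyMoments_uncurry hd.domain hd.measurableSet hd.isBounded hd.velocity
        hd.density hq.1 hq.2.1).mono (prod_mono le_rfl (subset_univ _)))
  have hcl := hc.preimage_isClosed_of_isClosed hK.isClosed (isClosed_Ici (a := c))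
  refine (hK.of_isClosed_subset hcl inter_subset_left).of_isClosed_subset ?_ ?_ <;>
  · have he : {q : ℝ × Config | (q.1 ∈ Icc 0 T ∧ IsRigid q.2 ∧ ‖q.2‖ ≤ R) ∧
        c ≤ (bodyMoments S₀ ρ u q.1 q.2).1} =
        Icc 0 T ×ˢ ({Z : Config | IsRigid Z} ∩ Metric.closedBall 0 R) ∩
          (fun q : ℝ × Config => (bodyMoments S₀ ρ u q.1 q.2).1) ⁻¹' Ici c := by
      ext q
      simp [and_assoc]
    first
    | exact he ▸ hcl
    | exact he.subset

lemma continuousOn_bodyField (hd : IsBodyData T Ω S₀ u ρ) :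
    ContinuousOn (fun q : ℝ × Config => bodyField S₀ ρ u q.1 q.2)
      {q | (q.1 ∈ Icc 0 T ∧ IsRigid q.2) ∧ 0 < (bodyMoments S₀ ρ u q.1 q.2).1} := by
  intro q hq
  have h1 := (contDiffAt_configVelocity hq.2.ne'
    (det_momInertia_bodyMoments_pos hd.domain hd.measurableSet hd.isBounded hd.velocity hq.1.1
      (hd.nonneg _ hq.1.1) hq.1.2 hq.2).ne' q.2).continuousAt
  have h2 : ContinuousWithinAt (fun q : ℝ × Config => (bodyMoments S₀ ρ u q.1 q.2, q.2))
      {q | (q.1 ∈ Icc 0 T ∧ IsRigid q.2) ∧ 0 < (bodyMoments S₀ ρ u q.1 q.2).1} q :=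
    ((continuousWithinAt_bodyMoments_uncurry hd.domain hd.measurableSet hd.isBounded hd.velocity
      hd.density hq.1.1 hq.1.2).mono fun p hp => ⟨hp.1.1, mem_univ _⟩).prodMk
      continuous_snd.continuousWithinAt
  exact ContinuousAt.comp_continuousWithinAt (g := configVelocity) h1 h2

lemma IsRigid.norm_le {Z : Config} (hZ : IsRigid Z) {R : ℝ} (hR : ‖Z.2‖ ≤ R) :
    ‖Z‖ ≤ max 1 R := by
  rw [Prod.norm_def]
  refine max_le_max ?_ hR
  refine ContinuousLinearMap.opNorm_le_bound _ zero_le_one fun y => ?_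
  rw [hZ y, one_mul]

/-- A body of positive mass has a point in the bounded set `Ω`, which bounds the translation; the
linear part has norm at most one. -/
lemma exists_bound_of_mass_pos (hd : IsBodyData T Ω S₀ u ρ) :
    ∃ R, ∀ t, ∀ Z : Config, IsRigid Z → 0 < (bodyMoments S₀ ρ u t Z).1 → ‖Z‖ ≤ R := by
  obtain ⟨R₁, hR₁⟩ := hd.isBounded.exists_norm_le
  obtain ⟨R₂, hR₂⟩ := hd.domain.isBounded.exists_norm_le
  refine ⟨max 1 (R₂ + R₁), fun t Z hZ hm => hZ.norm_le ?_⟩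
  obtain ⟨y, hy, hyΩ⟩ := exists_mem_of_mass_ne_zero hm.ne'
  have h1 : Z.2 = affineMap Z y - Z.1 y := by rw [affineMap, add_sub_cancel_left]
  rw [h1]
  refine (norm_sub_le _ _).trans (add_le_add (hR₂ _ hyΩ) ?_)
  rw [hZ y]
  exact hR₁ y hy

/-- A solution on `[0,σ)` that stays in a compact set on which the field is continuous extends to
`[0,σ]`. -/
lemma exists_isSolutionOn_of_mem_compact {E : Type*} [NormedAddCommGroup E] [NormedSpace ℝ E]
    [FiniteDimensional ℝ E] {G : ℝ → E → E} {X : ℝ → E} (hσ : 0 < σ)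
    (hX : ∀ t ∈ Ico 0 σ, HasDerivWithinAt X (G t (X t)) (Ico 0 σ) t) {K : Set (ℝ × E)}
    (hK : IsCompact K) (hG : ContinuousOn (fun q : ℝ × E => G q.1 q.2) K)
    (hmemX : ∀ t ∈ Ico 0 σ, (t, X t) ∈ K) :
    ∃ Z : ℝ → E, EqOn Z X (Ico 0 σ) ∧ (σ, Z σ) ∈ K ∧ IsSolutionOn G 0 σ Z := by
  obtain ⟨L, hL⟩ := hK.exists_bound_of_continuousOn hG
  have hlip : LipschitzOnWith L.toNNReal X (Ico 0 σ) := by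
    refine (convex_Ico 0 σ).lipschitzOnWith_of_nnnorm_hasDerivWithin_le hX fun t ht => ?_
    rw [← NNReal.coe_le_coe, coe_nnnorm]
    exact (hL _ (hmemX t ht)).trans (Real.le_coe_toNNReal L)
  -- The field is bounded on `K`, so the solution is Lipschitz and has a limit at `σ`, which is in
  -- `K` because `K` is closed.
  obtain ⟨Z, hZlip, hXZ⟩ := hlip.extend_finite_dimension
  have hZc : Continuous Z := hZlip.continuous
  have hZ : ∀ t ∈ Ico 0 σ, HasDerivWithinAt Z (G t (Z t)) (Ico 0 σ) t := fun t ht => by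
    rw [← hXZ ht]
    exact (hX t ht).congr (fun x hx => (hXZ hx).symm) (hXZ ht).symm
  have hIoo : Ioo 0 σ ∈ 𝓝[<] σ := Ioo_mem_nhdsLT hσ
  have hev : ∀ᶠ t in 𝓝[<] σ, (t, Z t) ∈ K := by
    filter_upwards [hIoo] with t ht
    rw [← hXZ (Ioo_subset_Ico_self ht)]
    exact hmemX t (Ioo_subset_Ico_self ht)
  have hpair : Tendsto (fun t => (t, Z t)) (𝓝[<] σ) (𝓝 (σ, Z σ)) :=
    (continuous_id.prodMk hZc).continuousAt.tendsto.mono_left nhdsWithin_le_nhds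
  have hσK : (σ, Z σ) ∈ K := hK.isClosed.mem_of_tendsto hpair hev
  have hlimG : Tendsto (fun t => G t (Z t)) (𝓝[<] σ) (𝓝 (G σ (Z σ))) :=
    (hG _ hσK).tendsto.comp (tendsto_nhdsWithin_iff.2 ⟨hpair, hev⟩)
  have hder : ∀ t ∈ Ioo 0 σ, HasDerivAt Z (G t (Z t)) t := fun t ht =>
    (hZ t (Ioo_subset_Ico_self ht)).hasDerivAt (Ico_mem_nhds ht.1 ht.2)
  have hend : HasDerivWithinAt Z (G σ (Z σ)) (Iic σ) σ := by
    -- Differentiability at the endpoint follows from the convergence of the derivatives.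
    refine hasDerivWithinAt_Iic_of_tendsto_deriv (s := Ioo 0 σ)
      (fun t ht => (hder t ht).differentiableAt.differentiableWithinAt)
      hZc.continuousWithinAt hIoo (hlimG.congr' ?_)
    filter_upwards [hIoo] with t ht
    exact (hder t ht).deriv.symm
  refine ⟨Z, hXZ.symm, hσK, fun t ht => ?_⟩
  rcases ht.2.eq_or_lt with rfl | hlt
  · exact hend.mono Icc_subset_Iic_self
  · refine (hZ t ⟨ht.1, hlt⟩).mono_of_mem_nhdsWithin ?_
    rw [mem_nhdsWithin_iff_exists_mem_nhds_inter]
    exact ⟨Iio σ, Iio_mem_nhds hlt, fun x hx => ⟨hx.2.1, hx.1⟩⟩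

/-- A solution on `[0,σ)` whose mass stays away from zero extends to `[0,σ]`. -/
lemma exists_isBodySolution_of_mass_ge (hd : IsBodyData T Ω S₀ u ρ) (hσ : σ ∈ Ioc 0 T)
    (h : ∀ s ∈ Ico 0 σ, IsBodySolution S₀ u ρ s X) {c : ℝ} (hc : 0 < c)
    (hm : ∀ t ∈ Ico 0 σ, c ≤ (bodyMoments S₀ ρ u t (X t)).1) :
    ∃ Z, IsBodySolution S₀ u ρ σ Z := by
  obtain ⟨R, hR⟩ := exists_bound_of_mass_pos hd
  have hK := isCompact_rigid_mass_ge hd R c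
  set K := {q : ℝ × Config | (q.1 ∈ Icc 0 T ∧ IsRigid q.2 ∧ ‖q.2‖ ≤ R) ∧
      c ≤ (bodyMoments S₀ ρ u q.1 q.2).1} with hKdef
  have hF : ContinuousOn (fun q : ℝ × Config => bodyField S₀ ρ u q.1 q.2) K :=
    (continuousOn_bodyField hd).mono fun q hq => ⟨⟨hq.1.1, hq.1.2.1⟩, hc.trans_le hq.2⟩
  have hmemX : ∀ t ∈ Ico 0 σ, (t, X t) ∈ K := fun t ht =>
    have hr := (h t ht).isRigid t ⟨ht.1, le_rfl⟩
    ⟨⟨⟨ht.1, ht.2.le.trans hσ.2⟩, hr, hR t _ hr (hc.trans_le (hm t ht))⟩, hm t ht⟩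
  obtain ⟨Z, hZX, hσK, hZ⟩ := exists_isSolutionOn_of_mem_compact hσ.1
    (fun t ht => hasDerivWithinAt_Ico h ht) hK hF hmemX
  refine ⟨Z, (hZX ⟨le_rfl, hσ.1⟩).trans (h 0 ⟨le_rfl, hσ.1⟩).start, hZ, fun t ht => ?_⟩
  rcases ht.2.eq_or_lt with rfl | hlt
  · exact hc.trans_le hσK.2
  · rw [hZX ⟨ht.1, hlt⟩]
    exact hc.trans_le (hm t ⟨ht.1, hlt⟩)

/-- If the mass persists, the motion of the body exists on `[0,T]`. -/
theorem exists_isBodySolution (hd : IsBodyData T Ω S₀ u ρ) (hT : 0 < T)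
    (hm : 0 < (bodyMoments S₀ ρ u 0 (ContinuousLinearMap.id ℝ E3, 0)).1)
    (hpers : MassPersists S₀ u ρ T) : ∃ X, IsBodySolution S₀ u ρ T X := by
  set A := {s : ℝ | ∃ X, IsBodySolution S₀ u ρ s X} with hA
  have hdown : ∀ s ∈ A, ∀ s' ≤ s, s' ∈ A := fun s ⟨X, hX⟩ s' hs' => ⟨X, hX.mono hs'⟩
  -- Persistence of the mass, applied to the motion on `[0, σ)`, gives the lower bound that permits
  -- the closing of the interval.
  have hlim : ∀ σ ∈ Ioc 0 T, (∀ s ∈ Ico 0 σ, s ∈ A) → σ ∈ A := by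
    intro σ hσ h
    obtain ⟨X, hX⟩ := exists_isBodySolution_Ico hd hσ h
    obtain ⟨c, hc, hcm⟩ := hpers σ hσ _ (isBodyMotion_of_isBodySolution hd hσ hX)
    refine exists_isBodySolution_of_mass_ge hd hσ hX hc fun t ht => ?_
    rw [← bodyMass_eq hd (η := fun t => affineMap (X t)) ⟨ht.1, ht.2.le.trans hσ.2⟩
      ((hX t ht).isRigid t ⟨ht.1, le_rfl⟩) rfl]
    exact hcm t ht
  have h0 : (0 : ℝ) ∈ A := ⟨_, isBodySolution_zero hm⟩
  have hclosed : IsClosed (A ∩ Icc 0 T) := by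
    refine isClosed_of_closure_subset fun x hx => ?_
    have hxI : x ∈ Icc 0 T := isClosed_Icc.closure_subset_iff.2 inter_subset_right hx
    refine ⟨?_, hxI⟩
    rcases hxI.1.eq_or_lt with rfl | hpos
    · exact h0
    refine hlim x ⟨hpos, hxI.2⟩ fun s hs => ?_
    obtain ⟨y, hy1, hy2⟩ := mem_closure_iff.1 hx (Ioi s) isOpen_Ioi hs.2
    exact hdown y hy2.1 s hy1.le
  refine hclosed.Icc_subset_of_forall_exists_gt h0 ?_ ⟨hT.le, le_rfl⟩
  rintro s ⟨⟨X, hX⟩, hs⟩ y hy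
  obtain ⟨δ, hδ, -, Z, hZ⟩ := hX.exists_extension hd hs
  have hy' : s < y := hy
  exact ⟨min (s + δ) y, ⟨Z, hZ.mono (min_le_left _ _)⟩, lt_min (by linarith) hy', min_le_right _ _⟩

end GlobalMotion

/-! ### Uniqueness of the characteristic function of the body -/

section CharUniqueness

variable {T : ℝ} {Ω S₀ : Set E3} {u : ℝ → E3 → E3} {ρ : ℝ → L2 Ω ℝ} {X : ℝ → Config}
  {χ : ℝ → E3 → ℝ}

lemma IsRigid.ae_eq_comp_inv {Z : Config} (hZ : IsRigid Z) {f g : E3 → ℝ}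
    (h : (fun y => f (affineMap Z y)) =ᵐ[volume] g) :
    f =ᵐ[volume] fun x => g (affineMap (invConfig Z) x) := by
  have h1 := hZ.inv.measurePreserving.quasiMeasurePreserving.ae_eq_comp h
  refine EventuallyEq.trans (Eventually.of_forall fun x => ?_) h1
  simp only [Function.comp_apply, hZ.affineMap_invConfig_self]

lemma IsRigid.ae_eq_comp {Z : Config} (hZ : IsRigid Z) {f g : E3 → ℝ} (h : f =ᵐ[volume] g) :
    (fun y => f (affineMap Z y)) =ᵐ[volume] fun y => g (affineMap Z y) :=
  hZ.measurePreserving.quasiMeasurePreserving.ae_eq_comp h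

/-- The coefficients of the rigid field of a curve of nondegenerate moments. -/
lemma eventually_continuousWithinAt_coefficients {M : ℝ → Moments} {t₀ : ℝ} (ht₀ : t₀ ∈ Icc 0 T)
    (hM : ContinuousOn M (Icc 0 T)) (hm : (M t₀).1 ≠ 0) (hJ : (momInertia (M t₀)).det ≠ 0) :
    ∀ᶠ t in 𝓝[Icc 0 T] t₀,
      ContinuousWithinAt (fun t => momLinear (M t)) (Icc 0 T) t ∧
      ContinuousWithinAt (fun t => momAngular (M t)) (Icc 0 T) t := by
  have h1 := (contDiffAt_momLinear hm hJ).eventually (by simp)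
  have h2 := (contDiffAt_momAngular hm hJ).eventually (by simp)
  filter_upwards [(hM t₀ ht₀).eventually h1, (hM t₀ ht₀).eventually h2, self_mem_nhdsWithin]
    with t h3 h4 ht
  exact ⟨ContinuousAt.comp_continuousWithinAt (g := momLinear) h3.continuousAt (hM t ht),
    ContinuousAt.comp_continuousWithinAt (g := momAngular) h4.continuousAt (hM t ht)⟩

/-- The competitor `χ` is not known to be a characteristic function, nor to have nondegenerate
moments at later times. Agreement at `t₀` gives nondegeneracy there, and continuity extends it to a
short interval. On it the moments are treated as prescribed, which yields a rigid motion `Y` that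
carries `χ`. -/
lemma exists_ae_eq_charFn_right (hd : IsBodyData T Ω S₀ u ρ) (hX : IsBodySolution S₀ u ρ T X)
    {f₀ : E3 → ℝ} (hχ : IsTransportSolution T (solidVelocity ρ χ u) f₀ χ) {t₀ : ℝ}
    (ht₀ : t₀ ∈ Ico 0 T) (h : χ t₀ =ᵐ[volume] charFn (affineMap (X t₀) '' S₀)) :
    ∃ δ > 0, t₀ + δ ≤ T ∧ ∀ t ∈ Icc t₀ (t₀ + δ),
      χ t =ᵐ[volume] charFn (affineMap (X t) '' S₀) := by
  have ht₀' : t₀ ∈ Icc 0 T := Ico_subset_Icc_self ht₀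
  have hΩm := hd.domain.isOpen.measurableSet
  obtain ⟨-, -, hρc, -⟩ := id hd.density
  have hmem : ∀ t ∈ Icc 0 T, MemLp (χ t) 2 volume := hχ.inClass.memLp 2 one_le_two ENNReal.ofNat_ne_top
  set M : ℝ → Moments := solidMoments ρ χ u with hMdef
  have hM : ContinuousOn M (Icc 0 T) :=
    continuousOn_solidMoments hd.domain.isOpen hd.domain.isBounded hd.velocity hρc hmem
      (hχ.inClass.continuous 2 one_le_two ENNReal.ofNat_ne_top)
  have hrig := hX.isRigid
  have hM₀ : M t₀ = bodyMoments S₀ ρ u t₀ (X t₀) :=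
    solidMoments_charFn hΩm hd.measurableSet (hrig t₀ ht₀') h
  have hm : (M t₀).1 ≠ 0 := by rw [hM₀]; exact (hX.mass_pos t₀ ht₀').ne'
  have hJ : (momInertia (M t₀)).det ≠ 0 := by
    rw [hM₀]
    exact (det_momInertia_bodyMoments_pos hd.domain hd.measurableSet hd.isBounded hd.velocity ht₀'
      (hd.nonneg t₀ ht₀') (hrig t₀ ht₀') (hX.mass_pos t₀ ht₀')).ne'
  -- The coefficients are functions of time alone, so the equation for `Y` is affine in the
  -- configuration and the moments have Lipschitz constant zero.
  have hlip : IsLipschitzNear T (fun t Z => configVelocity (M t, Z)) t₀ (X t₀) :=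
    IsLipschitzNear.of_comp (M := fun t _ => M t) (K := 0) ht₀'
      (contDiffAt_configVelocity hm hJ (X t₀)) one_pos
      (Eventually.of_forall fun t => (LipschitzWith.const (M t)).lipschitzOnWith)
      fun t ht _ _ => hM t ht
  obtain ⟨δ₁, hδ₁, hδ₁T, Y, hY0, hY⟩ := exists_isSolutionOn ht₀ hlip
  have hev := eventually_continuousWithinAt_coefficients ht₀' hM hm hJ
  have hev' := nhdsWithin_mono t₀ (Icc_subset_Icc_left ht₀.1) hev
  rw [nhdsWithin_Icc_eq_nhdsGE ht₀.2] at hev'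
  obtain ⟨c, hc1, hc2⟩ := mem_nhdsGE_iff_exists_Icc_subset.1 hev'
  have hc1' : t₀ < c := hc1
  set δ := min δ₁ (c - t₀) with hδ
  have hδpos : 0 < δ := lt_min hδ₁ (by linarith)
  have hδ1 : δ ≤ δ₁ := min_le_left _ _
  have hδ2 : δ ≤ c - t₀ := min_le_right _ _
  have hδT : t₀ + δ ≤ T := by linarith
  have hsub : Icc t₀ (t₀ + δ) ⊆ Icc 0 T := Icc_subset_Icc ht₀.1 hδT
  have hYlin : IsSolutionOn (linField (fun t => momLinear (M t)) (fun t => momAngular (M t)))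
      t₀ (t₀ + δ) Y := by
    intro t ht
    have h1 := hY.mono le_rfl (by linarith : t₀ + δ ≤ t₀ + δ₁) t ht
    beta_reduce at h1
    rw [configVelocity_eq_linField M] at h1
    exact h1
  have hYr := hYlin.isRigid (by rw [hY0]; exact hrig t₀ ht₀')
  have ha : ContinuousOn (fun t => momLinear (M t)) (Icc t₀ (t₀ + δ)) := fun t ht =>
    (hc2 ⟨ht.1, by linarith [ht.2]⟩).1.mono hsub
  have hw : ContinuousOn (fun t => momAngular (M t)) (Icc t₀ (t₀ + δ)) := fun t ht =>
    (hc2 ⟨ht.1, by linarith [ht.2]⟩).2.mono hsub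
  have hflow := hχ.comp_flow_ae_eq ht₀.1 hδT ha hw
    (fun t ht x => solidVelocity_eq hd.domain.isOpen hd.domain.isBounded hd.velocity
      (hsub (Ioo_subset_Icc_self ht)) (hmem t (hsub (Ioo_subset_Icc_self ht))) x)
    hYlin (by rw [hY0]; exact hrig t₀ ht₀')
  have h0 : (fun y => χ t₀ (affineMap (Y t₀) y)) =ᵐ[volume] charFn S₀ := by
    rw [hY0]
    refine ((hrig t₀ ht₀').ae_eq_comp h).trans (Eventually.of_forall fun y => ?_)
    simp only [(hrig t₀ ht₀').charFn_image, (hrig t₀ ht₀').invConfig_affineMap]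
  have hχY : ∀ t ∈ Icc t₀ (t₀ + δ), χ t =ᵐ[volume] charFn (affineMap (Y t) '' S₀) := by
    intro t ht
    refine ((hYr t ht).ae_eq_comp_inv ((hflow t ht).trans h0)).trans
      (Eventually.of_forall fun x => ?_)
    simp only [(hYr t ht).charFn_image]
  -- Now that `χ t` is known to be the characteristic function of the body moved by `Y`, the
  -- prescribed moments are those of the body, and `Y` solves the nonlinear equation; uniqueness
  -- identifies it with `X`.
  have hYbody : IsSolutionOn (bodyField S₀ ρ u) t₀ (t₀ + δ) Y := by
    intro t ht
    have h1 := hY.mono le_rfl (by linarith : t₀ + δ ≤ t₀ + δ₁) t ht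
    have h2 : M t = bodyMoments S₀ ρ u t (Y t) :=
      solidMoments_charFn hΩm hd.measurableSet (hYr t ht) (hχY t ht)
    beta_reduce at h1
    rw [h2] at h1
    exact h1
  have hXY : EqOn X Y (Icc t₀ (t₀ + δ)) :=
    (hX.solves.mono ht₀.1 hδT).eqOn ht₀.1 hδT hYbody hY0.symm fun t ht =>
      hX.isLipschitzNear hd le_rfl (hsub (Ico_subset_Icc_self ht))
  refine ⟨δ, hδpos, hδT, fun t ht => ?_⟩
  rw [hXY ht]
  exact hχY t ht

lemma continuousOn_integral_abs_sub {f g : ℝ → E3 → ℝ} (hf : InSolutionClass T f)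
    (hg : InSolutionClass T g) : ContinuousOn (fun t => ∫ x, |f t x - g t x|) (Icc 0 T) := by
  intro t ht
  rw [ContinuousWithinAt, tendsto_iff_dist_tendsto_zero]
  have hlim := (hf.tendsto_integral_abs ht).add (hg.tendsto_integral_abs ht)
  rw [add_zero] at hlim
  refine tendsto_of_tendsto_of_tendsto_of_le_of_le' tendsto_const_nhds hlim
    (Eventually.of_forall fun _ => dist_nonneg) ?_
  filter_upwards [self_mem_nhdsWithin] with s hs
  have i1 := hf.integrable hs
  have i2 := hf.integrable ht
  have i3 := hg.integrable hs
  have i4 := hg.integrable ht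
  have j1 : Integrable fun x => |f s x - g s x| := (i1.sub i3).abs
  have j2 : Integrable fun x => |f t x - g t x| := (i2.sub i4).abs
  have j3 : Integrable fun x => |f s x - f t x| := (i1.sub i2).abs
  have j4 : Integrable fun x => |g s x - g t x| := (i3.sub i4).abs
  rw [Real.dist_eq, ← integral_sub j1 j2, ← integral_add j3 j4]
  refine abs_integral_le_integral_abs.trans (integral_mono (j1.sub j2).abs (j3.add j4) fun x => ?_)
  refine (abs_abs_sub_abs_le_abs_sub _ _).trans ?_
  have : f s x - g s x - (f t x - g t x) = (f s x - f t x) - (g s x - g t x) := by ring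
  rw [this]
  exact abs_sub _ _

/-- A weak solution of the transport equation with its own field is the characteristic function of
the moving body. -/
theorem IsTransportSolution.ae_eq_charFn (hd : IsBodyData T Ω S₀ u ρ) (hT : 0 < T)
    (hX : IsBodySolution S₀ u ρ T X) (hχ : IsTransportSolution T (solidVelocity ρ χ u) (charFn S₀) χ)
    {ζ : ℝ → E3 → ℝ} (hζ : InSolutionClass T ζ)
    (hζX : ∀ t ∈ Icc 0 T, ζ t = charFn (affineMap (X t) '' S₀)) :
    ∀ t ∈ Icc 0 T, χ t =ᵐ[volume] ζ t := by
  have hiff : ∀ t ∈ Icc 0 T, (∫ x, |χ t x - ζ t x|) = 0 ↔ χ t =ᵐ[volume] ζ t := by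
    intro t ht
    have hi : Integrable fun x => |χ t x - ζ t x| :=
      ((hχ.inClass.integrable ht).sub (hζ.integrable ht)).abs
    rw [integral_eq_zero_iff_of_nonneg (fun x => abs_nonneg _) hi]
    constructor
    · intro h
      filter_upwards [h] with x hx
      exact sub_eq_zero.1 (abs_eq_zero.1 hx)
    · intro h
      filter_upwards [h] with x hx
      simp [hx]
  -- Continuous induction on the times of agreement, which form a closed set because both curves are
  -- continuous in L¹.
  set A := {t : ℝ | (∫ x, |χ t x - ζ t x|) = 0} with hA
  have hclosed : IsClosed (A ∩ Icc 0 T) := by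
    rw [inter_comm]
    exact (continuousOn_integral_abs_sub hχ.inClass hζ).preimage_isClosed_of_isClosed isClosed_Icc
      (isClosed_singleton (x := (0 : ℝ)))
  have h0I : (0 : ℝ) ∈ Icc 0 T := ⟨le_rfl, hT.le⟩
  have h0 : (0 : ℝ) ∈ A := by
    refine (hiff 0 h0I).2 (hχ.initial.trans ?_)
    rw [hζX 0 h0I, hX.start, affineMap_id, image_id]
  have hsub := hclosed.Icc_subset_of_forall_exists_gt h0 fun t ⟨htA, ht⟩ y hy => by
    have hy' : t < y := hy
    have ht' := Ico_subset_Icc_self ht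
    have h1 := (hiff t ht').1 htA
    rw [hζX t ht'] at h1
    obtain ⟨δ, hδ, hδT, hloc⟩ := exists_ae_eq_charFn_right hd hX hχ ht h1
    have hlt : t < min (t + δ) y := lt_min (by linarith) hy'
    have hI : min (t + δ) y ∈ Icc 0 T :=
      ⟨ht.1.trans hlt.le, (min_le_left _ _).trans hδT⟩
    refine ⟨min (t + δ) y, (hiff _ hI).2 ?_, hlt, min_le_right _ _⟩
    rw [hζX _ hI]
    exact hloc _ ⟨hlt.le, min_le_left _ _⟩
  exact fun t ht => (hiff t ht).1 (hsub ht)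

/-! ### Bounded representatives -/

/-- A measurable representative is truncated at the essential supremum. The bound then holds at
every point, and so it survives composition with any configuration. -/
lemma exists_bounded_representative {f : E3 → ℝ} (hf : MemLp f ⊤ volume) :
    ∃ g : E3 → ℝ, Measurable g ∧ g =ᵐ[volume] f ∧ ∃ B, ∀ x, |g x| ≤ B := by
  set B := (eLpNorm f ⊤ volume).toReal with hB
  have hB0 : 0 ≤ B := ENNReal.toReal_nonneg
  have hfB : ∀ᵐ x, |f x| ≤ B := by
    filter_upwards [ae_le_eLpNormEssSup (f := f) (μ := (volume : Measure E3))] with x hx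
    rw [← eLpNorm_exponent_top, ← ENNReal.ofReal_toReal hf.eLpNorm_ne_top] at hx
    exact norm_le_of_enorm_le hB0 hx
  have hm := hf.aestronglyMeasurable
  refine ⟨fun x => max (-B) (min B (hm.mk f x)),
    measurable_const.max (measurable_const.min hm.stronglyMeasurable_mk.measurable), ?_, B,
    fun x => abs_le.2 ⟨le_max_left _ _, max_le (by linarith) (min_le_left _ _)⟩⟩
  filter_upwards [hfB, hm.ae_eq_mk] with x h1 h2
  rw [← h2, min_eq_right (abs_le.1 h1).2, max_eq_right (abs_le.1 h1).1]

end CharUniqueness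

/-! ### The motion of the body as a flow defined for all times -/

section Assembly

variable {T : ℝ} {Ω S₀ : Set E3} {u : ℝ → E3 → E3} {ρ : ℝ → L2 Ω ℝ} {X : ℝ → Config}

lemma linField_congr {a a' w w' : ℝ → E3} {t : ℝ} (ha : a t = a' t) (hw : w t = w' t) (Z : Config) :
    linField a w t Z = linField a' w' t Z := by
  rw [linField, linField, ha, hw]

/-- A continuous family of rigid configurations, defined for all times, that moves the body on
`[0,T]`, with the coefficients of its field. -/
structure IsBodyFlow {Ω : Set E3} (T : ℝ) (S₀ : Set E3) (u : ℝ → E3 → E3) (ρ : ℝ → L2 Ω ℝ)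
    (X : ℝ → Config) (a w : ℝ → E3) : Prop where
  solution : IsBodySolution S₀ u ρ T X
  continuous : Continuous X
  isRigid : ∀ t, IsRigid (X t)
  continuous_linear : Continuous a
  continuous_angular : Continuous w
  coefficients : ∀ t ∈ Icc 0 T, a t = momLinear (bodyMoments S₀ ρ u t (X t)) ∧
    w t = momAngular (bodyMoments S₀ ρ u t (X t))

lemma IsBodySolution.exists_isBodyFlow (hd : IsBodyData T Ω S₀ u ρ) (hT : 0 < T)
    (hX : IsBodySolution S₀ u ρ T X) : ∃ Z a w, IsBodyFlow T S₀ u ρ Z a w := by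
  -- Constant continuation outside `[0, T]` makes the motion continuous and rigid for all times.
  set Z : ℝ → Config := IccExtend hT.le ((Icc 0 T).domRestrict X) with hZ
  have hZX : EqOn Z X (Icc 0 T) := fun t ht => extend_eq hT.le ht
  have hZs : IsBodySolution S₀ u ρ T Z := hX.congr hT.le hZX
  set M : ℝ → Moments := fun t => bodyMoments S₀ ρ u t (Z t) with hM
  have hMc : ContinuousOn M (Icc 0 T) := fun t ht =>
    continuousWithinAt_bodyMoments_comp hd.domain hd.measurableSet hd.isBounded hd.velocity
      hd.density le_rfl ht (hZs.solves.continuousOn t ht) (hZs.isRigid t ht)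
  have hJ : ∀ t ∈ Icc 0 T, (momInertia (M t)).det ≠ 0 := fun t ht =>
    (det_momInertia_bodyMoments_pos hd.domain hd.measurableSet hd.isBounded hd.velocity ht
      (hd.nonneg t ht) (hZs.isRigid t ht) (hZs.mass_pos t ht)).ne'
  have hc : ∀ t ∈ Icc 0 T, ContinuousWithinAt (fun t => momLinear (M t)) (Icc 0 T) t ∧
      ContinuousWithinAt (fun t => momAngular (M t)) (Icc 0 T) t := fun t ht =>
    (eventually_continuousWithinAt_coefficients ht hMc (hZs.mass_pos t ht).ne'
      (hJ t ht)).self_of_nhdsWithin ht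
  refine ⟨Z, IccExtend hT.le ((Icc 0 T).domRestrict fun t => momLinear (M t)),
    IccExtend hT.le ((Icc 0 T).domRestrict fun t => momAngular (M t)), hZs,
    hX.solves.continuousOn.domRestrict.Icc_extend', fun t => hX.isRigid _ (projIcc 0 T hT.le t).2,
    continuous_extend hT.le fun t ht => (hc t ht).1,
    continuous_extend hT.le fun t ht => (hc t ht).2,
    fun t ht => ⟨extend_eq hT.le ht, extend_eq hT.le ht⟩⟩

namespace IsBodyFlow

variable {a w : ℝ → E3}

lemma solves (h : IsBodyFlow T S₀ u ρ X a w) : IsSolutionOn (linField a w) 0 T X := by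
  have h1 := h.solution.solves.linField_of_bodyField
    (M := fun t => bodyMoments S₀ ρ u t (X t)) fun _ _ => rfl
  intro t ht
  have h2 := h1 t ht
  rwa [linField_congr (h.coefficients t ht).1.symm (h.coefficients t ht).2.symm] at h2

lemma affineMap_zero (h : IsBodyFlow T S₀ u ρ X a w) : affineMap (X 0) = id := by
  rw [h.solution.start, affineMap_id]

lemma affineMap_inv_zero (h : IsBodyFlow T S₀ u ρ X a w) (y : E3) :
    affineMap (invConfig (X 0)) y = y := by
  have h1 := (h.isRigid 0).affineMap_invConfig_self y
  rwa [h.affineMap_zero] at h1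

/-- The field determined by the moving body. -/
lemma solidVelocity_eq (hd : IsBodyData T Ω S₀ u ρ) (h : IsBodyFlow T S₀ u ρ X a w)
    {χ : ℝ → E3 → ℝ} (hχ : ∀ t, χ t = charFn (affineMap (X t) '' S₀)) {t : ℝ} (ht : t ∈ Icc 0 T)
    (x : E3) : solidVelocity ρ χ u t x = a t + cross (w t) x := by
  have hL : MemLp (χ t) 2 volume := by
    rw [hχ t]
    exact memLp_charFn ((h.isRigid t).measurableSet_image hd.measurableSet)
      ((h.isRigid t).isBounded_image hd.isBounded) 2
  rw [RigidTransport.solidVelocity_eq hd.domain.isOpen hd.domain.isBounded hd.velocity ht hL,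
    solidMoments_charFn hd.domain.isOpen.measurableSet hd.measurableSet (h.isRigid t)
      (by rw [hχ t]), (h.coefficients t ht).1, (h.coefficients t ht).2]

lemma nondegenerate (hd : IsBodyData T Ω S₀ u ρ) (h : IsBodyFlow T S₀ u ρ X a w)
    {χ : ℝ → E3 → ℝ} (hχ : ∀ t, χ t = charFn (affineMap (X t) '' S₀)) {t : ℝ} (ht : t ∈ Icc 0 T) :
    0 < mass Ω (solidDensity ρ χ t) ∧ IsUnit (inertia Ω (solidDensity ρ χ t)).det := by
  have hL : MemLp (χ t) 2 volume := by
    rw [hχ t]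
    exact memLp_charFn ((h.isRigid t).measurableSet_image hd.measurableSet)
      ((h.isRigid t).isBounded_image hd.isBounded) 2
  have hM : solidMoments ρ χ u t = bodyMoments S₀ ρ u t (X t) :=
    solidMoments_charFn hd.domain.isOpen.measurableSet hd.measurableSet (h.isRigid t) (by rw [hχ t])
  rw [mass_solidDensity hd.domain.isOpen hd.domain.isBounded hd.velocity ht hL,
    inertia_solidDensity hd.domain.isOpen hd.domain.isBounded hd.velocity ht hL, hM]
  exact ⟨h.solution.mass_pos t ht, isUnit_iff_ne_zero.2
    (det_momInertia_bodyMoments_pos hd.domain hd.measurableSet hd.isBounded hd.velocity ht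
      (hd.nonneg t ht) (h.isRigid t) (h.solution.mass_pos t ht)).ne'⟩

/-- Existence and uniqueness for the transport equation in the field of the moving body, for
bounded initial data that vanish outside the body. -/
lemma exists_unique_transport (hd : IsBodyData T Ω S₀ u ρ) (hT : 0 < T)
    (h : IsBodyFlow T S₀ u ρ X a w) {v : ℝ → E3 → E3}
    (hv : ∀ t ∈ Icc 0 T, ∀ x, v t x = a t + cross (w t) x) {ρ₀ : E3 → ℝ}
    (hρ₀ : MemLp (S₀.indicator ρ₀) ⊤ volume) :
    ∃ r : ℝ → E3 → ℝ, IsTransportSolution T v (S₀.indicator ρ₀) r ∧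
      ∀ r' : ℝ → E3 → ℝ, IsTransportSolution T v (S₀.indicator ρ₀) r' →
        ∀ t ∈ Icc 0 T, r' t =ᵐ[volume] r t := by
  obtain ⟨g, hgm, hge, B, hB⟩ := exists_bounded_representative hρ₀
  -- Bounded data supported in a set of finite measure belong to every `L^p`.
  have hLp : ∀ p : ℝ≥0∞, 1 ≤ p → p ≠ ⊤ → MemLp g p volume := fun p _ _ =>
    (hρ₀.mono_exponent_of_measure_support_ne_top (s := S₀)
      (fun x hx => indicator_of_notMem hx _) hd.isBounded.measure_lt_top.ne le_top).ae_eq hge.symm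
  have hsol := isTransportSolution_comp_inv hT h.continuous_linear h.continuous_angular hv
    h.continuous h.isRigid h.solves h.affineMap_zero hgm hB hLp
  refine ⟨_, ⟨hsol.inClass, hsol.equation, hsol.initial.trans hge⟩, fun r' hr' t ht => ?_⟩
  have hflow := hr'.comp_flow_ae_eq le_rfl le_rfl h.continuous_linear.continuousOn
    h.continuous_angular.continuousOn (fun t ht x => hv t (Ioo_subset_Icc_self ht) x) h.solves
    (h.isRigid 0) t ht
  refine (h.isRigid t).ae_eq_comp_inv (hflow.trans ?_)
  rw [h.affineMap_zero]
  exact hr'.initial.trans hge.symm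

end IsBodyFlow

end Assembly

end RigidTransport

end

/-! ### The theorem -/

open RigidTransport
theorem proposition3p1
    (T : ℝ) (hT : 0 < T)
    (Ω S₀ : Set E3) (hΩ : IsRegularDomain Ω) (hS₀ : IsRegularDomain S₀) (hSΩ : closure S₀ ⊆ Ω)
    (u : ℝ → E3 → E3) (hu : IsContinuousSmooth T Ω u)
    (ρ : ℝ → L2 Ω ℝ) (hρ2 : IsSquareIntegrableH2 T Ω ρ) (hρ1 : IsContinuousH1 T Ω ρ)
    (hρ_nonneg : ∀ t ∈ Icc 0 T, ∀ᵐ x ∂(volume.restrict Ω), 0 ≤ ρ t x)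
    (hρ_body : 0 < ∫ x in S₀, ρ 0 x) :
    (∃ τ ∈ Ioc 0 T, MassPersists S₀ u ρ τ) ∧
    (MassPersists S₀ u ρ T →
      ∃ (χ : ℝ → E3 → ℝ) (η : ℝ → ℝ → E3 → E3),
        -- `χ` is the unique solution, and `P_S u` is well defined along it
        IsTransportSolution T (solidVelocity ρ χ u) (charFn S₀) χ ∧
        (∀ t ∈ Icc 0 T, 0 < mass Ω (solidDensity ρ χ t) ∧
          IsUnit (inertia Ω (solidDensity ρ χ t)).det) ∧
        (∀ χ' : ℝ → E3 → ℝ, IsTransportSolution T (solidVelocity ρ χ' u) (charFn S₀) χ' →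
          ∀ t ∈ Icc 0 T, χ' t =ᵐ[volume] χ t) ∧
        -- it is the characteristic function of `S(t) = η_{t,0}(S₀)`
        (∀ t ∈ Icc 0 T, ∀ x, χ t x = charFn (η t 0 '' S₀) x) ∧
        -- `η` is the isometric propagator of `P_S u`
        IsPropagator T (solidVelocity ρ χ u) η ∧
        (∀ η' : ℝ → ℝ → E3 → E3, IsPropagator T (solidVelocity ρ χ u) η' →
          ∀ t ∈ Icc 0 T, ∀ s ∈ Icc 0 T, ∀ y, η' t s y = η t s y) ∧
        (∀ t ∈ Icc 0 T, ∀ s ∈ Icc 0 T, Isometry (η t s)) ∧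
        IsC1SmoothLoc T (fun q => η q.1 q.2) ∧
        -- the transported solid density
        (∀ ρ₀ : E3 → ℝ, MemLp (S₀.indicator ρ₀) ⊤ volume →
          ∃ r : ℝ → E3 → ℝ,
            IsTransportSolution T (solidVelocity ρ χ u) (S₀.indicator ρ₀) r ∧
            ∀ r' : ℝ → E3 → ℝ,
              IsTransportSolution T (solidVelocity ρ χ u) (S₀.indicator ρ₀) r' →
              ∀ t ∈ Icc 0 T, r' t =ᵐ[volume] r t)) := by
  have hd : IsBodyData T Ω S₀ u ρ :=
    ⟨hΩ, hS₀.isOpen.measurableSet, hS₀.isBounded, hu, hρ1, hρ_nonneg⟩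
  -- In the rest position the body lies in `Ω`, so its mass is the integral of `ρ 0` over `S₀`.
  have hm : 0 < (bodyMoments S₀ ρ u 0 (ContinuousLinearMap.id ℝ E3, 0)).1 := by
    rw [← bodyMass_eq hd (η := fun _ => id) ⟨le_rfl, hT.le⟩ isRigid_id affineMap_id.symm]
    have h1 : mass Ω (solidDensity ρ (fun _ => charFn (id '' S₀)) 0) = ∫ x in S₀, ρ 0 x := by
      rw [mass, image_id, ← integral_indicator hΩ.isOpen.measurableSet,
        ← integral_indicator hS₀.isOpen.measurableSet]
      refine integral_congr_ae (Eventually.of_forall fun x => ?_)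
      by_cases hx : x ∈ S₀
      · have hxΩ : x ∈ Ω := hSΩ (subset_closure hx)
        simp [hx, hxΩ, solidDensity, charFn]
      · by_cases hxΩ : x ∈ Ω <;> simp [hx, hxΩ, solidDensity, charFn]
    exact hρ_body.trans_eq h1.symm
  refine ⟨exists_massPersists hd hT hm, fun hpers => ?_⟩
  obtain ⟨X₀, hX₀⟩ := exists_isBodySolution hd hT hm hpers
  obtain ⟨X, a, w, hX⟩ := hX₀.exists_isBodyFlow hd hT
  -- Written with the inverse configuration, this is literally the transported initial datum; it
  -- equals the characteristic function of the moved body at every point, not merely almost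
  -- everywhere.
  set χ : ℝ → E3 → ℝ := fun t x => charFn S₀ (affineMap (invConfig (X t)) x) with hχ
  have hχX : ∀ t, χ t = charFn (affineMap (X t) '' S₀) := fun t =>
    funext fun x => ((hX.isRigid t).charFn_image S₀ x).symm
  have hv : ∀ t ∈ Icc 0 T, ∀ x, solidVelocity ρ χ u t x = a t + cross (w t) x := fun t ht x =>
    hX.solidVelocity_eq hd hχX ht x
  have hsol : IsTransportSolution T (solidVelocity ρ χ u) (charFn S₀) χ :=
    isTransportSolution_comp_inv hT hX.continuous_linear hX.continuous_angular hv hX.continuous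
      hX.isRigid hX.solves hX.affineMap_zero (measurable_charFn hd.measurableSet)
      (abs_charFn_le S₀) fun p _ _ => memLp_charFn hd.measurableSet hd.isBounded p
  refine ⟨χ, rigidPropagator X, hsol, fun t ht => hX.nondegenerate hd hχX ht,
    fun χ' hχ' => hχ'.ae_eq_charFn hd hT hX.solution hsol.inClass fun t _ => hχX t,
    fun t _ x => ?_, isPropagator_rigidPropagator hv hX.isRigid hX.solves,
    fun η' hη' t ht s hs y => hη'.eq_rigidPropagator hv hX.isRigid hX.solves ht hs y,
    fun t _ s _ => isometry_rigidPropagator hX.isRigid t s,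
    isC1SmoothLoc_rigidPropagator hX.continuous_linear hX.continuous_angular hX.continuous
      hX.solves,
    fun ρ₀ hρ₀ => hX.exists_unique_transport hd hT hv hρ₀⟩
  have h1 : rigidPropagator X t 0 = affineMap (X t) := by
    funext y
    rw [rigidPropagator, hX.affineMap_inv_zero]
  rw [h1, hχX t]
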